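/- **Setting.** Let $1\le n<a$ be integers, let $\ell_1,\dots,\ell_n\ge 1$ be integers with $\sum_m \ell_m=a$, and put $J=\{(m,i): 1\le m\le n,\ 1\le i\le \ell_m\}$. Let $G$ be the simply connected quasi-Abelian nilpotent Lie group of dimension $a+1$ whose lattice $\Gamma$ is generated by $x$ and $y_i^{(m)}$, $(m,i)\in J$, the $y_i^{(m)}$ commuting and $x y_i^{(m)}x^{-1}=y_i^{(m)}y_{i+1}^{(m)}$ (with $y_{\ell_m+1}^{(m)}=1$); that is, $G=\mathbb R\ltimes_h\mathbb R^J$, $\Gamma=\mathbb Z\ltimes\mathbb Z^J$, $(h(t)v)_i^{(m)}=\sum_{j\le i}\binom{t}{i-j}v_j^{(m)}$. Let $\mathfrak g$ be the Lie algebra of $G$, $\xi=\log x$, $\tilde\eta_i^{(m)}=\log y_i^{(m)}$, let $\mathfrak a$ be the Abelian ideal spanned by the $\tilde\eta_i^{(m)}$, $A=\exp\mathfrak a$, $\omega$ the invariant volume form with $\omega(\xi,\tilde\eta)=1$, $M=\Gamma\backslash G$ and $dx$ the $G$-invariant probability measure on $M$. For $\alpha=(\alpha_i^{(m)})\in\mathbb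 R^J$ let $X_\alpha=\log\bigl(x^{-1}\exp(\sum\alpha_i^{(m)}\tilde\eta_i^{(m)})\bigr)$ and $\alpha_1=(\alpha_1^{(1)},\dots,\alpha_1^{(n)})$. Let $\Phi_\alpha$ be the first return map of the flow $\Gamma g\mapsto\Gamma g\exp(tX_\alpha)$ to the $A$-orbits (the return time is constantly $1$), so that $\Phi_\alpha^r$, $r\in\mathbb Z$, is the time-$r$ map of the flow. Let $(X_\alpha,Y)$, $Y=(Y_1,\dots,Y_a)$, be a normalised strongly adapted basis: $Y$ is a basis of $\mathfrak a$, $X_\alpha,Y_1,\dots,Y_n$ generate the Lie algebra $\mathfrak g$, $(Y_{n+1},\dots,Y_a)$ is a basis of $[\mathfrak g,\mathfrak g]$, and $|\omega(X_\alpha,Y)|=1$. Let $\bar Y=(\bar Y_1,\dots,\bar Y_n)\subset\mathbb R^n$ be the projection of $(Y_1,\dots,Y_n)$ modulo $[\mathfrak g,\mathfrak g]$, in the coordinates given by the classes of $\tilde\eta_1^{(1)},\dots,\tilde\eta_1^{(n)}$. **The function $H$.** Let $I=I(Y)$ be the supremum of all $I'\in(0,1/2)$ such that, for every $x\in M$,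 the map $s\mapsto x\exp(\sum s_iY_i)$ is injective on $(-I',I')^a$. For $x,x'\in M$ let $\|x'-x\|_i=|s_i|$ if $x'=x\exp(\sum s_kY_k)$ with $s\in[-I/2,I/2]^a$, and $\|x'-x\|_i=I$ if there is no such $s$. Given $\rho\in[0,1)^a$, $T>0$, $L\ge1$ and $r\in\mathbb Z\setminus\{0\}$, let $$\delta_{r,L}(x)=\max_{1\le i\le n}\min\{I,L^{\rho_i}\|\Phi_\alpha^r(x)-x\|_i\},\qquad \delta'_{r,L}(x)=\max_{n<i\le a}\min\{I,L^{\rho_i}\|\Phi_\alpha^r(x)-x\|_i\},$$ let $AP_{r,j,L}=\{x\in M:\ \delta_{r,L}(x)\le I/2,\ 2^{-(j+1)}I<\delta'_{r,L}(x)\le 2^{-j}I\}$, and $$h_{r,L}=\sum_{j\ge1}\min\Bigl\{2^{j(a-n)},\Bigl(\frac{2}{\delta_{r,L}}\Bigr)^n\Bigr\}\chi_{AP_{r,j,L}},\qquad H^T_L=1+\sum_{1\le|r|\le[TL]}h_{r,L}.$$ **The Diophantine condition.** Let $\bar I=\bar I(\bar Y)$ be the supremum of all $I'>0$ such that $s\mapsto\sum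 s_i\bar Y_i \bmod \mathbb Z^n$ is injective on $(-I',I')^n$; for $\theta\in\mathbb R^n$ let $|\theta|_i=|s_i|$ if $\theta\equiv\sum s_k\bar Y_k\bmod\mathbb Z^n$ with $s\in[-\bar I/2,\bar I/2]^n$, and $|\theta|_i=\bar I$ if there is no such $s$. Let $\sigma$ be a vector of $n$ positive numbers with sum $1$ and $\nu\ge1$. Then $D_n(\bar Y,\sigma,\nu)$ is the set of those $\alpha_1\in(\mathbb R\setminus\mathbb Q)^n$ for which there is a constant $C>0$ such that, for all integers $N\ge1$ and all $\delta>0$, $$\#\{r\in[-N,N]\cap\mathbb Z:\ |r\alpha_1|_i\le\delta^{\sigma_i}\ \text{for}\ 1\le i\le n\}\le C\max\{N^{1-1/\nu},N\delta\}.$$ For $\rho\in[0,1)^a$ put $\bar\rho=(\rho_1,\dots,\rho_n)$, $|\bar\rho|=\rho_1+\dots+\rho_n$; for $\alpha_1\in D_n(\bar Y,\bar\rho/|\bar\rho|,\nu)$ with constant $C$ put $C(\alpha_1)=1+C$ and $$\mathcal H(Y,\rho,\alpha)=1+I(Y)^{a-n}C(\alpha_1)\bigl\{1+\log^+[I(Y)^{-1}]+\log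 C(\alpha_1)\bigr\}.$$ Put also $$\kappa(Y)=\max\Bigl\{1,\ |\det\bar Y|^{-1}\max\{1,I(Y)/\bar I(\bar Y)\}^n\Bigr\};$$ thus $\kappa(Y)=1$ if $|\det\bar Y|\ge1$ and $I(Y)\le\bar I(\bar Y)$. **Theorem.** For all integers $1\le n<a$ and every $\nu\ge1$ there is a constant $K'=K'(a,n,\nu)>0$ such that the following holds for all $\ell_1,\dots,\ell_n\ge1$ with sum $a$, all $\alpha$ and all normalised strongly adapted bases $(X_\alpha,Y)$ as above, and every $\rho\in[0,1)^a$: if $\nu\le1/|\bar\rho|$ and $\alpha_1\in D_n(\bar Y,\bar\rho/|\bar\rho|,\nu)$, with any admissible constant $C$, then for all $T>0$ and all $L\ge1$ the function $H^T_L$ is integrable over $M$ and $$\Bigl|\int_M H^T_L(x)\,dx\Bigr|\ \le\ K'\max\Bigl\{1,\ \kappa(Y)\,\mathcal H(Y,\rho,\alpha)\,(1+T)\,(1+\log^+T+\log L)\,L^{1-\sum_{i=1}^a\rho_i}\Bigr\}.$$ In particular, if $\sum_{i=1}^a\rho_i\le1$ and $\kappa(Y)=1$, then $$\Bigl|\int_M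 H^T_L(x)\,dx\Bigr|\ \le\ K'\,\mathcal H(Y,\rho,\alpha)\,(1+T)\,(1+\log^+T+\log L)\,L^{1-\sum_{i=1}^a\rho_i}.$$ -/

import Mathlib

open MeasureTheory Set

namespace QuasiAbelian

noncomputable section

/-! ### The group, its lattice and the nilmanifold -/

/-- The index set `J = {(m, i) : 1 ≤ m ≤ n, 1 ≤ i ≤ i_m}`, with `i_m = ℓ m`; the second index
is counted from `0` here, so that the generators carry the indices `(m, 0)`. -/
abbrev JIdx {n : ℕ} (ℓ : Fin n → ℕ) : Type := (m : Fin n) × Fin (ℓ m)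

/-- The one-parameter group `h = h_{i_1} × ⋯ × h_{i_n}` of automorphisms of `ℝ^J`, where on every
block `h(1) (s_1, s_2, …, s_j) = (s_1, s_2 + s_1, …, s_j + s_{j-1})`; hence the `i`-th coordinate
of `h(t) s` is `∑_{j ≤ i} binom(t, i - j) s_j`. -/
def hAct {n : ℕ} (ℓ : Fin n → ℕ) (t : ℝ) (v : JIdx ℓ → ℝ) : JIdx ℓ → ℝ :=
  fun p => ∑ j ∈ Finset.Iic p.2, Ring.choose t ((p.2 : ℕ) - (j : ℕ)) * v ⟨p.1, j⟩

/-- The underlying set of the quasi-Abelian group `G = ℝ ⋉_h ℝ^J`. -/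
@[ext] structure QAGroup {n : ℕ} (ℓ : Fin n → ℕ) : Type where
  t : ℝ
  v : JIdx ℓ → ℝ

theorem hAct_zero_left {n : ℕ} (ℓ : Fin n → ℕ) (v : JIdx ℓ → ℝ) : hAct ℓ 0 v = v := by
  funext p
  unfold hAct
  rw [Finset.sum_eq_single p.2]
  · simp
  · intro j hj hne
    have hlt : (j : ℕ) < p.2 := lt_of_le_of_ne (Fin.le_def.1 (Finset.mem_Iic.1 hj)) (fun h => hne (Fin.ext h))
    rw [Ring.choose_zero_pos ℝ (by omega : 0 < (p.2 : ℕ) - (j : ℕ)), zero_mul]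
  · intro h
    simp at h

theorem hAct_zero_right {n : ℕ} (ℓ : Fin n → ℕ) (t : ℝ) : hAct ℓ t 0 = 0 := by
  funext p
  simp [hAct]

theorem hAct_vadd {n : ℕ} (ℓ : Fin n → ℕ) (t : ℝ) (v w : JIdx ℓ → ℝ) :
    hAct ℓ t (v + w) = hAct ℓ t v + hAct ℓ t w := by
  funext p
  simp [hAct, mul_add, Finset.sum_add_distrib]

theorem hAct_add {n : ℕ} (ℓ : Fin n → ℕ) (s t : ℝ) (v : JIdx ℓ → ℝ) :
    hAct ℓ (s + t) v = hAct ℓ s (hAct ℓ t v) := by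
  funext ⟨m, i⟩
  simp only [hAct, Finset.mul_sum]
  rw [Finset.sum_comm' (s' := fun k => Finset.Icc k i) (t' := Finset.Iic i)]
  · refine Finset.sum_congr rfl fun k hk => ?_
    have hk' : (k : ℕ) ≤ i := Fin.le_def.1 (Finset.mem_Iic.1 hk)
    rw [Ring.add_choose_eq _ (Commute.all s t), Finset.sum_mul]
    refine Finset.sum_bij' (fun (q : ℕ × ℕ) hq => (⟨k + q.2, ?_⟩ : Fin (ℓ m)))
      (fun (j : Fin (ℓ m)) _ => ((i : ℕ) - (j : ℕ), (j : ℕ) - (k : ℕ))) ?_ ?_ ?_ ?_ ?_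
    · have := Finset.HasAntidiagonal.mem_antidiagonal.1 hq
      have := i.isLt
      omega
    · intro q hq
      have := Finset.HasAntidiagonal.mem_antidiagonal.1 hq
      simp only [Finset.mem_Icc, Fin.le_def]
      omega
    · intro j hj
      simp only [Finset.mem_Icc, Fin.le_def] at hj
      rw [Finset.HasAntidiagonal.mem_antidiagonal]
      simp only
      omega
    · intro q hq
      have := Finset.HasAntidiagonal.mem_antidiagonal.1 hq
      ext
      · simp
        omega
      · simp
    · intro j hj
      simp only [Finset.mem_Icc, Fin.le_def] at hj
      ext
      simp
      omega
    · intro q hq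
      have := Finset.HasAntidiagonal.mem_antidiagonal.1 hq
      have h1 : (i : ℕ) - ((k : ℕ) + q.2) = q.1 := by omega
      have h2 : (k : ℕ) + q.2 - (k : ℕ) = q.2 := by omega
      simp only [h1, h2]
      ring
  · intro j k
    simp only [Finset.mem_Iic, Finset.mem_Icc, Fin.le_def]
    omega

/-- The twisted product `(t, v) (t', v') = (t + t', v + h(t) v')`. -/
instance instGroupQAGroup {n : ℕ} (ℓ : Fin n → ℕ) : Group (QAGroup ℓ) where
  mul g g' := ⟨g.t + g'.t, g.v + hAct ℓ g.t g'.v⟩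
  one := ⟨0, 0⟩
  inv g := ⟨-g.t, hAct ℓ (-g.t) (-g.v)⟩
  mul_assoc a b c := by
    refine QAGroup.ext (add_assoc _ _ _) ?_
    change a.v + hAct ℓ a.t b.v + hAct ℓ (a.t + b.t) c.v
      = a.v + hAct ℓ a.t (b.v + hAct ℓ b.t c.v)
    rw [hAct_vadd, hAct_add, add_assoc]
  one_mul a := by
    refine QAGroup.ext (zero_add _) ?_
    change 0 + hAct ℓ 0 a.v = a.v
    rw [hAct_zero_left, zero_add]
  mul_one a := by
    refine QAGroup.ext (add_zero _) ?_
    change a.v + hAct ℓ a.t 0 = a.v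
    rw [hAct_zero_right, add_zero]
  inv_mul_cancel a := by
    refine QAGroup.ext (neg_add_cancel _) ?_
    change hAct ℓ (-a.t) (-a.v) + hAct ℓ (-a.t) a.v = 0
    rw [← hAct_vadd, neg_add_cancel, hAct_zero_right]

/-- The Borel structure of `G`, that is, of `ℝ × ℝ^J`. -/
instance instMeasurableSpaceQAGroup {n : ℕ} (ℓ : Fin n → ℕ) : MeasurableSpace (QAGroup ℓ) :=
  MeasurableSpace.comap (fun g => (g.t, g.v)) inferInstance

/-- The generator `x = (1, 0)`. -/
def xGen {n : ℕ} (ℓ : Fin n → ℕ) : QAGroup ℓ := ⟨1, 0⟩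

/-- The generators `y_i^{(m)}`: the standard basis of `{0} × ℤ^J`. -/
def yGen {n : ℕ} (ℓ : Fin n → ℕ) (p : JIdx ℓ) : QAGroup ℓ := ⟨0, Pi.single p 1⟩

/-- The lattice `Γ = ℤ ⋉ ℤ^J` generated by `x` and the `y_i^{(m)}`. -/
def lattice {n : ℕ} (ℓ : Fin n → ℕ) : Subgroup (QAGroup ℓ) :=
  Subgroup.closure (insert (xGen ℓ) (Set.range (yGen ℓ)))

/-- The nilmanifold `M = Γ \ G`, the space of cosets `Γ g`. -/
abbrev Nil {n : ℕ} (ℓ : Fin n → ℕ) : Type := Quotient (QuotientGroup.rightRel (lattice ℓ))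

/-- The point `Γ g` of `M`. -/
def toNil {n : ℕ} (ℓ : Fin n → ℕ) (g : QAGroup ℓ) : Nil ℓ := Quotient.mk _ g

/-- The right action of `G` on `M`: `(Γ g₀) g = Γ (g₀ g)`. -/
def act {n : ℕ} {ℓ : Fin n → ℕ} (x : Nil ℓ) (g : QAGroup ℓ) : Nil ℓ :=
  Quotient.map (fun g₀ => g₀ * g)
    (fun a b h => by
      have h' : QuotientGroup.rightRel (lattice ℓ) a b := h
      change QuotientGroup.rightRel (lattice ℓ) (a * g) (b * g)
      rw [QuotientGroup.rightRel_apply] at h' ⊢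
      simpa [mul_assoc] using h') x

/-- The `G`-invariant probability measure of `M`: Lebesgue measure `dt dv` on `G`, restricted to
the fundamental domain `[0,1) × [0,1)^J` of `Γ` and projected to `M`. -/
def nilMeasure {n : ℕ} (ℓ : Fin n → ℕ) : Measure (Nil ℓ) :=
  Measure.map (fun z : ℝ × (JIdx ℓ → ℝ) => toNil ℓ ⟨z.1, z.2⟩)
    (volume.restrict (Set.Ico (0 : ℝ) 1 ×ˢ Set.univ.pi fun _ => Set.Ico (0 : ℝ) 1))

/-! ### The Lie algebra and the exponential map -/

/-- The Lie algebra `𝔤` of `G`; the pair `(c, v)` stands for `c ξ + ∑ v_i^{(m)} η̃_i^{(m)}`, where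
`ξ = log x` and `η̃_i^{(m)} = log y_i^{(m)}`. -/
def QALie {n : ℕ} (ℓ : Fin n → ℕ) : Type := ℝ × (JIdx ℓ → ℝ)

instance instAddCommGroupQALie {n : ℕ} (ℓ : Fin n → ℕ) : AddCommGroup (QALie ℓ) :=
  inferInstanceAs (AddCommGroup (ℝ × (JIdx ℓ → ℝ)))

instance instModuleQALie {n : ℕ} (ℓ : Fin n → ℕ) : Module ℝ (QALie ℓ) :=
  inferInstanceAs (Module ℝ (ℝ × (JIdx ℓ → ℝ)))

/-- `ad ξ` on the Abelian ideal:
`[ξ, η̃_j^{(m)}] = ∑_{i > j} (-1)^{i-j-1} / (i - j) η̃_i^{(m)}`. -/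
def adXi {n : ℕ} (ℓ : Fin n → ℕ) : (JIdx ℓ → ℝ) →ₗ[ℝ] (JIdx ℓ → ℝ) where
  toFun v := fun p => ∑ j ∈ Finset.Iio p.2,
    (-1 : ℝ) ^ ((p.2 : ℕ) - (j : ℕ) - 1) / (((p.2 : ℕ) : ℝ) - ((j : ℕ) : ℝ)) * v ⟨p.1, j⟩
  map_add' v w := by
    funext p
    simp [mul_add, Finset.sum_add_distrib]
  map_smul' c v := by
    funext p
    simp only [Pi.smul_apply, smul_eq_mul, RingHom.id_apply, Finset.mul_sum]
    exact Finset.sum_congr rfl fun j _ => by ring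

instance instBracketQALie {n : ℕ} (ℓ : Fin n → ℕ) : Bracket (QALie ℓ) (QALie ℓ) where
  bracket u w := ((0 : ℝ), u.1 • adXi ℓ w.2 - w.1 • adXi ℓ u.2)

instance instLieRingQALie {n : ℕ} (ℓ : Fin n → ℕ) : LieRing (QALie ℓ) where
  add_lie u u' w := by
    refine Prod.ext (add_zero (0 : ℝ)).symm ?_
    change (u.1 + u'.1) • adXi ℓ w.2 - w.1 • adXi ℓ (u.2 + u'.2)
      = (u.1 • adXi ℓ w.2 - w.1 • adXi ℓ u.2) + (u'.1 • adXi ℓ w.2 - w.1 • adXi ℓ u'.2)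
    rw [map_add]
    module
  lie_add u w w' := by
    refine Prod.ext (add_zero (0 : ℝ)).symm ?_
    change u.1 • adXi ℓ (w.2 + w'.2) - (w.1 + w'.1) • adXi ℓ u.2
      = (u.1 • adXi ℓ w.2 - w.1 • adXi ℓ u.2) + (u.1 • adXi ℓ w'.2 - w'.1 • adXi ℓ u.2)
    rw [map_add]
    module
  lie_self u := Prod.ext rfl (sub_self (u.1 • adXi ℓ u.2))
  leibniz_lie u w z := by
    refine Prod.ext (add_zero (0 : ℝ)).symm ?_
    change u.1 • adXi ℓ (w.1 • adXi ℓ z.2 - z.1 • adXi ℓ w.2) - (0 : ℝ) • adXi ℓ u.2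
      = ((0 : ℝ) • adXi ℓ z.2 - z.1 • adXi ℓ (u.1 • adXi ℓ w.2 - w.1 • adXi ℓ u.2))
        + (w.1 • adXi ℓ (u.1 • adXi ℓ z.2 - z.1 • adXi ℓ u.2) - (0 : ℝ) • adXi ℓ w.2)
    simp only [map_sub, map_smul]
    module

instance instLieAlgebraQALie {n : ℕ} (ℓ : Fin n → ℕ) : LieAlgebra ℝ (QALie ℓ) where
  lie_smul c u w := by
    refine Prod.ext (mul_zero c).symm ?_
    change u.1 • adXi ℓ (c • w.2) - (c * w.1) • adXi ℓ u.2
      = c • (u.1 • adXi ℓ w.2 - w.1 • adXi ℓ u.2)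
    rw [map_smul]
    module

/-- The element `∑ w_i^{(m)} η̃_i^{(m)}` of the Abelian ideal `𝔞`. -/
def ofIdeal {n : ℕ} {ℓ : Fin n → ℕ} (w : JIdx ℓ → ℝ) : QALie ℓ := ((0 : ℝ), w)

/-- The exponential map of `G`: the curve `s ↦ (s c, ∫_0^s h(r c) v dr)` is the one-parameter
subgroup with initial velocity `(c, v)`. -/
def gexp {n : ℕ} {ℓ : Fin n → ℕ} (u : QALie ℓ) : QAGroup ℓ :=
  ⟨u.1, fun p => ∫ s in (0 : ℝ)..1, hAct ℓ (s * u.1) u.2 p⟩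

theorem continuous_choose (k : ℕ) : Continuous fun t : ℝ => Ring.choose t k := by
  have h : (fun t : ℝ => Ring.choose t k)
      = fun t : ℝ => ((k.factorial : ℝ))⁻¹ * (Polynomial.aeval t (descPochhammer ℤ k)) := by
    funext t
    rw [Ring.choose_eq_smul, Polynomial.aeval_eq_smeval, smul_eq_mul]
  rw [h]
  have h2 : Continuous fun t : ℝ => Polynomial.aeval t (descPochhammer ℤ k) :=
    Polynomial.continuous_aeval _
  exact continuous_const.mul h2

theorem gexp_v {n : ℕ} {ℓ : Fin n → ℕ} (u : QALie ℓ) (p : JIdx ℓ) :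
    (gexp u).v p = ∑ j ∈ Finset.Iic p.2,
      (∫ s in (0 : ℝ)..1, Ring.choose (s * u.1) ((p.2 : ℕ) - (j : ℕ))) * u.2 ⟨p.1, j⟩ := by
  change (∫ s in (0 : ℝ)..1, hAct ℓ (s * u.1) u.2 p) = _
  unfold hAct
  rw [intervalIntegral.integral_finsetSum]
  · simp only [intervalIntegral.integral_mul_const]
  · intro j _
    exact (((continuous_choose _).comp (continuous_id.mul continuous_const)).mul
      continuous_const).intervalIntegrable _ _

theorem gexp_bijective {n : ℕ} {ℓ : Fin n → ℕ} :
    Function.Bijective (gexp : QALie ℓ → QAGroup ℓ) := by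
  let E : ℝ → (JIdx ℓ → ℝ) →ₗ[ℝ] (JIdx ℓ → ℝ) := fun c =>
    { toFun := fun v p => ∑ j ∈ Finset.Iic p.2,
        (∫ s in (0 : ℝ)..1, Ring.choose (s * c) ((p.2 : ℕ) - (j : ℕ))) * v ⟨p.1, j⟩
      map_add' := fun v w => by
        funext p
        simp [mul_add, Finset.sum_add_distrib]
      map_smul' := fun a v => by
        funext p
        simp only [Pi.smul_apply, smul_eq_mul, RingHom.id_apply, Finset.mul_sum]
        exact Finset.sum_congr rfl fun j _ => by ring }
  have hE : ∀ u : QALie ℓ, gexp u = ⟨u.1, E u.1 u.2⟩ := fun u =>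
    QAGroup.ext rfl (funext fun p => gexp_v u p)
  have hinj : ∀ c, Function.Injective (E c) := by
    intro c
    rw [injective_iff_map_eq_zero]
    intro v hv
    have key : ∀ (m : Fin n) (k : ℕ) (hk : k < ℓ m), v ⟨m, ⟨k, hk⟩⟩ = 0 := by
      intro m k
      induction k using Nat.strong_induction_on with
      | _ k ih =>
        intro hk
        have h := congrFun hv ⟨m, ⟨k, hk⟩⟩
        change ∑ j ∈ Finset.Iic (⟨k, hk⟩ : Fin (ℓ m)),
          (∫ s in (0 : ℝ)..1, Ring.choose (s * c) (k - (j : ℕ))) * v ⟨m, j⟩ = 0 at h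
        rw [Finset.sum_eq_single ⟨k, hk⟩] at h
        · simpa [Ring.choose_zero_right] using h
        · intro j hj hne
          have hle : (j : ℕ) ≤ k := Fin.le_def.1 (Finset.mem_Iic.1 hj)
          have hlt : (j : ℕ) < k := lt_of_le_of_ne hle (fun h => hne (Fin.ext h))
          rw [show v ⟨m, j⟩ = 0 from ih j hlt j.isLt, mul_zero]
        · intro h'
          simp at h'
    funext ⟨m, i⟩
    exact key m i i.isLt
  constructor
  · intro u w h
    rw [hE, hE] at h
    have h1 : u.1 = w.1 := congrArg QAGroup.t h
    have h2 : E u.1 u.2 = E w.1 w.2 := congrArg QAGroup.v h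
    rw [← h1] at h2
    exact Prod.ext h1 (hinj _ h2)
  · intro g
    obtain ⟨v, hv⟩ := (LinearMap.injective_iff_surjective.1 (hinj g.t)) g.v
    let u : QALie ℓ := (g.t, v)
    exact ⟨u, (hE u).trans (QAGroup.ext rfl hv)⟩

/-- The inverse `log : G → 𝔤` of the exponential map. -/
def glog {n : ℕ} {ℓ : Fin n → ℕ} : QAGroup ℓ → QALie ℓ :=
  (Equiv.ofBijective gexp gexp_bijective).symm

/-! ### The nilflow and its return maps -/

/-- `X_α = log (x⁻¹ exp (∑ α_i^{(m)} η̃_i^{(m)}))`. -/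
def Xvec {n : ℕ} {ℓ : Fin n → ℕ} (α : JIdx ℓ → ℝ) : QALie ℓ :=
  glog ((xGen ℓ)⁻¹ * gexp (ofIdeal α))

/-- The flow `φ_X^t (Γ g) = Γ g exp (t X)` on `M`. -/
def nilflow {n : ℕ} {ℓ : Fin n → ℕ} (X : QALie ℓ) (t : ℝ) (x : Nil ℓ) : Nil ℓ :=
  act x (gexp (t • X))

/-- The toral fibre through `x` of the projection `M → ℝ/ℤ`, that is, the orbit of `x` under
`A = exp 𝔞`. -/
def fibre {n : ℕ} {ℓ : Fin n → ℕ} (x : Nil ℓ) : Set (Nil ℓ) :=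
  Set.range fun w : JIdx ℓ → ℝ => act x (gexp (ofIdeal w))

/-- The `r`-th iterate `Φ_α^r`, `r ∈ ℤ`, of the first return map of the flow of `X_α` to the toral
fibres. The first return time is constantly equal to `1` (see `isLeast_returnTime`), so this is
the time-`r` map of the flow. -/
def returnMap {n : ℕ} {ℓ : Fin n → ℕ} (α : JIdx ℓ → ℝ) (r : ℤ) (x : Nil ℓ) : Nil ℓ :=
  nilflow (Xvec α) (r : ℝ) x

theorem mul_t {n : ℕ} {ℓ : Fin n → ℕ} (g g' : QAGroup ℓ) : (g * g').t = g.t + g'.t := rfl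

theorem inv_t {n : ℕ} {ℓ : Fin n → ℕ} (g : QAGroup ℓ) : (g⁻¹).t = -g.t := rfl

theorem gexp_Xvec {n : ℕ} {ℓ : Fin n → ℕ} (α : JIdx ℓ → ℝ) :
    gexp (Xvec α) = (xGen ℓ)⁻¹ * gexp (ofIdeal α) :=
  (Equiv.ofBijective gexp gexp_bijective).apply_symm_apply _

theorem Xvec_fst {n : ℕ} {ℓ : Fin n → ℕ} (α : JIdx ℓ → ℝ) : (Xvec α).1 = -1 := by
  have h := congrArg QAGroup.t (gexp_Xvec α)
  rw [mul_t, inv_t] at h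
  change (Xvec α).1 = -1 + 0 at h
  rw [h, add_zero]

theorem lattice_t_int {n : ℕ} {ℓ : Fin n → ℕ} {g : QAGroup ℓ} (hg : g ∈ lattice ℓ) :
    ∃ k : ℤ, g.t = k := by
  induction hg using Subgroup.closure_induction with
  | mem g hg =>
    rcases hg with rfl | ⟨p, rfl⟩
    · exact ⟨1, by simp [xGen]⟩
    · exact ⟨0, by simp [yGen]⟩
  | one => exact ⟨0, Int.cast_zero.symm⟩
  | mul a b _ _ ha hb =>
    obtain ⟨k, hk⟩ := ha
    obtain ⟨l, hl⟩ := hb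
    exact ⟨k + l, by rw [mul_t, hk, hl]; push_cast; ring⟩
  | inv a _ ha =>
    obtain ⟨k, hk⟩ := ha
    exact ⟨-k, by rw [inv_t, hk]; push_cast; ring⟩

/-- The first return time of the flow of `X_α` to the toral fibres is `1`. -/
theorem isLeast_returnTime {n : ℕ} {ℓ : Fin n → ℕ} (α : JIdx ℓ → ℝ) (x : Nil ℓ) :
    IsLeast {t : ℝ | 0 < t ∧ nilflow (Xvec α) t x ∈ fibre x} 1 := by
  induction x using Quotient.inductionOn with
  | _ g =>
  constructor
  · refine ⟨one_pos, ?_⟩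
    let b : QAGroup ℓ := g⁻¹ * (xGen ℓ * g * (xGen ℓ)⁻¹ * gexp (ofIdeal α))
    have hbt : b.t = 0 := by
      change -g.t + (1 + g.t + -1 + 0) = 0
      ring
    obtain ⟨u, hu⟩ := (gexp_bijective (ℓ := ℓ)).2 b
    have hu1 : u.1 = 0 := (congrArg QAGroup.t hu).trans hbt
    refine ⟨u.2, ?_⟩
    have hu2 : ofIdeal u.2 = u := Prod.ext hu1.symm rfl
    change act _ (gexp (ofIdeal u.2)) = act _ (gexp ((1 : ℝ) • Xvec α))
    rw [hu2, hu, one_smul, gexp_Xvec]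
    refine Quotient.sound ?_
    change QuotientGroup.rightRel (lattice ℓ) _ _
    rw [QuotientGroup.rightRel_apply]
    have : g * ((xGen ℓ)⁻¹ * gexp (ofIdeal α)) * (g * b)⁻¹ = (xGen ℓ)⁻¹ := by
      simp only [b]
      group
    rw [this]
    exact inv_mem (Subgroup.subset_closure (Set.mem_insert _ _))
  · rintro t ⟨ht, w, hw⟩
    have h := Quotient.exact hw
    have h' : QuotientGroup.rightRel (lattice ℓ) (g * gexp (ofIdeal w))
      (g * gexp (t • Xvec α)) := h
    rw [QuotientGroup.rightRel_apply] at h'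
    obtain ⟨k, hk⟩ := lattice_t_int h'
    have hk' : g.t + (t * (Xvec α).1) + -(g.t + 0) = k := hk
    rw [Xvec_fst] at hk'
    have htk : t = ((-k : ℤ) : ℝ) := by push_cast; linarith
    rw [htk] at ht ⊢
    have : (0 : ℤ) < -k := by exact_mod_cast ht
    exact_mod_cast this

/-! ### Adapted bases -/

/-- The coordinates of an element of `𝔤` in the basis `(ξ, η̃)`. -/
def lieCoord {n : ℕ} {ℓ : Fin n → ℕ} (u : QALie ℓ) (o : Option (JIdx ℓ)) : ℝ :=
  o.elim u.1 u.2

/-- The value `ω(X, Y)` of the invariant volume form, normalised by `ω(ξ, η̃) = 1`. -/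
def volForm {n : ℕ} {ℓ : Fin n → ℕ} (X : QALie ℓ) (Y : JIdx ℓ → QALie ℓ) : ℝ :=
  Matrix.det (Matrix.of fun o o' : Option (JIdx ℓ) => lieCoord (o.elim X Y) o')

/-- Normalised strongly adapted bases `(X, Y)`. The elements of `Y` are labelled by `J`; the label
`(m, 0)` is given to the `m`-th of the first `n` elements `Y_1, …, Y_n`, and the labels `(m, i)`,
`i ≠ 0`, to the remaining elements `Y_{n+1}, …, Y_a`. -/
structure IsNormalisedStronglyAdapted {n : ℕ} {ℓ : Fin n → ℕ} [∀ m, NeZero (ℓ m)]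
    (X : QALie ℓ) (Y : JIdx ℓ → QALie ℓ) : Prop where
  not_mem_ideal : X.1 ≠ 0
  mem_ideal : ∀ p, (Y p).1 = 0
  linearIndependent : LinearIndependent ℝ Y
  generate : LieSubalgebra.lieSpan ℝ (QALie ℓ) (insert X (Set.range fun m : Fin n => Y ⟨m, 0⟩)) = ⊤
  derived : Submodule.span ℝ (Y '' {p | p.2 ≠ 0})
    = (LieAlgebra.derivedSeries ℝ (QALie ℓ) 1).toSubmodule
  normalised : |volForm X Y| = 1

/-- The projection `Ȳ = (Ȳ_1, …, Ȳ_n)` of `(Y_1, …, Y_n)` to the Abelianised Lie algebra, in the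
coordinates given by the images of the generators `η̃_1^{(m)}`; `Ybar Y i m` is the `m`-th
coordinate of `Ȳ_i`. -/
def Ybar {n : ℕ} {ℓ : Fin n → ℕ} [∀ m, NeZero (ℓ m)] (Y : JIdx ℓ → QALie ℓ) :
    Fin n → Fin n → ℝ :=
  fun i m => (Y ⟨i, 0⟩).2 ⟨m, 0⟩

/-- The map `φ_x^Y (s) = x exp (∑ s_i Y_i)`. -/
def phiY {n : ℕ} {ℓ : Fin n → ℕ} (Y : JIdx ℓ → QALie ℓ) (x : Nil ℓ) (s : JIdx ℓ → ℝ) : Nil ℓ :=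
  act x (gexp (∑ p, s p • Y p))

/-- The constant `I(Y)`. -/
def IY {n : ℕ} {ℓ : Fin n → ℕ} (Y : JIdx ℓ → QALie ℓ) : ℝ :=
  sSup {I' : ℝ | I' ∈ Set.Ioo (0 : ℝ) (1 / 2) ∧
    ∀ x : Nil ℓ, Set.InjOn (phiY Y x) {s | ∀ p, |s p| < I'}}

open Classical in
/-- `‖x' - x‖_p`: it is `|s_p|` if `x' = x exp (∑ s_i Y_i)` with `s ∈ [-I/2, I/2]^a` (such an `s`
is unique), and `I` if there is no such `s`. -/
def dist1 {n : ℕ} {ℓ : Fin n → ℕ} (Y : JIdx ℓ → QALie ℓ) (x x' : Nil ℓ) (p : JIdx ℓ) : ℝ :=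
  if h : ∃ s : JIdx ℓ → ℝ, (∀ q, |s q| ≤ IY Y / 2) ∧ x' = phiY Y x s then |h.choose p| else IY Y

/-! ### Almost periodic points and the function `H` -/

/-- `δ_{r,L}(x) = max_{1 ≤ i ≤ n} min (I, L^{ρ_i} ‖Φ_α^r(x) - x‖_i)`. -/
def deltaOne {n : ℕ} {ℓ : Fin n → ℕ} [∀ m, NeZero (ℓ m)] (α : JIdx ℓ → ℝ)
    (Y : JIdx ℓ → QALie ℓ) (ρ : JIdx ℓ → ℝ) (r : ℤ) (L : ℝ) (x : Nil ℓ) : ℝ :=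
  ⨆ m : Fin n, min (IY Y) (L ^ ρ ⟨m, 0⟩ * dist1 Y x (returnMap α r x) ⟨m, 0⟩)

/-- `δ'_{r,L}(x) = max_{n < i ≤ a} min (I, L^{ρ_i} ‖Φ_α^r(x) - x‖_i)`. -/
def deltaOther {n : ℕ} {ℓ : Fin n → ℕ} [∀ m, NeZero (ℓ m)] (α : JIdx ℓ → ℝ)
    (Y : JIdx ℓ → QALie ℓ) (ρ : JIdx ℓ → ℝ) (r : ℤ) (L : ℝ) (x : Nil ℓ) : ℝ :=
  ⨆ p : {p : JIdx ℓ // p.2 ≠ 0},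
    min (IY Y) (L ^ ρ p.1 * dist1 Y x (returnMap α r x) p.1)

/-- The sets of almost periodic points: `δ_{r,L} ≤ I/2` and `δ'_{r,L} ∈ (2^{-(j+1)} I, 2^{-j} I]`. -/
def APset {n : ℕ} {ℓ : Fin n → ℕ} [∀ m, NeZero (ℓ m)] (α : JIdx ℓ → ℝ)
    (Y : JIdx ℓ → QALie ℓ) (ρ : JIdx ℓ → ℝ) (r : ℤ) (j : ℕ) (L : ℝ) : Set (Nil ℓ) :=
  {x | deltaOne α Y ρ r L x ≤ IY Y / 2 ∧
    deltaOther α Y ρ r L x ∈ Set.Ioc (IY Y / 2 ^ (j + 1)) (IY Y / 2 ^ j)}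

/-- `h_{r,L} = ∑_{j ≥ 1} min (2^{j(a-n)}, (2/δ_{r,L})^n) χ_{AP}`, where `AP` is the `j`-th set of
almost periodic points. -/
def hFun {n : ℕ} {ℓ : Fin n → ℕ} [∀ m, NeZero (ℓ m)] (α : JIdx ℓ → ℝ)
    (Y : JIdx ℓ → QALie ℓ) (ρ : JIdx ℓ → ℝ) (r : ℤ) (L : ℝ) (x : Nil ℓ) : ℝ :=
  ∑' j : ℕ, Set.indicator (APset α Y ρ r (j + 1) L)
    (fun y => min ((2 : ℝ) ^ ((j + 1) * (∑ m, ℓ m - n))) ((2 / deltaOne α Y ρ r L y) ^ n)) x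

/-- `H_L^T = 1 + ∑_{1 ≤ |r| ≤ [TL]} h_{r,L}`. -/
def HFun {n : ℕ} {ℓ : Fin n → ℕ} [∀ m, NeZero (ℓ m)] (α : JIdx ℓ → ℝ)
    (Y : JIdx ℓ → QALie ℓ) (ρ : JIdx ℓ → ℝ) (T L : ℝ) (x : Nil ℓ) : ℝ :=
  1 + ∑ r ∈ (Finset.Icc (-⌊T * L⌋) ⌊T * L⌋).erase 0, hFun α Y ρ r L x

/-! ### The Diophantine condition -/

/-- The point `[∑ s_i Ȳ_i]` of the torus `ℝ^n / ℤ^n`. -/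
def torusPt {n : ℕ} (Yb : Fin n → Fin n → ℝ) (s : Fin n → ℝ) : Fin n → UnitAddCircle :=
  fun m => ((∑ i, s i * Yb i m : ℝ) : UnitAddCircle)

/-- The constant `Ī(Ȳ)`. -/
def barI {n : ℕ} (Yb : Fin n → Fin n → ℝ) : ℝ :=
  sSup {I' : ℝ | 0 < I' ∧ Set.InjOn (torusPt Yb) {s | ∀ i, |s i| < I'}}

open Classical in
/-- `|θ|_i`: it is `|s_i|` if `[θ] = [∑ s_i Ȳ_i]` with `s ∈ [-Ī/2, Ī/2]^n` (such an `s` is unique),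
and `Ī` if there is no such `s`. -/
def barNorm {n : ℕ} (Yb : Fin n → Fin n → ℝ) (θ : Fin n → ℝ) (i : Fin n) : ℝ :=
  if h : ∃ s : Fin n → ℝ, (∀ k, |s k| ≤ barI Yb / 2) ∧
      (fun m => ((θ m : ℝ) : UnitAddCircle)) = torusPt Yb s
  then |h.choose i| else barI Yb

/-- The set of `r ∈ [-N, N] ∩ ℤ` with `|r α|_i ≤ δ^{σ_i}` for all `i`. -/
def closeReturns {n : ℕ} (Yb : Fin n → Fin n → ℝ) (σ α : Fin n → ℝ) (N : ℕ) (δ : ℝ) : Set ℤ :=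
  {r | -(N : ℤ) ≤ r ∧ r ≤ N ∧ ∀ i, barNorm Yb (fun m => (r : ℝ) * α m) i ≤ δ ^ σ i}

/-- `α ∈ D_n(Ȳ, σ, ν)`, with the constant `C` in the Diophantine condition; here `σ` is a vector of
positive weights with sum `1`. -/
structure IsDiophantineWith {n : ℕ} (Yb : Fin n → Fin n → ℝ) (σ : Fin n → ℝ) (ν : ℝ)
    (α : Fin n → ℝ) (C : ℝ) : Prop where
  weight_pos : ∀ i, 0 < σ i
  weight_sum : ∑ i, σ i = 1
  irrational : ∀ i, Irrational (α i)
  const_pos : 0 < C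
  bound : ∀ N : ℕ, 1 ≤ N → ∀ δ : ℝ, 0 < δ →
    ((closeReturns Yb σ α N δ).ncard : ℝ) ≤ C * max ((N : ℝ) ^ (1 - 1 / ν)) (N * δ)

/-! ### The constants in the bound -/

/-- `|ρ̄| = ρ_1 + ⋯ + ρ_n`. -/
def rhoBar {n : ℕ} {ℓ : Fin n → ℕ} [∀ m, NeZero (ℓ m)] (ρ : JIdx ℓ → ℝ) : ℝ :=
  ∑ m : Fin n, ρ ⟨m, 0⟩

/-- `1 + I(Y)^{a-n} C(α₁) (1 + log⁺ (I(Y)⁻¹) + log C(α₁))`, with `C(α₁) = 1 + C` for the constant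
`C` of the Diophantine condition. -/
def HConst {n : ℕ} {ℓ : Fin n → ℕ} (Y : JIdx ℓ → QALie ℓ) (C : ℝ) : ℝ :=
  1 + IY Y ^ (∑ m, ℓ m - n) * (1 + C) * (1 + Real.posLog (IY Y)⁻¹ + Real.log (1 + C))

/-- The distortion `κ(Y) = max (1, |det Ȳ|⁻¹ max (1, I(Y) / Ī(Ȳ))^n)`; it is `1` as soon as
`|det Ȳ| ≥ 1` and `I(Y) ≤ Ī(Ȳ)`. -/
def distortion {n : ℕ} {ℓ : Fin n → ℕ} [∀ m, NeZero (ℓ m)] (Y : JIdx ℓ → QALie ℓ) : ℝ :=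
  max 1 (|Matrix.det (Matrix.of (Ybar Y))|⁻¹ * max 1 (IY Y / barI (Ybar Y)) ^ n)

end

end QuasiAbelian

/-! Fix `r ≠ 0` and a point `Γ(t, v)`. After multiplication by `x^r` on the left, the equation
`Φ_α^r(x) = x exp(∑ s_p Y_p)` says that `h(t)(∑ s_p Y_p)` equals the return vector `returnDiff α r t
v` modulo `ℤ^J`. Its two groups of coordinates behave in opposite ways.

In the generator coordinates the return vector is `r α₁`, whatever `t` and `v` are. Hence the first
`n` components of `s` solve `∑ s_i Ȳ_i = r α₁ - z` with `z ∈ ℤ^n`, and `δ_{r,L}` takes on the almost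
periodic set only the values `pairDelta` of pairs `(r, z)`. In the coordinates of `[𝔤, 𝔤]` the
return vector is `(h(r) - 1) v` plus a term independent of `v`. As `h(r) - 1` is there a surjective
integer matrix, it carries the uniform distribution of `v` to the uniform distribution of a torus of
dimension `d = a - n`. The remaining components of `s` therefore lie in a given box with probability
at most the volume of its image, which is `|det Ȳ|⁻¹` times the volume of the box
(`volume_returnSet_le`).

The box of the `j`-th almost periodic set has volume proportional to `2^{-jd}`, which cancels the
cap `2^{jd}` in `h`. So a pair `p` contributes to the integral at most `returnVolume` times `∑_j
min(1, (2/δ_p)^n / 2^{jd})`, and this sum is logarithmic in `1/δ_p` (`lintegral_hTerm_le`,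
`sum_min_one_le`).

It remains to sum `log(1/δ_p)` over the pairs with `|r| ≤ N = [TL]` and `δ_p ≤ I/2`. The Diophantine
condition, with `τ = L^{-|ρ̄|}`, bounds the number of pairs with `δ_p ≤ u` by a multiple of `C
max(N^{1-1/ν}, Nτ) (1 + (u/Ī)^n)` (`ncard_returnPairs_le`). The last factor allows for several `z`
belonging to one `r` when `u > Ī/2`, and is the origin of the distortion `κ(Y)`. Applied to the
multiples of one pair, the same condition bounds `δ_p` from below by a power of `(1 + C)N`
(`returnPairs_lower_bound`), so only logarithmically many dyadic scales occur (`sum_weights_le`).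
Finally `ν ≤ 1/|ρ̄|` gives `max(N^{1-1/ν}, Nτ) ≤ (1+T) L^{1-|ρ̄|}`, and the factor `L^{-∑ρ_q}` over
`[𝔤, 𝔤]` completes the exponent. -/

namespace QuasiAbelian

/-! ### The group law in coordinates -/

section Group

variable {n : ℕ} {ℓ : Fin n → ℕ}

theorem mul_v (g g' : QAGroup ℓ) : (g * g').v = g.v + hAct ℓ g.t g'.v := rfl

theorem inv_v (g : QAGroup ℓ) : (g⁻¹).v = hAct ℓ (-g.t) (-g.v) := rfl

theorem mk_mul_mk (t s : ℝ) (v w : JIdx ℓ → ℝ) :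
    (⟨t, v⟩ : QAGroup ℓ) * ⟨s, w⟩ = ⟨t + s, v + hAct ℓ t w⟩ := rfl

theorem hAct_smul (t c : ℝ) (v : JIdx ℓ → ℝ) : hAct ℓ t (c • v) = c • hAct ℓ t v := by
  funext p
  simp only [hAct, Pi.smul_apply, smul_eq_mul, Finset.mul_sum]
  exact Finset.sum_congr rfl fun j _ => by ring

/-- `h(t)` as a linear map. -/
noncomputable def hLin (ℓ : Fin n → ℕ) (t : ℝ) : (JIdx ℓ → ℝ) →ₗ[ℝ] (JIdx ℓ → ℝ) where
  toFun := hAct ℓ t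
  map_add' := hAct_vadd ℓ t
  map_smul' := hAct_smul t

theorem hLin_apply (t : ℝ) (v : JIdx ℓ → ℝ) : hLin ℓ t v = hAct ℓ t v := rfl

theorem hAct_neg_hAct (t : ℝ) (v : JIdx ℓ → ℝ) : hAct ℓ (-t) (hAct ℓ t v) = v := by
  rw [← hAct_add, neg_add_cancel, hAct_zero_left]

theorem hAct_hAct_neg (t : ℝ) (v : JIdx ℓ → ℝ) : hAct ℓ t (hAct ℓ (-t) v) = v := by
  rw [← hAct_add, add_neg_cancel, hAct_zero_left]

theorem hAct_apply_of_eq_zero (t : ℝ) (v : JIdx ℓ → ℝ) (p : JIdx ℓ) (hp : (p.2 : ℕ) = 0) :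
    hAct ℓ t v p = v p := by
  unfold hAct
  rw [Finset.sum_eq_single p.2]
  · simp
  · intro j hj hne
    exact absurd (Fin.ext (by have := Fin.le_def.1 (Finset.mem_Iic.1 hj); omega)) hne
  · intro h
    simp at h

theorem continuous_hAct {X : Type*} [TopologicalSpace X] {f : X → ℝ} {g : X → JIdx ℓ → ℝ}
    (hf : Continuous f) (hg : Continuous g) : Continuous fun x => hAct ℓ (f x) (g x) := by
  refine continuous_pi fun p => ?_
  unfold hAct
  exact continuous_finsetSum _ fun j _ =>
    ((continuous_choose _).comp hf).mul ((continuous_apply _).comp hg)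

theorem choose_intCast (k : ℤ) (m : ℕ) :
    Ring.choose (k : ℝ) m = ((Ring.choose k m : ℤ) : ℝ) :=
  (Ring.map_choose (Int.castRingHom ℝ) k m).symm

/-- `h(k)`, `k ∈ ℤ`, on integer vectors. -/
def hActInt (ℓ : Fin n → ℕ) (k : ℤ) (z : JIdx ℓ → ℤ) : JIdx ℓ → ℤ :=
  fun p => ∑ j ∈ Finset.Iic p.2, Ring.choose k ((p.2 : ℕ) - (j : ℕ)) * z ⟨p.1, j⟩

theorem hAct_intCast (k : ℤ) (z : JIdx ℓ → ℤ) :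
    hAct ℓ (k : ℝ) (fun p => (z p : ℝ)) = fun p => ((hActInt ℓ k z p : ℤ) : ℝ) := by
  funext p
  simp [hAct, hActInt, choose_intCast]

theorem mk_zero_mem_lattice (z : JIdx ℓ → ℤ) :
    (⟨0, fun p => (z p : ℝ)⟩ : QAGroup ℓ) ∈ lattice ℓ := by
  classical
  -- On `t = 0` the group law is vector addition, so membership in the lattice need only be checked
  -- on the standard basis.
  let S : AddSubgroup (JIdx ℓ → ℝ) :=
    { carrier := {w | (⟨0, w⟩ : QAGroup ℓ) ∈ lattice ℓ}
      zero_mem' := one_mem (lattice ℓ)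
      add_mem' := fun {a b} ha hb => by
        have h := (lattice ℓ).mul_mem ha hb
        rw [mk_mul_mk, hAct_zero_left, add_zero] at h
        exact h
      neg_mem' := fun {a} ha => by
        have h := (lattice ℓ).inv_mem ha
        have e : (⟨0, a⟩ : QAGroup ℓ)⁻¹ = ⟨0, -a⟩ := by
          refine QAGroup.ext neg_zero ?_
          rw [inv_v]
          change hAct ℓ (-0) (-a) = -a
          rw [neg_zero, hAct_zero_left]
        rw [e] at h
        exact h }
  have h : (fun p => (z p : ℝ)) = ∑ p, z p • (Pi.single p 1 : JIdx ℓ → ℝ) := by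
    funext q
    simp [Finset.sum_apply, Pi.single_apply]
  change (fun p => (z p : ℝ)) ∈ S
  rw [h]
  refine sum_mem fun p _ => zsmul_mem ?_ _
  exact Subgroup.subset_closure (Set.mem_insert_of_mem _ ⟨p, rfl⟩)

theorem mk_int_zero_mem_lattice (k : ℤ) : (⟨(k : ℝ), 0⟩ : QAGroup ℓ) ∈ lattice ℓ := by
  let S : AddSubgroup ℝ :=
    { carrier := {t | (⟨t, 0⟩ : QAGroup ℓ) ∈ lattice ℓ}
      zero_mem' := one_mem (lattice ℓ)
      add_mem' := fun {a b} ha hb => by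
        have h := (lattice ℓ).mul_mem ha hb
        rw [mk_mul_mk, hAct_zero_right, add_zero] at h
        exact h
      neg_mem' := fun {a} ha => by
        have h := (lattice ℓ).inv_mem ha
        have e : (⟨a, 0⟩ : QAGroup ℓ)⁻¹ = ⟨-a, 0⟩ := by
          refine QAGroup.ext rfl ?_
          rw [inv_v, neg_zero, hAct_zero_right]
        rw [e] at h
        exact h }
  have h1 : (1 : ℝ) ∈ S := Subgroup.subset_closure (Set.mem_insert _ _)
  have h2 : k • (1 : ℝ) ∈ S := zsmul_mem h1 k
  rwa [zsmul_one] at h2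

/-- Binomial coefficients of integers are integers, so `h(k)` preserves `ℤ^J` and integrality
survives products and inverses. -/
theorem lattice_v_int {g : QAGroup ℓ} (hg : g ∈ lattice ℓ) :
    ∃ z : JIdx ℓ → ℤ, g.v = fun p => (z p : ℝ) := by
  classical
  induction hg using Subgroup.closure_induction with
  | mem g hg =>
    rcases hg with rfl | ⟨p, rfl⟩
    · exact ⟨0, by funext q; simp [xGen]⟩
    · refine ⟨Pi.single p 1, ?_⟩
      funext q
      by_cases h : q = p
      · subst h; simp [yGen]
      · simp [yGen, h]
  | one => exact ⟨0, by funext q; exact Int.cast_zero.symm⟩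
  | mul a b ha hb iha ihb =>
    obtain ⟨k, hk⟩ := lattice_t_int ha
    obtain ⟨y, hy⟩ := iha
    obtain ⟨z, hz⟩ := ihb
    refine ⟨y + hActInt ℓ k z, ?_⟩
    rw [mul_v, hy, hz, hk, hAct_intCast]
    funext p
    simp
  | inv a ha iha =>
    obtain ⟨k, hk⟩ := lattice_t_int ha
    obtain ⟨y, hy⟩ := iha
    refine ⟨hActInt ℓ (-k) (-y), ?_⟩
    have h := hAct_intCast (ℓ := ℓ) (-k) (-y)
    rw [inv_v, hk, hy, ← h]
    push_cast
    congr 1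
    funext p
    simp

theorem mk_zero_mem_lattice_iff (w : JIdx ℓ → ℝ) :
    (⟨0, w⟩ : QAGroup ℓ) ∈ lattice ℓ ↔ ∃ z : JIdx ℓ → ℤ, w = fun p => (z p : ℝ) := by
  constructor
  · exact fun h => lattice_v_int h
  · rintro ⟨z, rfl⟩
    exact mk_zero_mem_lattice z

theorem gexp_ofIdeal (w : JIdx ℓ → ℝ) : gexp (ofIdeal w) = (⟨0, w⟩ : QAGroup ℓ) := by
  refine QAGroup.ext rfl ?_
  funext p
  change ∫ s in (0 : ℝ)..1, hAct ℓ (s * 0) w p = w p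
  simp [hAct_zero_left]

theorem gexp_v_of_eq_zero (u : QALie ℓ) (p : JIdx ℓ) (hp : (p.2 : ℕ) = 0) :
    (gexp u).v p = u.2 p := by
  change (∫ s in (0 : ℝ)..1, hAct ℓ (s * u.1) u.2 p) = u.2 p
  simp [hAct_apply_of_eq_zero _ _ p hp]

theorem Xvec_snd_of_eq_zero (α : JIdx ℓ → ℝ) (p : JIdx ℓ) (hp : (p.2 : ℕ) = 0) :
    (Xvec α).2 p = α p := by
  rw [← gexp_v_of_eq_zero _ p hp, gexp_Xvec, mul_v, gexp_ofIdeal, Pi.add_apply,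
    hAct_apply_of_eq_zero _ _ p hp, inv_v]
  change hAct ℓ (-1) (-0) p + α p = α p
  rw [neg_zero, hAct_zero_right, Pi.zero_apply, zero_add]

/-- The abelian part of `x^r g exp (r X_α)`, minus that of `g`, for `g = (t, v)`. -/
noncomputable def returnDiff (α : JIdx ℓ → ℝ) (r : ℤ) (t : ℝ) (v : JIdx ℓ → ℝ) : JIdx ℓ → ℝ :=
  hAct ℓ r v - v + hAct ℓ (r + t) (gexp ((r : ℝ) • Xvec α)).v

/-- Each `h(t)` fixes the first coordinate of every block, so the dependence on the base point
cancels. This is why `δ_{r,L}` can be controlled by arithmetic alone. -/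
theorem returnDiff_of_eq_zero (α : JIdx ℓ → ℝ) (r : ℤ) (t : ℝ) (v : JIdx ℓ → ℝ) (p : JIdx ℓ)
    (hp : (p.2 : ℕ) = 0) : returnDiff α r t v p = r * α p := by
  rw [returnDiff, Pi.add_apply, Pi.sub_apply, hAct_apply_of_eq_zero _ _ p hp,
    hAct_apply_of_eq_zero _ _ p hp, gexp_v_of_eq_zero _ p hp]
  change v p - v p + r * (Xvec α).2 p = _
  rw [Xvec_snd_of_eq_zero α p hp]
  ring

theorem toNil_eq_iff (g g' : QAGroup ℓ) : toNil ℓ g = toNil ℓ g' ↔ g' * g⁻¹ ∈ lattice ℓ := by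
  unfold toNil
  rw [Quotient.eq]
  rw [QuotientGroup.rightRel_apply]

/-- `Φ_α^r` moves `Γ(t, v)` along `w ∈ 𝔞` exactly if `h(t) w` is the return vector modulo `ℤ^J`. -/
theorem returnMap_eq_act_iff (α : JIdx ℓ → ℝ) (r : ℤ) (t : ℝ) (v w : JIdx ℓ → ℝ) :
    returnMap α r (toNil ℓ ⟨t, v⟩) = act (toNil ℓ ⟨t, v⟩) (gexp (ofIdeal w)) ↔
      ∃ z : JIdx ℓ → ℤ, returnDiff α r t v - hAct ℓ t w = fun p => (z p : ℝ) := by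
  have h1 : returnMap α r (toNil ℓ ⟨t, v⟩)
      = toNil ℓ (⟨t, v⟩ * gexp ((r : ℝ) • Xvec α)) := rfl
  have h2 : act (toNil ℓ ⟨t, v⟩) (gexp (ofIdeal w))
      = toNil ℓ (⟨t, v⟩ * gexp (ofIdeal w)) := rfl
  rw [h1, h2, eq_comm, toNil_eq_iff, ← mk_zero_mem_lattice_iff,
    ← (lattice ℓ).mul_mem_cancel_left (mk_int_zero_mem_lattice r)]
  have hu : gexp ((r : ℝ) • Xvec α) = (⟨-r, (gexp ((r : ℝ) • Xvec α)).v⟩ : QAGroup ℓ) := by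
    refine QAGroup.ext ?_ rfl
    change (r : ℝ) * (Xvec α).1 = -r
    rw [Xvec_fst, mul_neg_one]
  -- The `ξ`-coefficient of `X_α` is `-1`, so `exp(r X_α)` lowers `t` by `r`; the factor `x^r ∈ Γ`
  -- on the left restores it, and the quotient lies in `A`.
  have key : (⟨(r : ℝ), 0⟩ : QAGroup ℓ)
      * (⟨t, v⟩ * gexp ((r : ℝ) • Xvec α) * (⟨t, v⟩ * gexp (ofIdeal w))⁻¹)
      = ⟨0, returnDiff α r t v - hAct ℓ t w⟩ := by
    rw [← mul_assoc, mul_inv_eq_iff_eq_mul, hu, gexp_ofIdeal, mk_mul_mk, mk_mul_mk, mk_mul_mk,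
      mk_mul_mk]
    refine QAGroup.ext (by simp) ?_
    simp only [hAct_zero_left, hAct_vadd, returnDiff, hAct_add]
    abel
  rw [key]

theorem continuous_returnDiff (α : JIdx ℓ → ℝ) (r : ℤ) :
    Continuous fun y : ℝ × (JIdx ℓ → ℝ) => returnDiff α r y.1 y.2 := by
  unfold returnDiff
  exact ((continuous_hAct continuous_const continuous_snd).sub continuous_snd).add
    (continuous_hAct (continuous_const.add continuous_fst) continuous_const)

end Group

/-! ### Integer matrices acting on tori -/

section Torus

variable {ι κ : Type*}

/-- The covering `ℝ^ι → (ℝ/ℤ)^ι`. -/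
def torusMk (v : ι → ℝ) : ι → UnitAddCircle := fun i => (v i : UnitAddCircle)

theorem measurePreserving_torusMk [Fintype ι] :
    MeasurePreserving (torusMk (ι := ι))
      (volume.restrict (Set.univ.pi fun _ => Set.Ico (0 : ℝ) 1)) := by
  have h := measurePreserving_pi (fun _ : ι => (volume : Measure ℝ).restrict (Set.Ioc 0 (0 + 1)))
    (fun _ : ι => (volume : Measure UnitAddCircle))
    (f := fun _ x => (x : UnitAddCircle)) (fun _ => UnitAddCircle.measurePreserving_mk 0)
  rw [← Measure.restrict_pi_pi, zero_add] at h
  have e : (Measure.pi fun _ : ι => (volume : Measure ℝ)).restrict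
        (Set.univ.pi fun _ => Set.Ioc (0 : ℝ) 1)
      = volume.restrict (Set.univ.pi fun _ => Set.Ico (0 : ℝ) 1) :=
    Measure.restrict_congr_set
      (Measure.univ_pi_Ioc_ae_eq_Icc.trans Measure.univ_pi_Ico_ae_eq_Icc.symm)
  rw [e] at h
  exact h

theorem torusMk_eq_iff (v w : ι → ℝ) :
    torusMk v = torusMk w ↔ ∃ z : ι → ℤ, v = w + fun i => (z i : ℝ) := by
  have h : ∀ i, ((v i : ℝ) : UnitAddCircle) = (w i : ℝ) ↔ ∃ k : ℤ, v i = w i + k := by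
    intro i
    rw [eq_comm, QuotientAddGroup.eq, AddSubgroup.mem_zmultiples_iff]
    constructor
    · rintro ⟨k, hk⟩
      exact ⟨k, by rw [zsmul_one] at hk; linarith⟩
    · rintro ⟨k, hk⟩
      exact ⟨k, by rw [zsmul_one]; linarith⟩
  constructor
  · intro e
    choose z hz using fun i => (h i).1 (congrFun e i)
    exact ⟨z, funext hz⟩
  · rintro ⟨z, hz⟩
    exact funext fun i => (h i).2 ⟨z i, congrFun hz i⟩

/-- Cut `E` along the unit cells and translate every piece into the cube. The pieces are disjoint in
`E` but may overlap after translation, whence an inequality. -/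
theorem volume_torusMk_image_le [Fintype κ] {E : Set (κ → ℝ)} (hE : IsCompact E) :
    volume (torusMk '' E) ≤ volume E := by
  have hc : Continuous (torusMk (ι := κ)) :=
    continuous_pi fun i => (AddCircle.continuous_mk' 1).comp (continuous_apply i)
  have hm : MeasurableSet (torusMk '' E) := (hE.image hc).isClosed.measurableSet
  have hEm : MeasurableSet E := hE.measurableSet
  set F : Set (κ → ℝ) := Set.univ.pi fun _ => Set.Ico (0 : ℝ) 1 with hF
  have hFm : MeasurableSet F := MeasurableSet.univ_pi fun _ => measurableSet_Ico
  rw [← measurePreserving_torusMk.measure_preimage hm.nullMeasurableSet,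
    Measure.restrict_apply (hc.measurable hm)]
  let c : (κ → ℤ) → κ → ℝ := fun z i => (z i : ℝ)
  have h1 : torusMk ⁻¹' (torusMk '' E) ∩ F
      ⊆ ⋃ z : κ → ℤ, (fun x => x + c z) ⁻¹' (E ∩ (fun x => x + -c z) ⁻¹' F) := by
    rintro x ⟨⟨e, he, hex⟩, hxF⟩
    obtain ⟨z, hz⟩ := (torusMk_eq_iff e x).1 hex
    refine Set.mem_iUnion.2 ⟨z, ?_⟩
    have : x + c z = e := hz.symm
    simp only [Set.mem_preimage, Set.mem_inter_iff, add_neg_cancel_right]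
    exact ⟨this ▸ he, hxF⟩
  refine (measure_mono h1).trans ((measure_iUnion_le _).trans ?_)
  simp only [measure_preimage_add_right]
  rw [← measure_iUnion]
  · exact measure_mono (Set.iUnion_subset fun z => Set.inter_subset_left)
  · intro z z' hne
    rw [Function.onFun, Set.disjoint_left]
    rintro x ⟨_, hx⟩ ⟨_, hx'⟩
    refine hne (funext fun i => ?_)
    have a := hx i trivial
    have b := hx' i trivial
    simp only [Pi.add_apply, Pi.neg_apply, c, Set.mem_Ico] at a b
    have a1 : ((z i : ℤ) : ℝ) < z' i + 1 := by linarith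
    have a2 : ((z' i : ℤ) : ℝ) < z i + 1 := by linarith
    have b1 : z i < z' i + 1 := by exact_mod_cast a1
    have b2 : z' i < z i + 1 := by exact_mod_cast a2
    omega
  · intro z
    exact hEm.inter ((measurable_id.add_const _) hFm)

/-- The endomorphism of tori defined by an integer matrix. -/
def torusHom [Fintype ι] (N : Matrix κ ι ℤ) : (ι → UnitAddCircle) →+ (κ → UnitAddCircle) where
  toFun θ k := ∑ i, N k i • θ i
  map_zero' := by funext k; simp
  map_add' θ θ' := by funext k; simp [Finset.sum_add_distrib]

theorem torusHom_torusMk [Fintype ι] (N : Matrix κ ι ℤ) (v : ι → ℝ) :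
    torusHom N (torusMk v) = torusMk ((N.map (Int.cast : ℤ → ℝ)).mulVec v) := by
  funext k
  change ∑ i, N k i • ((v i : ℝ) : UnitAddCircle)
    = ((∑ i, (N k i : ℝ) * v i : ℝ) : UnitAddCircle)
  have h := map_sum (QuotientAddGroup.mk' (AddSubgroup.zmultiples (1 : ℝ)))
    (fun i => (N k i : ℝ) * v i) Finset.univ
  refine Eq.trans (Finset.sum_congr rfl fun i _ => ?_) h.symm
  rw [← zsmul_eq_mul, map_zsmul]
  rfl

theorem torusMk_surjective : Function.Surjective (torusMk (ι := ι)) := by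
  intro θ
  choose v hv using fun i => QuotientAddGroup.mk_surjective (θ i)
  exact ⟨v, funext hv⟩

/-- A surjective integer matrix maps the uniform distribution of the unit cube to the uniform
distribution modulo `1`. -/
theorem volume_cube_preimage_le [Fintype ι] [Fintype κ] (N : Matrix κ ι ℤ)
    (hN : Function.Surjective (N.map (Int.cast : ℤ → ℝ)).mulVec) {E : Set (κ → ℝ)}
    (hE : IsCompact E) :
    volume ({v : ι → ℝ | ∃ z : κ → ℤ,
      ((N.map (Int.cast : ℤ → ℝ)).mulVec v - fun k => (z k : ℝ)) ∈ E} ∩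
        Set.univ.pi fun _ => Set.Ico (0 : ℝ) 1) ≤ volume E := by
  have hc : Continuous (torusMk (ι := κ)) :=
    continuous_pi fun i => (AddCircle.continuous_mk' 1).comp (continuous_apply i)
  have hc' : Continuous (torusMk (ι := ι)) :=
    continuous_pi fun i => (AddCircle.continuous_mk' 1).comp (continuous_apply i)
  have hm : MeasurableSet (torusMk '' E) := (hE.image hc).isClosed.measurableSet
  have hcont : Continuous (torusHom N) :=
    continuous_pi fun k => continuous_finsetSum _ fun i _ => (continuous_apply i).zsmul _
  have hsurj : Function.Surjective (torusHom N) := by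
    intro θ
    obtain ⟨w, rfl⟩ := torusMk_surjective θ
    obtain ⟨v, rfl⟩ := hN w
    exact ⟨torusMk v, torusHom_torusMk N v⟩
  -- A continuous surjective homomorphism of compact groups carries Haar measure to Haar measure,
  -- here with equal total mass.
  have hmp : MeasurePreserving (torusHom N) volume volume :=
    AddMonoidHom.measurePreserving hcont hsurj (by simp [volume_pi, Measure.pi_univ])
  have hset : {v : ι → ℝ | ∃ z : κ → ℤ,
      ((N.map (Int.cast : ℤ → ℝ)).mulVec v - fun k => (z k : ℝ)) ∈ E}
      = torusMk ⁻¹' (torusHom N ⁻¹' (torusMk '' E)) := by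
    ext v
    simp only [Set.mem_ofPred_eq, Set.mem_preimage, torusHom_torusMk, Set.mem_image]
    constructor
    · rintro ⟨z, hz⟩
      refine ⟨_, hz, (torusMk_eq_iff _ _).2 ⟨-z, ?_⟩⟩
      funext k
      simp [sub_eq_add_neg]
    · rintro ⟨e, he, h⟩
      obtain ⟨z, hz⟩ := (torusMk_eq_iff _ _).1 h
      refine ⟨-z, ?_⟩
      convert he using 1
      rw [hz]
      funext k
      simp
  rw [hset, ← Measure.restrict_apply (hc'.measurable (hcont.measurable hm)),
    measurePreserving_torusMk.measure_preimage (hcont.measurable hm).nullMeasurableSet,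
    hmp.measure_preimage hm.nullMeasurableSet]
  exact volume_torusMk_image_le hE

end Torus

/-! ### Unitriangularity of `h(t)` and determinants of adapted bases. -/

section Single

variable {n : ℕ} {ℓ : Fin n → ℕ}

theorem hAct_single_of_lt (t : ℝ) (p q : JIdx ℓ) (h : (p.2 : ℕ) < q.2) :
    hAct ℓ t (Pi.single q 1) p = 0 := by
  refine Finset.sum_eq_zero fun j hj => ?_
  rw [Pi.single_eq_of_ne, mul_zero]
  rintro rfl
  have := Fin.le_def.1 (Finset.mem_Iic.1 hj)
  dsimp at h
  omega

theorem hAct_single_of_eq (t : ℝ) (p q : JIdx ℓ) (h : (p.2 : ℕ) = q.2) :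
    hAct ℓ t (Pi.single q 1) p = (Pi.single q 1 : JIdx ℓ → ℝ) p := by
  unfold hAct
  rw [Finset.sum_eq_single p.2]
  · simp
  · intro j hj hne
    rw [Pi.single_eq_of_ne, mul_zero]
    rintro rfl
    exact hne (Fin.ext h.symm)
  · intro h
    simp at h

end Single

section Adapted

variable {n : ℕ} {ℓ : Fin n → ℕ} [∀ m, NeZero (ℓ m)]

/-- The labels `(m, i)`, `i ≠ 0`, of the elements of `[𝔤, 𝔤]`. -/
abbrev JDer {n : ℕ} (ℓ : Fin n → ℕ) [∀ m, NeZero (ℓ m)] : Type := {p : JIdx ℓ // p.2 ≠ 0}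

/-- The labels `(m, 0)` of the generators. -/
def generatorEquiv {n : ℕ} (ℓ : Fin n → ℕ) [∀ m, NeZero (ℓ m)] :
    Fin n ≃ {p : JIdx ℓ // p.2 = 0} where
  toFun m := ⟨⟨m, 0⟩, rfl⟩
  invFun p := p.1.1
  left_inv _ := rfl
  right_inv p := by
    obtain ⟨⟨m, i⟩, hi⟩ := p
    have hi : i = 0 := hi
    subst hi
    rfl

theorem derived_coord {u : QALie ℓ}
    (hu : u ∈ (LieAlgebra.derivedSeries ℝ (QALie ℓ) 1).toSubmodule) (q : JIdx ℓ)
    (hq : q.2 = 0) : u.2 q = 0 := by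
  have h1 : LieAlgebra.derivedSeries ℝ (QALie ℓ) 1
      = ⁅(⊤ : LieIdeal ℝ (QALie ℓ)), (⊤ : LieIdeal ℝ (QALie ℓ))⁆ := rfl
  rw [h1, LieSubmodule.lieIdeal_oper_eq_linear_span'] at hu
  have had : ∀ w : JIdx ℓ → ℝ, adXi ℓ w q = 0 := by
    intro w
    change ∑ j ∈ Finset.Iio q.2, _ = (0 : ℝ)
    rw [Finset.sum_eq_zero]
    intro j hj
    rw [Finset.mem_Iio, hq] at hj
    exact absurd hj (Fin.not_lt_zero j)
  induction hu using Submodule.span_induction with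
  | mem u hu =>
    obtain ⟨x, _, y, _, rfl⟩ := hu
    change x.1 * adXi ℓ y.2 q - y.1 * adXi ℓ x.2 q = 0
    rw [had, had]; ring
  | zero => rfl
  | add a b _ _ ha hb =>
    change a.2 q + b.2 q = 0
    rw [ha, hb, add_zero]
  | smul c a _ ha =>
    change c * a.2 q = 0
    rw [ha, mul_zero]

/-- The coordinates of `Y` in the basis `η̃`. -/
def Ymat {n : ℕ} {ℓ : Fin n → ℕ} (Y : JIdx ℓ → QALie ℓ) : Matrix (JIdx ℓ) (JIdx ℓ) ℝ :=
  Matrix.of fun p q => (Y p).2 q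

/-- The block of `Ymat Y` belonging to `[𝔤, 𝔤]`. -/
def YderMat (Y : JIdx ℓ → QALie ℓ) : Matrix (JDer ℓ) (JDer ℓ) ℝ :=
  Matrix.of fun p q => (Y p.1).2 q.1

/-- The matrix of `h(t)` on the coordinates of `[𝔤, 𝔤]`. -/
noncomputable def hDerMat (ℓ : Fin n → ℕ) [∀ m, NeZero (ℓ m)] (t : ℝ) :
    Matrix (JDer ℓ) (JDer ℓ) ℝ :=
  Matrix.of fun p q => hAct ℓ t (Pi.single q.1 1) p.1

/-- Ordered by depth in the blocks, `h(t)` is triangular with identity diagonal blocks. -/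
theorem det_hDerMat (t : ℝ) : (hDerMat ℓ t).det = 1 := by
  have hbt : (hDerMat ℓ t).BlockTriangular fun p => OrderDual.toDual (p.1.2 : ℕ) := by
    intro p q h
    exact hAct_single_of_lt t p.1 q.1 (OrderDual.toDual_lt_toDual.1 h)
  rw [hbt.det]
  refine Finset.prod_eq_one fun k _ => ?_
  rw [show (hDerMat ℓ t).toSquareBlock (fun p => OrderDual.toDual (p.1.2 : ℕ)) k = 1 from ?_,
    Matrix.det_one]
  ext p q
  have h : (p.1.1.2 : ℕ) = q.1.1.2 := by
    have := p.2.trans q.2.symm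
    exact OrderDual.toDual_inj.1 this
  change hAct ℓ t (Pi.single q.1.1 1) p.1.1 = _
  rw [hAct_single_of_eq t _ _ h, Matrix.one_apply]
  by_cases e : p = q
  · subst e; simp
  · rw [if_neg e, Pi.single_eq_of_ne]
    exact fun e' => e (Subtype.ext (Subtype.ext e'))

variable {α : JIdx ℓ → ℝ} {Y : JIdx ℓ → QALie ℓ}
  (hY : IsNormalisedStronglyAdapted (Xvec α) Y)

include hY

theorem Y_derived_coord (p q : JIdx ℓ) (hp : p.2 ≠ 0) (hq : q.2 = 0) : (Y p).2 q = 0 := by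
  refine derived_coord ?_ q hq
  rw [← hY.derived]
  exact Submodule.subset_span ⟨p, hp, rfl⟩

/-- The elements of `Y` have no `ξ`-component and that of `X_α` is `-1`, so the volume form reduces,
up to sign, to the determinant on the ideal. -/
theorem abs_det_Ymat : |(Ymat Y).det| = 1 := by
  have h := hY.normalised
  have key : volForm (Xvec α) Y = (Ymat Y).det * -1 := by
    have e : (Matrix.of fun o o' : Option (JIdx ℓ) => lieCoord (o.elim (Xvec α) Y) o').submatrix
        (Equiv.optionEquivSumPUnit.{0} (JIdx ℓ)).symm (Equiv.optionEquivSumPUnit (JIdx ℓ)).symm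
        = Matrix.fromBlocks (Ymat Y) 0 (Matrix.of fun _ q => (Xvec α).2 q)
          (Matrix.of fun _ _ => -1) := by
      ext i j
      rcases i with i | i <;> rcases j with j | j
      · rfl
      · exact hY.mem_ideal i
      · rfl
      · exact Xvec_fst α
    rw [volForm, ← Matrix.det_submatrix_equiv_self (Equiv.optionEquivSumPUnit.{0} (JIdx ℓ)).symm, e,
      Matrix.det_fromBlocks_zero₁₂]
    simp
  rw [key, mul_neg_one, abs_neg] at h
  exact h

theorem isUnit_det_Ymat : IsUnit (Ymat Y).det := by
  rw [isUnit_iff_ne_zero]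
  intro h
  have := abs_det_Ymat hY
  rw [h, abs_zero] at this
  exact zero_ne_one this

/-- Elements of `[𝔤, 𝔤]` have no generator coordinates, so `Ymat Y` is block triangular with
diagonal blocks `Ȳ` and `YderMat Y`. The normalisation of the basis thus expresses the volume
distortion on `[𝔤, 𝔤]` through `det Ȳ`. -/
theorem det_Ybar_mul_det_YderMat :
    |(Matrix.of (Ybar Y)).det| * |(YderMat Y).det| = 1 := by
  have h := Matrix.twoBlockTriangular_det (Ymat Y) (fun p => p.2 = 0)
    (fun i hi j hj => Y_derived_coord hY i j hi hj)
  have h1 : ((Ymat Y).toSquareBlockProp fun p => p.2 = 0).det = (Matrix.of (Ybar Y)).det := by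
    rw [← Matrix.det_submatrix_equiv_self (generatorEquiv ℓ)]
    rfl
  have h2 : ((Ymat Y).toSquareBlockProp fun p => ¬ p.2 = 0).det = (YderMat Y).det := rfl
  rw [h1, h2] at h
  rw [← abs_mul, ← h, abs_det_Ymat hY]

theorem isUnit_det_Ybar : IsUnit (Matrix.of (Ybar Y)).det := by
  rw [isUnit_iff_ne_zero]
  intro h
  have := det_Ybar_mul_det_YderMat hY
  rw [h, abs_zero, zero_mul] at this
  exact zero_ne_one this

theorem abs_det_YderMat : |(YderMat Y).det| = |(Matrix.of (Ybar Y)).det|⁻¹ :=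
  eq_inv_of_mul_eq_one_right (det_Ybar_mul_det_YderMat hY)

/-- The matrix of `s' ↦ h(t) (∑ s'_q Y_q)` on `[𝔤, 𝔤]`. -/
theorem abs_det_transported (t : ℝ) :
    |(Matrix.of fun q q' : JDer ℓ => hAct ℓ t (Y q'.1).2 q.1).det|
      = |(Matrix.of (Ybar Y)).det|⁻¹ := by
  have e : (Matrix.of fun q q' : JDer ℓ => hAct ℓ t (Y q'.1).2 q.1)
      = hDerMat ℓ t * (YderMat Y).transpose := by
    ext q q'
    have h1 : (Y q'.1).2 = ∑ p, (Y q'.1).2 p • (Pi.single p 1 : JIdx ℓ → ℝ) := by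
      funext p
      simp [Finset.sum_apply, Pi.single_apply]
    have h2 : hAct ℓ t (Y q'.1).2 q.1
        = ∑ p, (Y q'.1).2 p * hAct ℓ t (Pi.single p 1) q.1 := by
      conv_lhs => rw [h1]
      rw [← hLin_apply, map_sum, Finset.sum_apply]
      simp [hLin_apply]
    rw [Matrix.of_apply, h2, ← Fintype.sum_subtype_add_sum_subtype (fun p : JIdx ℓ => p.2 = 0),
      Finset.sum_eq_zero, zero_add]
    · exact Finset.sum_congr rfl fun p _ => mul_comm _ _
    · intro p _
      rw [Y_derived_coord hY q'.1 p.1 q'.2 p.2, zero_mul]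
  rw [e, Matrix.det_mul, det_hDerMat, one_mul, Matrix.det_transpose, abs_det_YderMat hY]

end Adapted

/-! ### Volume of the return sets in a toral fibre. -/

section Return

variable {n : ℕ} {ℓ : Fin n → ℕ} [∀ m, NeZero (ℓ m)]

/-- `v ↦ h(t) v - v`, in the coordinates of `[𝔤, 𝔤]`. -/
noncomputable def hSubOne (ℓ : Fin n → ℕ) [∀ m, NeZero (ℓ m)] (t : ℝ) :
    (JIdx ℓ → ℝ) →ₗ[ℝ] (JDer ℓ → ℝ) :=
  (LinearMap.funLeft ℝ ℝ Subtype.val).comp (hLin ℓ t - LinearMap.id)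

theorem hSubOne_apply (t : ℝ) (v : JIdx ℓ → ℝ) (q : JDer ℓ) :
    hSubOne ℓ t v q = hAct ℓ t v q.1 - v q.1 := rfl

theorem hSubOne_apply_eq_sum (t : ℝ) (v : JIdx ℓ → ℝ) (q : JDer ℓ) :
    hSubOne ℓ t v q = ∑ j ∈ Finset.Iio q.1.2,
      Ring.choose t ((q.1.2 : ℕ) - (j : ℕ)) * v ⟨q.1.1, j⟩ := by
  rw [hSubOne_apply, hAct, ← Finset.Iio_insert, Finset.sum_insert (by simp)]
  simp

/-- The shift `u ↦ (u_{i+1})_i`, from the coordinates of `[𝔤, 𝔤]` to those of `𝔞`. -/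
def shiftLin (ℓ : Fin n → ℕ) [∀ m, NeZero (ℓ m)] : (JDer ℓ → ℝ) →ₗ[ℝ] (JIdx ℓ → ℝ) where
  toFun u p := if h : (p.2 : ℕ) + 1 < ℓ p.1 then
    u ⟨⟨p.1, ⟨p.2 + 1, h⟩⟩, fun e => by simpa using congrArg Fin.val e⟩ else 0
  map_add' u w := by
    funext p
    by_cases h : (p.2 : ℕ) + 1 < ℓ p.1 <;> simp [h]
  map_smul' c u := by
    funext p
    by_cases h : (p.2 : ℕ) + 1 < ℓ p.1 <;> simp [h]

/-- After the shift, `h(t) - 1` is triangular with diagonal entries `binom(t, 1) = t`. Being an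
injective endomorphism of a finite-dimensional space, the composite is onto, and hence so is
`hSubOne ℓ t`. -/
theorem hSubOne_shift_injective {t : ℝ} (ht : t ≠ 0) :
    Function.Injective ((hSubOne ℓ t).comp (shiftLin ℓ)) := by
  rw [injective_iff_map_eq_zero]
  intro u hu
  have key : ∀ (m : Fin n) (k : ℕ) (hk : k + 1 < ℓ m),
      shiftLin ℓ u ⟨m, ⟨k, by omega⟩⟩ = 0 := by
    intro m k
    induction k using Nat.strong_induction_on with
    | _ k ih =>
      intro hk
      have hne : (⟨k + 1, hk⟩ : Fin (ℓ m)) ≠ 0 := fun e => by simpa using congrArg Fin.val e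
      have h := congrFun hu ⟨⟨m, ⟨k + 1, hk⟩⟩, hne⟩
      rw [LinearMap.comp_apply, hSubOne_apply_eq_sum, Pi.zero_apply,
        Finset.sum_eq_single (⟨k, (Nat.lt_succ_self k).trans hk⟩ : Fin (ℓ m))] at h
      · simpa [ht] using h
      · intro j hj hjne
        have hlt : (j : ℕ) < k + 1 := Fin.lt_def.1 (Finset.mem_Iio.1 hj)
        have hjk : (j : ℕ) < k :=
          lt_of_le_of_ne (Nat.lt_succ_iff.1 hlt) fun e => hjne (Fin.ext e)
        have := ih j hjk (by omega)
        rw [this, mul_zero]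
      · intro h'
        exact absurd (Finset.mem_Iio.2 (Fin.lt_def.2 (Nat.lt_succ_self k))) h'
  funext ⟨⟨m, i⟩, hi⟩
  have hi0 : (i : ℕ) ≠ 0 := fun e => hi (Fin.val_eq_zero_iff.1 e)
  obtain ⟨k, hk⟩ := Nat.exists_eq_succ_of_ne_zero hi0
  have hkl : k + 1 < ℓ m := hk.symm.trans_lt i.isLt
  have h := key m k hkl
  have e : i = ⟨k + 1, hkl⟩ := Fin.ext hk
  subst e
  simpa [shiftLin, hkl] using h

theorem hSubOne_surjective {t : ℝ} (ht : t ≠ 0) : Function.Surjective (hSubOne ℓ t) := by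
  have h := LinearMap.injective_iff_surjective.1 (hSubOne_shift_injective (ℓ := ℓ) ht)
  rw [LinearMap.coe_comp] at h
  exact h.of_comp

/-- The integer matrix of `hSubOne ℓ r`. -/
def hSubOneMat (ℓ : Fin n → ℕ) [∀ m, NeZero (ℓ m)] (r : ℤ) : Matrix (JDer ℓ) (JIdx ℓ) ℤ :=
  Matrix.of fun q i => hActInt ℓ r (Pi.single i 1) q.1 - (Pi.single i 1 : JIdx ℓ → ℤ) q.1

theorem hSubOneMat_mulVec (r : ℤ) (v : JIdx ℓ → ℝ) :
    ((hSubOneMat ℓ r).map (Int.cast : ℤ → ℝ)).mulVec v = hSubOne ℓ r v := by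
  have e : (hSubOneMat ℓ r).map (Int.cast : ℤ → ℝ) = LinearMap.toMatrix' (hSubOne ℓ (r : ℝ)) := by
    ext q i
    have hs : (Pi.single i 1 : JIdx ℓ → ℝ)
        = fun p => (((Pi.single i 1 : JIdx ℓ → ℤ) p : ℤ) : ℝ) := by
      funext p
      by_cases h : p = i
      · subst h; simp
      · simp [h]
    rw [LinearMap.toMatrix'_apply, hSubOne_apply, hs, hAct_intCast, Matrix.map_apply]
    exact Int.cast_sub _ _
  rw [e, LinearMap.toMatrix'_mulVec]

variable {α : JIdx ℓ → ℝ} {Y : JIdx ℓ → QALie ℓ}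

/-- The `v ∈ ℝ^J` such that `Φ_α^r (Γ(t, v)) = Γ(t, v) exp (∑ s_p Y_p)` for some `s` with the given
first components and with the others bounded by `ε`. -/
def returnSet (α : JIdx ℓ → ℝ) (Y : JIdx ℓ → QALie ℓ) (r : ℤ) (t : ℝ) (s₀ : JIdx ℓ → ℝ)
    (ε : JDer ℓ → ℝ) : Set (JIdx ℓ → ℝ) :=
  {v | ∃ s : JIdx ℓ → ℝ, (∀ p : JIdx ℓ, p.2 = 0 → s p = s₀ p) ∧ (∀ q : JDer ℓ, |s q.1| ≤ ε q) ∧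
    ∃ z : JIdx ℓ → ℤ, returnDiff α r t v - hAct ℓ t (∑ p, s p • (Y p).2) = fun p => (z p : ℝ)}

/-- With the generator components of `s` frozen, the equation in the coordinates of `[𝔤, 𝔤]` places
`(h(r) - 1) v`, modulo integers, in a translate of a linear image of the box. The bound is uniform
in `t` and `s₀`, since the determinant of that linear map does not depend on `t` and translations
preserve volume. -/
theorem volume_returnSet_le (hY : IsNormalisedStronglyAdapted (Xvec α) Y) {r : ℤ} (hr : r ≠ 0)
    (t : ℝ) (s₀ : JIdx ℓ → ℝ) {ε : JDer ℓ → ℝ} (hε : ∀ q, 0 ≤ ε q) :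
    volume (returnSet α Y r t s₀ ε ∩ Set.univ.pi fun _ => Set.Ico (0 : ℝ) 1)
      ≤ ENNReal.ofReal (|(Matrix.of (Ybar Y)).det|⁻¹ * ∏ q, (2 * ε q)) := by
  set Mt : Matrix (JDer ℓ) (JDer ℓ) ℝ := Matrix.of fun q q' => hAct ℓ t (Y q'.1).2 q.1 with hMt
  set w₀ : JIdx ℓ → ℝ := ∑ p : {p : JIdx ℓ // p.2 = 0}, s₀ p.1 • (Y p.1).2 with hw₀
  set c : JDer ℓ → ℝ := fun q =>
    hAct ℓ t w₀ q.1 - hAct ℓ (r + t) (gexp ((r : ℝ) • Xvec α)).v q.1 with hc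
  set E : Set (JDer ℓ → ℝ) :=
    (fun x => x + c) '' (Matrix.toLin' Mt '' Set.Icc (fun q => -ε q) ε) with hE
  have hEc : IsCompact E := by
    have h1 : Continuous (Matrix.toLin' Mt) := LinearMap.continuous_of_finiteDimensional _
    exact (isCompact_Icc.image h1).image (continuous_id.add continuous_const)
  have hEv : volume E = ENNReal.ofReal (|(Matrix.of (Ybar Y)).det|⁻¹ * ∏ q, (2 * ε q)) := by
    rw [hE, Set.image_add_right, measure_preimage_add_right, Measure.addHaar_image_linearMap,
      LinearMap.det_toLin', hMt, abs_det_transported hY t, Real.volume_Icc_pi,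
      ENNReal.ofReal_mul (by positivity),
      ENNReal.ofReal_prod_of_nonneg fun q _ => mul_nonneg zero_le_two (hε q)]
    congr 1
    refine Finset.prod_congr rfl fun q _ => ?_
    congr 1
    ring
  rw [← hEv]
  -- Only the coordinates of `[𝔤, 𝔤]` are kept; dropping the other equations enlarges the set.
  -- Surjectivity is where `r ≠ 0` enters.
  refine le_trans (measure_mono ?_) (volume_cube_preimage_le (hSubOneMat ℓ r) ?_ hEc)
  · refine Set.inter_subset_inter_left _ ?_
    rintro v ⟨s, hs0, hsε, z, hz⟩
    refine ⟨fun q => z q.1, ?_⟩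
    refine ⟨_, ⟨fun q => s q.1, ⟨fun q => (abs_le.1 (hsε q)).1, fun q => (abs_le.1 (hsε q)).2⟩,
      rfl⟩, ?_⟩
    funext q
    have hsum : ∑ p, s p • (Y p).2 = w₀ + ∑ q : JDer ℓ, s q.1 • (Y q.1).2 := by
      rw [← Fintype.sum_subtype_add_sum_subtype (fun p : JIdx ℓ => p.2 = 0)]
      congr 1
      exact Finset.sum_congr rfl fun p _ => by rw [hs0 p.1 p.2]
    have h1 : hAct ℓ t (∑ p, s p • (Y p).2) q.1
        = hAct ℓ t w₀ q.1 + Matrix.toLin' Mt (fun q => s q.1) q := by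
      rw [hsum, hAct_vadd, Pi.add_apply, ← hLin_apply t (∑ q : JDer ℓ, _), map_sum,
        Finset.sum_apply, Matrix.toLin'_apply]
      congr 1
      refine Finset.sum_congr rfl fun q' _ => ?_
      rw [map_smul, Pi.smul_apply, smul_eq_mul, mul_comm]
      rfl
    have h2 := congrFun hz q.1
    rw [Pi.sub_apply, h1, returnDiff, Pi.add_apply, Pi.sub_apply] at h2
    rw [hSubOneMat_mulVec]
    simp only [Pi.add_apply, Pi.sub_apply, hSubOne_apply, hc]
    linarith
  · intro y
    obtain ⟨v, hv⟩ := hSubOne_surjective (ℓ := ℓ) (Int.cast_ne_zero (α := ℝ).2 hr) y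
    exact ⟨v, (hSubOneMat_mulVec r v).trans hv⟩

end Return

/-! ### The constant `Ī` -/

section BarI

variable {n : ℕ} {Yb : Fin n → Fin n → ℝ}

theorem torusPt_eq_iff (s s' : Fin n → ℝ) :
    torusPt Yb s = torusPt Yb s' ↔ ∃ z : Fin n → ℤ, ∀ m,
      Matrix.vecMul (s - s') (Matrix.of Yb) m = z m := by
  have h : ∀ m, torusPt Yb s m = torusPt Yb s' m ↔ ∃ k : ℤ,
      Matrix.vecMul (s - s') (Matrix.of Yb) m = k := by
    intro m
    have e : Matrix.vecMul (s - s') (Matrix.of Yb) m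
        = ∑ i, s i * Yb i m - ∑ i, s' i * Yb i m := by
      rw [← Finset.sum_sub_distrib]
      change ∑ i, (s i - s' i) * Yb i m = _
      exact Finset.sum_congr rfl fun i _ => sub_mul (s i) (s' i) (Yb i m)
    unfold torusPt
    rw [eq_comm, QuotientAddGroup.eq, AddSubgroup.mem_zmultiples_iff, e]
    constructor
    · rintro ⟨k, hk⟩
      exact ⟨k, by rw [zsmul_one] at hk; linarith⟩
    · rintro ⟨k, hk⟩
      exact ⟨k, by rw [zsmul_one]; linarith⟩
  constructor
  · intro e
    choose z hz using fun i => (h i).1 (congrFun e i)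
    exact ⟨z, hz⟩
  · rintro ⟨z, hz⟩
    exact funext fun i => (h i).2 ⟨z i, hz i⟩

theorem abs_vecMul_le (s : Fin n → ℝ) {c : ℝ} (hs : ∀ i, |s i| ≤ c) (M : Matrix (Fin n) (Fin n) ℝ)
    (m : Fin n) : |Matrix.vecMul s M m| ≤ c * ∑ i, |M i m| := by
  rw [Finset.mul_sum]
  change |∑ i, s i * M i m| ≤ _
  refine (Finset.abs_sum_le_sum_abs (fun i => s i * M i m) _).trans (Finset.sum_le_sum fun i _ => ?_)
  rw [abs_mul]
  exact mul_le_mul_of_nonneg_right (hs i) (abs_nonneg _)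

variable (hdet : IsUnit (Matrix.of Yb).det)

include hdet

theorem vecMul_eq_zero_of_det {s : Fin n → ℝ} (h : Matrix.vecMul s (Matrix.of Yb) = 0) : s = 0 := by
  have := congrArg (fun w => Matrix.vecMul w (Matrix.of Yb)⁻¹) h
  simpa [Matrix.vecMul_vecMul, Matrix.mul_nonsing_inv _ hdet] using this

/-- For sufficiently small parameters the integer vector relating two preimages has entries below
`1` in absolute value, so it vanishes, and `Ȳ` is invertible. -/
theorem exists_pos_injOn_torusPt :
    ∃ I' : ℝ, 0 < I' ∧ Set.InjOn (torusPt Yb) {s | ∀ i, |s i| < I'} := by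
  set S : ℝ := ∑ m, ∑ i, |Yb i m| with hS
  have hS0 : 0 ≤ S := Finset.sum_nonneg fun m _ => Finset.sum_nonneg fun i _ => abs_nonneg _
  refine ⟨1 / (2 * (S + 1)), by positivity, ?_⟩
  intro s hs s' hs' h
  obtain ⟨z, hz⟩ := (torusPt_eq_iff s s').1 h
  have hd : ∀ i, |(s - s') i| ≤ 1 / (S + 1) := by
    intro i
    have h1 := hs i
    have h2 := hs' i
    have h3 : |(s - s') i| ≤ |s i| + |s' i| := abs_sub _ _
    have h4 : 1 / (2 * (S + 1)) + 1 / (2 * (S + 1)) = 1 / (S + 1) := by field_simp; norm_num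
    linarith
  refine sub_eq_zero.1 (vecMul_eq_zero_of_det hdet (funext fun m => ?_))
  have h1 := abs_vecMul_le (s - s') hd (Matrix.of Yb) m
  have h2 : ∑ i, |Matrix.of Yb i m| ≤ S :=
    Finset.single_le_sum (f := fun m => ∑ i, |Yb i m|)
      (fun m _ => Finset.sum_nonneg fun i _ => abs_nonneg _) (Finset.mem_univ m)
  have h3 : 1 / (S + 1) * ∑ i, |Matrix.of Yb i m| < 1 := by
    rw [div_mul_eq_mul_div, one_mul, div_lt_one (by linarith)]
    linarith
  rw [hz m] at h1 ⊢
  have h4 : |((z m : ℤ) : ℝ)| < 1 := h1.trans_lt h3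
  have h5 : |z m| < 1 := by exact_mod_cast h4
  rw [Int.abs_lt_one_iff.1 h5]
  simp

theorem bddAbove_injOn_torusPt (hn : 0 < n) :
    BddAbove {I' : ℝ | 0 < I' ∧ Set.InjOn (torusPt Yb) {s | ∀ i, |s i| < I'}} := by
  -- This nonzero `s` solves `∑ s_i Ȳ_i = (1, …, 1)`, so it collides with `0` on the torus; no
  -- admissible radius exceeds `∑ |s_i|`.
  set s : Fin n → ℝ := Matrix.vecMul (fun _ => (1 : ℝ)) (Matrix.of Yb)⁻¹ with hs
  have hsY : Matrix.vecMul s (Matrix.of Yb) = fun _ => 1 := by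
    rw [hs, Matrix.vecMul_vecMul, Matrix.nonsing_inv_mul _ hdet, Matrix.vecMul_one]
  have hs0 : s ≠ 0 := by
    intro h
    rw [h, Matrix.zero_vecMul] at hsY
    exact zero_ne_one (congrFun hsY ⟨0, hn⟩)
  refine ⟨∑ i, |s i|, ?_⟩
  rintro I' ⟨hI, hinj⟩
  by_contra! hlt
  have h1 : ∀ i, |s i| < I' := fun i =>
    (Finset.single_le_sum (f := fun i => |s i|) (fun i _ => abs_nonneg _)
      (Finset.mem_univ i)).trans_lt hlt
  refine hs0 (hinj h1 (show ∀ i, |(0 : Fin n → ℝ) i| < I' by simpa using fun _ => hI) ?_)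
  refine (torusPt_eq_iff _ _).2 ⟨fun _ => 1, fun m => ?_⟩
  rw [sub_zero, hsY]
  simp

theorem barI_pos (hn : 0 < n) : 0 < barI Yb := by
  obtain ⟨I', h⟩ := exists_pos_injOn_torusPt hdet
  exact h.1.trans_le (le_csSup (bddAbove_injOn_torusPt hdet hn) h)

theorem injOn_torusPt_barI : Set.InjOn (torusPt Yb) {s | ∀ i, |s i| ≤ barI Yb / 2} := by
  -- For `n = 0` every radius is admissible and the supremum is a default value, but the parameter
  -- space is a point.
  rcases Nat.eq_zero_or_pos n with rfl | hn
  · exact fun s _ s' _ _ => Subsingleton.elim _ _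
  have hpos := barI_pos hdet hn
  obtain ⟨I', hI', hlt⟩ := exists_lt_of_lt_csSup
    (let ⟨I', h⟩ := exists_pos_injOn_torusPt hdet; ⟨I', h⟩) (half_lt_self hpos)
  exact hI'.2.mono fun s hs i => (hs i).trans_lt hlt

theorem barNorm_eq {θ : Fin n → ℝ} {s : Fin n → ℝ} (hs : ∀ i, |s i| ≤ barI Yb / 2)
    (h : (fun m => ((θ m : ℝ) : UnitAddCircle)) = torusPt Yb s) (i : Fin n) :
    barNorm Yb θ i = |s i| := by
  have hex : ∃ s : Fin n → ℝ, (∀ k, |s k| ≤ barI Yb / 2) ∧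
      (fun m => ((θ m : ℝ) : UnitAddCircle)) = torusPt Yb s := ⟨s, hs, h⟩
  unfold barNorm
  rw [dif_pos hex]
  have h2 := hex.choose_spec
  rw [injOn_torusPt_barI hdet h2.1 hs (h2.2.symm.trans h)]

end BarI

/-! ### Counting close returns -/

section Count

variable {n : ℕ} (Yb : Fin n → Fin n → ℝ) (α : Fin n → ℝ)

/-- The solution `s` of `∑ s_i Ȳ_i = r α - z`. -/
noncomputable def torusSol : ℤ × (Fin n → ℤ) →+ (Fin n → ℝ) where
  toFun p := Matrix.vecMul (fun m => (p.1 : ℝ) * α m - (p.2 m : ℝ)) (Matrix.of Yb)⁻¹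
  map_zero' := by
    have : (fun m => (((0 : ℤ × (Fin n → ℤ)).1 : ℤ) : ℝ) * α m
        - (((0 : ℤ × (Fin n → ℤ)).2 m : ℤ) : ℝ)) = 0 := by
      funext m; simp
    rw [this, Matrix.zero_vecMul]
  map_add' p p' := by
    rw [← Matrix.add_vecMul]
    congr 1
    funext m
    simp only [Prod.fst_add, Prod.snd_add, Pi.add_apply]
    push_cast
    ring

theorem vecMul_torusSol (hdet : IsUnit (Matrix.of Yb).det) (p : ℤ × (Fin n → ℤ)) (m : Fin n) :
    Matrix.vecMul (torusSol Yb α p) (Matrix.of Yb) m = p.1 * α m - p.2 m := by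
  change Matrix.vecMul (Matrix.vecMul (fun m => (p.1 : ℝ) * α m - (p.2 m : ℝ))
    (Matrix.of Yb)⁻¹) (Matrix.of Yb) m = _
  rw [Matrix.vecMul_vecMul, Matrix.nonsing_inv_mul _ hdet, Matrix.vecMul_one]

theorem torusSol_eq (hdet : IsUnit (Matrix.of Yb).det) {p : ℤ × (Fin n → ℤ)} {s : Fin n → ℝ}
    (h : ∀ m, Matrix.vecMul s (Matrix.of Yb) m = p.1 * α m - p.2 m) : torusSol Yb α p = s := by
  refine sub_eq_zero.1 (vecMul_eq_zero_of_det hdet (funext fun m => ?_))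
  rw [Matrix.sub_vecMul, Pi.sub_apply, vecMul_torusSol Yb α hdet, h, sub_self, Pi.zero_apply]

/-- The pairs `(r, z)`, `|r| ≤ N`, such that the solution of `∑ s_i Ȳ_i = r α - z` satisfies
`|s_i| ≤ τ ^ σ_i u`. -/
def returnPairs (σ : Fin n → ℝ) (τ : ℝ) (N : ℕ) (u : ℝ) : Set (ℤ × (Fin n → ℤ)) :=
  {p | |p.1| ≤ N ∧ ∀ i, |torusSol Yb α p i| ≤ τ ^ σ i * u}

variable {Yb α} {σ : Fin n → ℝ} {τ : ℝ} (hdet : IsUnit (Matrix.of Yb).det)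

include hdet

theorem finite_returnPairs (N : ℕ) (u : ℝ) : (returnPairs Yb α σ τ N u).Finite := by
  set c : ℝ := ∑ i, |τ ^ σ i * u| with hc
  set R : Fin n → ℝ := fun m => N * |α m| + c * ∑ i, |Yb i m| with hR
  refine ((Set.finite_Icc (-(N : ℤ)) N).prod
    (Set.Finite.pi' (t := fun m => Set.Icc (-⌈R m⌉) ⌈R m⌉) fun m => Set.finite_Icc _ _)).subset ?_
  rintro p ⟨h1, h2⟩
  refine ⟨abs_le.1 h1, fun m => ?_⟩
  have h3 : ∀ i, |torusSol Yb α p i| ≤ c := fun i => (h2 i).trans ((le_abs_self _).trans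
    (Finset.single_le_sum (f := fun i => |τ ^ σ i * u|) (fun i _ => abs_nonneg _)
      (Finset.mem_univ i)))
  have h4 := abs_vecMul_le _ h3 (Matrix.of Yb) m
  rw [vecMul_torusSol Yb α hdet] at h4
  have h5 : |(p.1 : ℝ)| ≤ N := by exact_mod_cast h1
  have h6 : |(p.1 : ℝ) * α m| ≤ N * |α m| := by
    rw [abs_mul]; exact mul_le_mul_of_nonneg_right h5 (abs_nonneg _)
  have h7 : |(p.2 m : ℝ)| ≤ R m := by
    have : (p.2 m : ℝ) = p.1 * α m - (p.1 * α m - p.2 m) := by ring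
    rw [this]
    exact (abs_sub _ _).trans (add_le_add h6 h4)
  have h8 : |(p.2 m : ℝ)| ≤ (⌈R m⌉ : ℤ) := h7.trans (Int.le_ceil _)
  exact abs_le.1 (by exact_mod_cast h8)

variable {ν C : ℝ} (hD : IsDiophantineWith Yb σ ν α C) (hτ0 : 0 < τ) (hτ1 : τ ≤ 1)

include hD hτ0 hτ1

omit hdet hτ1 in
-- The boxes of `returnPairs` are linear in `u`, so that differences and multiples stay in the
-- family. As `σ_i ≤ 1` and `u ≤ 1`, they fit into the anisotropic Diophantine box with `δ = τ u`.
theorem weight_scale_le {u : ℝ} (hu0 : 0 < u) (hu1 : u ≤ 1) (i : Fin n) :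
    τ ^ σ i * u ≤ (τ * u) ^ σ i := by
  have h1 : σ i ≤ 1 := by
    rw [← hD.weight_sum]
    exact Finset.single_le_sum (fun j _ => (hD.weight_pos j).le) (Finset.mem_univ i)
  rw [Real.mul_rpow hτ0.le hu0.le]
  refine mul_le_mul_of_nonneg_left ?_ (Real.rpow_nonneg hτ0.le _)
  calc u = u ^ (1 : ℝ) := (Real.rpow_one u).symm
    _ ≤ u ^ σ i := Real.rpow_le_rpow_of_exponent_ge hu0 hu1 h1

/-- Within radius `Ī/2` the torus chart is injective, so `r` determines `z` and the pairs inject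
into the close returns counted by the Diophantine condition. -/
theorem ncard_returnPairs_le_of_small {N : ℕ} (hN : 1 ≤ N) {u : ℝ} (hu0 : 0 < u) (hu1 : u ≤ 1)
    (hub : u ≤ barI Yb / 2) :
    ((returnPairs Yb α σ τ N u).ncard : ℝ) ≤ C * max ((N : ℝ) ^ (1 - 1 / ν)) (N * τ * u) := by
  have hbox : ∀ p ∈ returnPairs Yb α σ τ N u, ∀ i, |torusSol Yb α p i| ≤ barI Yb / 2 := by
    intro p hp i
    refine (hp.2 i).trans (le_trans ?_ hub)
    have := Real.rpow_le_one hτ0.le hτ1 (hD.weight_pos i).le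
    nlinarith
  have hpt : ∀ p : ℤ × (Fin n → ℤ),
      (fun m => (((p.1 : ℝ) * α m : ℝ) : UnitAddCircle)) = torusPt Yb (torusSol Yb α p) := by
    intro p
    funext m
    have h := vecMul_torusSol Yb α hdet p m
    change ∑ i, torusSol Yb α p i * Yb i m = _ at h
    unfold torusPt
    rw [h, eq_comm, QuotientAddGroup.eq, AddSubgroup.mem_zmultiples_iff]
    exact ⟨p.2 m, by rw [zsmul_one]; ring⟩
  have hinj : Set.InjOn Prod.fst (returnPairs Yb α σ τ N u) := by
    intro p hp p' hp' h
    have e : torusSol Yb α p = torusSol Yb α p' :=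
      injOn_torusPt_barI hdet (hbox p hp) (hbox p' hp') (by rw [← hpt, ← hpt, h])
    refine Prod.ext h (funext fun m => ?_)
    have h1 := vecMul_torusSol Yb α hdet p m
    have h2 := vecMul_torusSol Yb α hdet p' m
    rw [e, h2, h] at h1
    have h3 : (p.2 m : ℝ) = p'.2 m := by linarith
    exact_mod_cast h3
  have hmaps : Prod.fst '' returnPairs Yb α σ τ N u ⊆ closeReturns Yb σ α N (τ * u) := by
    rintro _ ⟨p, hp, rfl⟩
    refine ⟨(abs_le.1 hp.1).1, (abs_le.1 hp.1).2, fun i => ?_⟩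
    rw [barNorm_eq hdet (hbox p hp) (hpt p)]
    exact (hp.2 i).trans (weight_scale_le hD hτ0 hu0 hu1 i)
  have hfin : (closeReturns Yb σ α N (τ * u)).Finite :=
    (Set.finite_Icc (-(N : ℤ)) N).subset fun r hr => ⟨hr.1, hr.2.1⟩
  have h1 : (returnPairs Yb α σ τ N u).ncard ≤ (closeReturns Yb σ α N (τ * u)).ncard := by
    rw [← hinj.ncard_image]
    exact Set.ncard_le_ncard hmaps hfin
  refine (Nat.cast_le.2 h1).trans ((hD.bound N hN (τ * u) (mul_pos hτ0 hu0)).trans_eq ?_)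
  rw [mul_assoc]

end Count

section Count2

variable {n : ℕ} {Yb : Fin n → Fin n → ℝ} {α : Fin n → ℝ} {σ : Fin n → ℝ} {τ ν C : ℝ}

theorem sub_mem_returnPairs {N : ℕ} {w b : ℝ} {p p' : ℤ × (Fin n → ℤ)}
    (hp : p ∈ returnPairs Yb α σ τ N w) (hp' : p' ∈ returnPairs Yb α σ τ N w)
    (h : ∀ i, |torusSol Yb α p i - torusSol Yb α p' i| ≤ τ ^ σ i * b) :
    p - p' ∈ returnPairs Yb α σ τ (2 * N) b := by
  refine ⟨?_, fun i => ?_⟩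
  · have h1 := hp.1
    have h2 := hp'.1
    have h3 : |p.1 - p'.1| ≤ |p.1| + |p'.1| := abs_sub _ _
    rw [Prod.fst_sub]
    push_cast
    linarith
  · rw [map_sub, Pi.sub_apply]
    exact h i

theorem nsmul_mem_returnPairs {N : ℕ} {u : ℝ} {p : ℤ × (Fin n → ℤ)}
    (hp : p ∈ returnPairs Yb α σ τ N u) {k K : ℕ} (hk : k ≤ K) :
    k • p ∈ returnPairs Yb α σ τ (K * N) (K * u) := by
  have hkR : (k : ℝ) ≤ K := Nat.cast_le.2 hk
  refine ⟨?_, fun i => ?_⟩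
  · rw [Prod.smul_fst, nsmul_eq_mul, abs_mul, Nat.abs_cast]
    push_cast
    exact mul_le_mul (Nat.cast_le.2 hk) hp.1 (abs_nonneg _) (Nat.cast_nonneg _)
  · rw [map_nsmul, Pi.smul_apply, nsmul_eq_mul, abs_mul, Nat.abs_cast]
    have h := hp.2 i
    have h0 := abs_nonneg (torusSol Yb α p i)
    calc (k : ℝ) * |torusSol Yb α p i| ≤ K * (τ ^ σ i * u) :=
          mul_le_mul hkR h h0 (Nat.cast_nonneg _)
      _ = τ ^ σ i * (K * u) := by ring

variable (hdet : IsUnit (Matrix.of Yb).det) (hD : IsDiophantineWith Yb σ ν α C) (hτ0 : 0 < τ)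
  (hτ1 : τ ≤ 1) (hn : 0 < n) (hν : 1 ≤ ν)

include hdet hD hτ0 hτ1 hn hν

/-- Beyond `Ī/2` the chart is no longer injective. The box is cut into cells of relative size `b =
min(u, Ī/2)`; subtracting a fixed pair of a cell from the others gives pairs in the small box for
`2N`, and there are of order `1 + (u/Ī)^n` cells. -/
theorem ncard_returnPairs_le {N : ℕ} (hN : 1 ≤ N) {u : ℝ} (hu0 : 0 < u) (hu1 : u ≤ 1) :
    ((returnPairs Yb α σ τ N u).ncard : ℝ) ≤
      2 * 8 ^ n * (1 + (u / barI Yb) ^ n) * (C * max ((N : ℝ) ^ (1 - 1 / ν)) (N * τ * u)) := by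
  classical
  have hĪ := barI_pos hdet hn
  have hC := hD.const_pos
  set b : ℝ := min u (barI Yb / 2) with hb
  have hb0 : 0 < b := lt_min hu0 (by positivity)
  have hN0 : (0 : ℝ) < N := by exact_mod_cast hN
  set w : ℝ := u / b with hw
  have hw0 : 0 ≤ w := by positivity
  have hwle : w ≤ 1 + 2 * (u / barI Yb) := by
    have h0 : 0 ≤ u / barI Yb := by positivity
    rcases min_choice u (barI Yb / 2) with h | h
    · rw [hw, hb, h, div_self hu0.ne']; linarith
    · rw [hw, hb, h]
      have : u / (barI Yb / 2) = 2 * (u / barI Yb) := by field_simp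
      linarith
  have hfin := finite_returnPairs (α := α) (σ := σ) (τ := τ) hdet N u
  have hfin2 := finite_returnPairs (α := α) (σ := σ) (τ := τ) hdet (2 * N) b
  have hsc : ∀ i, 0 < τ ^ σ i * b := fun i => mul_pos (Real.rpow_pos_of_pos hτ0 _) hb0
  let f : ℤ × (Fin n → ℤ) → Fin n → ℤ := fun p i => ⌊torusSol Yb α p i / (τ ^ σ i * b)⌋
  let t : Finset (Fin n → ℤ) := Fintype.piFinset fun _ => Finset.Icc (-(⌊w⌋ + 1)) ⌊w⌋
  have hmaps : ∀ p ∈ hfin.toFinset, f p ∈ t := by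
    intro p hp
    rw [Set.Finite.mem_toFinset] at hp
    refine Fintype.mem_piFinset.2 fun i => ?_
    have h1 : |torusSol Yb α p i / (τ ^ σ i * b)| ≤ w := by
      rw [abs_div, abs_of_pos (hsc i), div_le_iff₀ (hsc i)]
      refine (hp.2 i).trans_eq ?_
      rw [hw]; field_simp
    obtain ⟨h2, h3⟩ := abs_le.1 h1
    refine Finset.mem_Icc.2 ⟨Int.le_floor.2 ?_, Int.floor_le_floor h3⟩
    have := Int.lt_floor_add_one w
    push_cast
    linarith
  -- Translation by one member `p₀` of the cell injects it into a small box; the range of `r`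
  -- doubles.
  have hfib : ∀ c ∈ t, (hfin.toFinset.filter fun p => f p = c).card
      ≤ (returnPairs Yb α σ τ (2 * N) b).ncard := by
    intro c _
    rcases (hfin.toFinset.filter fun p => f p = c).eq_empty_or_nonempty with h | ⟨p₀, hp₀⟩
    · rw [h]; simp
    rw [Set.ncard_eq_toFinset_card _ hfin2]
    refine Finset.card_le_card_of_injOn (fun p => p - p₀) ?_ (fun p _ p' _ h => sub_left_injective h)
    intro p hp
    have hp := Finset.mem_filter.1 (Finset.mem_coe.1 hp)
    have hp₀ := Finset.mem_filter.1 hp₀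
    rw [Finset.mem_coe, Set.Finite.mem_toFinset]
    refine sub_mem_returnPairs (hfin.mem_toFinset.1 hp.1) (hfin.mem_toFinset.1 hp₀.1) fun i => ?_
    have h1 : f p i = f p₀ i := by rw [hp.2, hp₀.2]
    have h2 := Int.abs_sub_lt_one_of_floor_eq_floor h1
    rw [← sub_div, abs_div, abs_of_pos (hsc i), div_lt_one (hsc i)] at h2
    exact h2.le
  have hcard := Finset.card_le_mul_card_image_of_maps_to hmaps _ hfib
  have ht : (t.card : ℝ) ≤ (4 + 4 * (u / barI Yb)) ^ n := by
    have h0 : (0 : ℤ) ≤ ⌊w⌋ := Int.floor_nonneg.2 hw0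
    have h1 : t.card = (2 * ⌊w⌋ + 2).toNat ^ n := by
      simp only [t, Fintype.card_piFinset, Int.card_Icc, Finset.prod_const, Finset.card_univ,
        Fintype.card_fin]
      congr 2
      ring
    have h2 : ((2 * ⌊w⌋ + 2).toNat : ℝ) = 2 * (⌊w⌋ : ℝ) + 2 := by
      rw [← Int.cast_natCast, Int.toNat_of_nonneg (by omega)]
      push_cast
      ring
    rw [h1, Nat.cast_pow, h2]
    have h3 := Int.floor_le w
    have h4 : (0 : ℝ) ≤ ⌊w⌋ := by exact_mod_cast h0
    exact pow_le_pow_left₀ (by linarith) (by linarith) n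
  have hpow : (4 + 4 * (u / barI Yb)) ^ n ≤ 8 ^ n * (1 + (u / barI Yb) ^ n) := by
    have h0 : 0 ≤ u / barI Yb := by positivity
    have h1 := add_pow_le (zero_le_one' ℝ) h0 n
    rw [one_pow] at h1
    have h2 : (2 : ℝ) ^ (n - 1) ≤ 2 ^ n := pow_le_pow_right₀ (by norm_num) (Nat.sub_le _ _)
    calc (4 + 4 * (u / barI Yb)) ^ n = 4 ^ n * (1 + u / barI Yb) ^ n := by rw [← mul_pow]; ring
      _ ≤ 4 ^ n * (2 ^ n * (1 + (u / barI Yb) ^ n)) := by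
          refine mul_le_mul_of_nonneg_left (h1.trans ?_) (by positivity)
          exact mul_le_mul_of_nonneg_right h2 (by positivity)
      _ = 8 ^ n * (1 + (u / barI Yb) ^ n) := by
          rw [← mul_assoc, ← mul_pow]; norm_num
  have hsmall := ncard_returnPairs_le_of_small hdet hD hτ0 hτ1 (N := 2 * N) (by omega) hb0
    ((min_le_left _ _).trans hu1) (min_le_right _ _)
  have hexp0 : 0 ≤ 1 - 1 / ν := by
    rw [sub_nonneg, div_le_one (by linarith)]; exact hν
  have hexp1 : 1 - 1 / ν ≤ 1 := by
    have : 0 ≤ 1 / ν := by positivity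
    linarith
  have hmax : max (((2 * N : ℕ) : ℝ) ^ (1 - 1 / ν)) ((2 * N : ℕ) * τ * b)
      ≤ 2 * max ((N : ℝ) ^ (1 - 1 / ν)) (N * τ * u) := by
    push_cast
    refine max_le ?_ ?_
    · rw [Real.mul_rpow (by norm_num) hN0.le]
      have h1 : (2 : ℝ) ^ (1 - 1 / ν) ≤ 2 := by
        calc (2 : ℝ) ^ (1 - 1 / ν) ≤ 2 ^ (1 : ℝ) :=
              Real.rpow_le_rpow_of_exponent_le (by norm_num) hexp1
          _ = 2 := Real.rpow_one 2
      exact mul_le_mul h1 (le_max_left _ _) (by positivity) (by norm_num)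
    · have h1 : N * τ * b ≤ N * τ * u :=
        mul_le_mul_of_nonneg_left (min_le_left _ _) (by positivity)
      have h2 := h1.trans (le_max_right ((N : ℝ) ^ (1 - 1 / ν)) _)
      linarith
  rw [Set.ncard_eq_toFinset_card _ hfin]
  have hM0 : 0 ≤ max ((N : ℝ) ^ (1 - 1 / ν)) (N * τ * u) := le_max_of_le_left (by positivity)
  calc (hfin.toFinset.card : ℝ)
      ≤ (returnPairs Yb α σ τ (2 * N) b).ncard * t.card := by exact_mod_cast hcard
    _ ≤ (C * (2 * max ((N : ℝ) ^ (1 - 1 / ν)) (N * τ * u))) * (8 ^ n * (1 + (u / barI Yb) ^ n)) := by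
        refine mul_le_mul (hsmall.trans (mul_le_mul_of_nonneg_left hmax hC.le)) (ht.trans hpow)
          (Nat.cast_nonneg _) (by positivity)
    _ = _ := by ring

/-- A pair with `r ≠ 0` and very small `u` would have too many small multiples: `0, p, …, K p` are
`K + 1` distinct pairs in the box for `(KN, Ku)`, whereas the Diophantine count there is at most
`K`. -/
theorem returnPairs_lower_bound {N : ℕ} (hN : 1 ≤ N) {u : ℝ} (hu0 : 0 < u)
    {p : ℤ × (Fin n → ℤ)} (hp : p ∈ returnPairs Yb α σ τ N u) (hp0 : p.1 ≠ 0) :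
    min (barI Yb) 1 / (4 * ((1 + C) * N) ^ (ν + 1)) < u := by
  by_contra! hle
  have hĪ := barI_pos hdet hn
  have hC := hD.const_pos
  have hN1 : (1 : ℝ) ≤ N := by exact_mod_cast hN
  set B : ℝ := (1 + C) * N with hB
  have hB1 : 1 ≤ B := by nlinarith
  have hB0 : 0 < B := by linarith
  have hCN : C * N ≤ B := by nlinarith
  have hν0 : 0 < ν := by linarith
  have hBν : 1 ≤ B ^ ν := Real.one_le_rpow hB1 hν0.le
  -- `K > B^ν` makes `C N ≤ B ≤ K^{1/ν}`, which defeats the first term of the maximum; `K ≤ 2 B^ν`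
  -- keeps `K u` below `1/(2B)`, which defeats the second, and below `Ī/2`, as the count requires.
  set K : ℕ := ⌊B ^ ν⌋₊ + 1 with hK
  have hK0 : (0 : ℝ) < K := by positivity
  have hK1 : (1 : ℝ) ≤ K := by rw [hK]; push_cast; linarith [(Nat.cast_nonneg ⌊B ^ ν⌋₊ : (0:ℝ) ≤ _)]
  have hKlt : B ^ ν < K := by rw [hK]; push_cast; exact Nat.lt_floor_add_one _
  have hKle : (K : ℝ) ≤ 2 * B ^ ν := by
    have := Nat.floor_le (by linarith : 0 ≤ B ^ ν)
    rw [hK]; push_cast; linarith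
  have hKu : K * u ≤ min (barI Yb) 1 / (2 * B) := by
    calc K * u ≤ (2 * B ^ ν) * (min (barI Yb) 1 / (4 * B ^ (ν + 1))) :=
          mul_le_mul hKle hle hu0.le (by positivity)
      _ = min (barI Yb) 1 / (2 * B) := by
          rw [Real.rpow_add_one hB0.ne']
          field_simp
          norm_num
  have hm0 : 0 < min (barI Yb) 1 := lt_min hĪ one_pos
  have hKu2 : K * u ≤ min (barI Yb) 1 / 2 :=
    hKu.trans (div_le_div_of_nonneg_left hm0.le (by norm_num) (by linarith))
  have hKu3 : K * u ≤ 1 / (2 * B) :=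
    hKu.trans (div_le_div_of_nonneg_right (min_le_right _ _) (by positivity))
  have hKu4 : K * u ≤ barI Yb / 2 := hKu2.trans (by linarith [min_le_left (barI Yb) 1])
  have hKu5 : K * u ≤ 1 := hKu2.trans (by linarith [min_le_right (barI Yb) 1])
  have hKN : 1 ≤ K * N := Nat.one_le_iff_ne_zero.2 (by rw [hK]; positivity)
  have hcount := ncard_returnPairs_le_of_small hdet hD hτ0 hτ1 hKN (mul_pos hK0 hu0) hKu5 hKu4
  have hlow : K + 1 ≤ (returnPairs Yb α σ τ (K * N) (K * u)).ncard := by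
    have hinj : Function.Injective fun k : ℕ => k • p := by
      intro k k' h
      have h1 : k • p.1 = k' • p.1 := congrArg Prod.fst h
      rw [nsmul_eq_mul, nsmul_eq_mul] at h1
      exact_mod_cast mul_right_cancel₀ hp0 h1
    calc K + 1 = ((Finset.range (K + 1)).image fun k : ℕ => k • p).card := by
          rw [Finset.card_image_of_injective _ hinj, Finset.card_range]
      _ ≤ _ := by
          rw [← Set.ncard_coe_finset]
          refine Set.ncard_le_ncard ?_ (finite_returnPairs hdet _ _)
          intro x hx
          obtain ⟨k, hk, rfl⟩ := Finset.mem_image.1 (Finset.mem_coe.1 hx)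
          exact nsmul_mem_returnPairs hp (Nat.lt_succ_iff.1 (Finset.mem_range.1 hk))
  have hlow' : (K : ℝ) + 1 ≤ C * max (((K * N : ℕ) : ℝ) ^ (1 - 1 / ν)) ((K * N : ℕ) * τ * (K * u)) :=
    le_trans (by exact_mod_cast hlow) hcount
  rw [mul_max_of_nonneg _ _ hC.le] at hlow'
  have hexp0 : 0 ≤ 1 - 1 / ν := by
    rw [sub_nonneg, div_le_one hν0]; exact hν
  have hexp1 : 1 - 1 / ν ≤ 1 := by
    have : 0 ≤ 1 / ν := by positivity
    linarith
  rcases le_max_iff.1 hlow' with h | h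
  · push_cast at h
    rw [Real.mul_rpow hK0.le (by linarith)] at h
    have h1 : (N : ℝ) ^ (1 - 1 / ν) ≤ N := by
      calc (N : ℝ) ^ (1 - 1 / ν) ≤ (N : ℝ) ^ (1 : ℝ) :=
            Real.rpow_le_rpow_of_exponent_le hN1 hexp1
        _ = N := Real.rpow_one _
    have h2 : B ≤ (K : ℝ) ^ (1 / ν) := by
      calc B = (B ^ ν) ^ (1 / ν) := by
            rw [← Real.rpow_mul hB0.le, mul_one_div_cancel hν0.ne', Real.rpow_one]
        _ ≤ (K : ℝ) ^ (1 / ν) := Real.rpow_le_rpow (by linarith) hKlt.le (by positivity)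
    have h3 : (K : ℝ) ^ (1 / ν) * (K : ℝ) ^ (1 - 1 / ν) = K := by
      rw [← Real.rpow_add hK0]
      simp
    have h4 : 0 ≤ (K : ℝ) ^ (1 - 1 / ν) := by positivity
    have h5 : C * ((K : ℝ) ^ (1 - 1 / ν) * (N : ℝ) ^ (1 - 1 / ν)) ≤ K := by
      calc C * ((K : ℝ) ^ (1 - 1 / ν) * (N : ℝ) ^ (1 - 1 / ν))
          ≤ C * ((K : ℝ) ^ (1 - 1 / ν) * N) := by gcongr
        _ = C * N * (K : ℝ) ^ (1 - 1 / ν) := by ring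
        _ ≤ (K : ℝ) ^ (1 / ν) * (K : ℝ) ^ (1 - 1 / ν) :=
            mul_le_mul_of_nonneg_right (hCN.trans h2) h4
        _ = K := h3
    linarith
  · push_cast at h
    have h1 : C * (K * N * τ * (K * u)) ≤ K := by
      calc C * (K * N * τ * (K * u)) ≤ C * (K * N * 1 * (1 / (2 * B))) := by gcongr
        _ = K * (C * N / B) / 2 := by field_simp
        _ ≤ K * 1 / 2 := by
            gcongr
            rw [div_le_one hB0]; exact hCN
        _ ≤ K := by linarith
    linarith

end Count2

/-! ### Dyadic summation -/

/-- The first `m` terms are at most `1`; from then on `X ≤ 2^m` leaves a geometric tail of sum at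
most `1`. -/
theorem sum_min_one_le {X : ℝ} {m d : ℕ} (hd : 1 ≤ d) (hX0 : 0 ≤ X) (hX : X ≤ 2 ^ m) (J : ℕ) :
    ∑ j ∈ Finset.range J, min 1 (X / 2 ^ ((j + 1) * d)) ≤ m + 1 := by
  have hterm : ∀ j : ℕ, 0 ≤ min 1 (X / 2 ^ ((j + 1) * d)) := fun j => by positivity
  calc ∑ j ∈ Finset.range J, min 1 (X / 2 ^ ((j + 1) * d))
      ≤ ∑ j ∈ Finset.range (m + J), min 1 (X / 2 ^ ((j + 1) * d)) :=
        Finset.sum_le_sum_of_subset_of_nonneg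
          (Finset.range_subset_range.2 (Nat.le_add_left _ _)) fun j _ _ => hterm j
    _ = ∑ j ∈ Finset.range m, min 1 (X / 2 ^ ((j + 1) * d))
        + ∑ j ∈ Finset.range J, min 1 (X / 2 ^ ((m + j + 1) * d)) := Finset.sum_range_add _ _ _
    _ ≤ ∑ j ∈ Finset.range m, 1 + ∑ j ∈ Finset.range J, (1 / 2 : ℝ) ^ j * (1 / 2) := by
        refine add_le_add (Finset.sum_le_sum fun j _ => min_le_left _ _)
          (Finset.sum_le_sum fun j _ => (min_le_right _ _).trans ?_)
        have h1 : (2 : ℝ) ^ (m + j + 1) ≤ 2 ^ ((m + j + 1) * d) :=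
          pow_le_pow_right₀ (by norm_num) (Nat.le_mul_of_pos_right _ hd)
        calc X / 2 ^ ((m + j + 1) * d) ≤ 2 ^ m / 2 ^ (m + j + 1) :=
              div_le_div₀ (by positivity) hX (by positivity) h1
          _ = (1 / 2 : ℝ) ^ j * (1 / 2) := by
              rw [pow_add, pow_add, div_pow, one_pow]; field_simp
    _ ≤ m + 1 := by
        rw [← Finset.sum_mul, Finset.sum_const, Finset.card_range, nsmul_eq_mul, mul_one]
        have h := geom_sum_eq (show (1 / 2 : ℝ) ≠ 1 by norm_num) J
        have h2 : (((1 / 2 : ℝ) ^ J - 1) / (1 / 2 - 1)) * (1 / 2) = 1 - (1 / 2) ^ J := by ring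
        rw [h, h2]
        have : (0 : ℝ) ≤ (1 / 2) ^ J := by positivity
        linarith

/-- The dyadic size of `δ`, in terms of the number of scales `2^{-k} I / 2` above it. -/
theorem two_div_le_of_card {I δ : ℝ} {M e : ℕ} (hI0 : 0 < I)
    (hM : I / 2 / 2 ^ (M + 1) ≤ δ) (he : 1 / I ≤ 2 ^ e) :
    2 / δ ≤ 2 ^ (((Finset.Icc 1 M).filter fun k => δ ≤ I / 2 / 2 ^ k).card + 3 + e) := by
  set k := ((Finset.Icc 1 M).filter fun k => δ ≤ I / 2 / 2 ^ k).card with hk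
  -- The scales above `δ` form an initial segment of `[1, M]`, so their number locates `δ`; the
  -- hypothesis on `M` covers the case in which all of them are above `δ`.
  have key : I / 2 / 2 ^ (k + 1) ≤ δ := by
    by_contra! hlt
    have hkM : k < M := by
      by_contra! h
      refine absurd hM (not_le.2 (hlt.trans_le ?_))
      exact div_le_div_of_nonneg_left (by positivity) (by positivity)
        (pow_le_pow_right₀ (by norm_num) (by omega))
    have hsub : Finset.Icc 1 (k + 1) ⊆ (Finset.Icc 1 M).filter fun k => δ ≤ I / 2 / 2 ^ k := by
      intro i hi
      rw [Finset.mem_Icc] at hi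
      refine Finset.mem_filter.2 ⟨Finset.mem_Icc.2 ⟨hi.1, by omega⟩, hlt.le.trans ?_⟩
      exact div_le_div_of_nonneg_left (by positivity) (by positivity)
        (pow_le_pow_right₀ (by norm_num) hi.2)
    have := Finset.card_le_card hsub
    rw [Nat.card_Icc] at this
    omega
  calc 2 / δ ≤ 2 / (I / 2 / 2 ^ (k + 1)) :=
        div_le_div_of_nonneg_left (by norm_num) (by positivity) key
    _ = 2 ^ (k + 3) * (1 / I) := by rw [pow_succ, pow_add]; field_simp
    _ ≤ 2 ^ (k + 3) * 2 ^ e := mul_le_mul_of_nonneg_left he (by positivity)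
    _ = 2 ^ (k + 3 + e) := (pow_add _ _ _).symm

theorem exists_pow_two_ge {x : ℝ} (hx : 1 ≤ x) : ∃ e : ℕ, x ≤ 2 ^ e ∧ (e : ℝ) ≤ 1 + 2 * Real.log x := by
  refine ⟨⌈Real.logb 2 x⌉₊, ?_, ?_⟩
  · have h := Nat.le_ceil (Real.logb 2 x)
    rwa [Real.logb_le_iff_le_rpow (by norm_num) (by linarith), Real.rpow_natCast] at h
  · have h0 : 0 ≤ Real.logb 2 x := Real.logb_nonneg (by norm_num) hx
    have h1 := Nat.ceil_lt_add_one h0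
    have h2 : Real.logb 2 x ≤ 2 * Real.log x := by
      rw [Real.logb, div_le_iff₀ (Real.log_pos (by norm_num))]
      have := Real.log_two_gt_d9
      have := Real.log_nonneg hx
      nlinarith
    linarith

/-- In the application `A` is the counting bound, `Q = max(1, I/Ī)^n`, `lI = log⁺(1/I)`, `lB =
log((1 + C)N)`, `M` is the number of dyadic scales and `2^e ≥ 1/I`. -/
theorem dyadic_sum_arith {n ν A Q lI lB M e : ℝ} (hn : 1 ≤ n) (hν : 1 ≤ ν) (hA : 0 ≤ A)
    (hQ : 1 ≤ Q) (hI : 0 ≤ lI) (hB : 0 ≤ lB) (hM : M ≤ 1 + 2 * ((ν + 1) * lB + Q))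
    (he : e ≤ 1 + 2 * lI) :
    n * (A * (M + Q)) + 2 * A * Q * (n * (3 + e) + 1)
      ≤ n * A * Q * (16 * (ν + 1) * (1 + lI + lB)) := by
  have hM2 : M + Q ≤ Q * (4 + 2 * (ν + 1) * lB) := by
    have h0 : 0 ≤ (Q - 1) * ((ν + 1) * lB) := mul_nonneg (by linarith) (by positivity)
    linarith
  have he2 : n * (3 + e) + 1 ≤ n * (5 + 2 * lI) := by
    have h0 : n * e ≤ n * (1 + 2 * lI) := mul_le_mul_of_nonneg_left he (by linarith)
    linarith
  calc n * (A * (M + Q)) + 2 * A * Q * (n * (3 + e) + 1)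
      ≤ n * (A * (Q * (4 + 2 * (ν + 1) * lB))) + 2 * A * Q * (n * (5 + 2 * lI)) := by
        gcongr
    _ = n * A * Q * (14 + 4 * lI + 2 * (ν + 1) * lB) := by ring
    _ ≤ n * A * Q * (16 * (ν + 1) * (1 + lI + lB)) := by
        refine mul_le_mul_of_nonneg_left ?_ (by positivity)
        have h1 : 0 ≤ ν * lI := by positivity
        have h2 : 0 ≤ ν * lB := by positivity
        nlinarith

section Sum

variable {n : ℕ} {Yb : Fin n → Fin n → ℝ} {α : Fin n → ℝ} {σ : Fin n → ℝ} {τ ν C : ℝ}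
  (hdet : IsUnit (Matrix.of Yb).det) (hD : IsDiophantineWith Yb σ ν α C) (hτ0 : 0 < τ)
  (hτ1 : τ ≤ 1) (hn : 0 < n) (hν : 1 ≤ ν)

include hdet hD hτ0 hτ1 hn hν

theorem pos_of_lower_bound {N : ℕ} (hN : 1 ≤ N) {p : ℤ × (Fin n → ℤ)}
    (hpN : |p.1| ≤ N) (hp0 : p.1 ≠ 0) {δ : ℝ} (hδ : ∀ i, |torusSol Yb α p i| ≤ τ ^ σ i * δ) :
    min (barI Yb) 1 / (4 * ((1 + C) * N) ^ (ν + 1)) < δ := by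
  have hĪ := barI_pos hdet hn
  have hC := hD.const_pos
  have hN0 : (0 : ℝ) < N := by exact_mod_cast hN
  set b := min (barI Yb) 1 / (4 * ((1 + C) * N) ^ (ν + 1)) with hb
  have hb0 : 0 < b := div_pos (lt_min hĪ one_pos) (by positivity)
  by_contra! hle
  have h : p ∈ returnPairs Yb α σ τ N b := ⟨hpN, fun i => (hδ i).trans
    (mul_le_mul_of_nonneg_left hle (Real.rpow_nonneg hτ0.le _))⟩
  exact lt_irrefl _ (returnPairs_lower_bound hdet hD hτ0 hτ1 hn hν hN hb0 h hp0)

/-- The inner sum is at most affine in the number `κ p` of dyadic scales above `δ p`. Summing `κ`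
over the pairs means adding, scale by scale, the numbers of pairs below that scale, each bounded by
the Diophantine count; the lower bound on `δ` limits the number of scales. -/
theorem sum_weights_le {N : ℕ} (hN : 1 ≤ N) {I : ℝ} (hI0 : 0 < I) (hI1 : I ≤ 1 / 2) {d : ℕ}
    (hd : 1 ≤ d) (Q : Finset (ℤ × (Fin n → ℤ)))
    (hQ : ∀ p ∈ Q, p.1 ≠ 0 ∧ p ∈ returnPairs Yb α σ τ N (I / 2)) (δ : ℤ × (Fin n → ℤ) → ℝ)
    (hδ : ∀ p u, 0 ≤ u → (δ p ≤ u ↔ ∀ i, |torusSol Yb α p i| ≤ τ ^ σ i * u))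
    (hδ0 : ∀ p, 0 ≤ δ p) (J : ℕ) :
    ∑ p ∈ Q, ∑ j ∈ Finset.range J, min 1 ((2 / δ p) ^ n / 2 ^ ((j + 1) * d)) ≤
      32 * 8 ^ n * n * (ν + 1) * (max 1 (I / barI Yb) ^ n *
        (C * max ((N : ℝ) ^ (1 - 1 / ν)) (N * τ)) *
        (1 + Real.posLog I⁻¹ + Real.log (1 + C) + Real.log N)) := by
  have hĪ := barI_pos hdet hn
  have hC := hD.const_pos
  have hN1 : (1 : ℝ) ≤ N := by exact_mod_cast hN
  have hn1 : (1 : ℝ) ≤ n := by exact_mod_cast hn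
  set q : ℝ := max 1 (I / barI Yb) with hq
  have hq1 : 1 ≤ q := le_max_left _ _
  have hqn : 1 ≤ q ^ n := one_le_pow₀ hq1
  have hqqn : q ≤ q ^ n := le_self_pow₀ hq1 hn.ne'
  have hIq : (I / barI Yb) ^ n ≤ q ^ n := pow_le_pow_left₀ (by positivity) (le_max_right _ _) n
  set B : ℝ := (1 + C) * N with hB
  have hB1 : 1 ≤ B := by nlinarith
  have hlogB : Real.log B = Real.log (1 + C) + Real.log N :=
    Real.log_mul (by positivity) (by positivity)
  obtain ⟨e, he, he'⟩ := exists_pow_two_ge (x := 1 / I) (by rw [le_div_iff₀ hI0]; linarith)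
  -- `2^M ≥ B^{ν+1} q` puts the last scale `I / 2^{M+2}` below the lower bound for `δ`, because `I ≤
  -- q min(Ī, 1)`.
  obtain ⟨M, hM, hM'⟩ := exists_pow_two_ge (x := B ^ (ν + 1) * q)
    (one_le_mul_of_one_le_of_one_le (Real.one_le_rpow hB1 (by linarith)) hq1)
  have hpl : Real.log (1 / I) ≤ Real.posLog I⁻¹ := by
    rw [one_div]; exact le_max_right _ _
  -- The term `log q` is absorbed into `q^n`, so that no logarithm of the distortion remains in the
  -- result.
  have hlogM : Real.log (B ^ (ν + 1) * q) ≤ (ν + 1) * Real.log B + q ^ n := by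
    rw [Real.log_mul (by positivity) (by positivity), Real.log_rpow (by linarith)]
    have := Real.log_le_self (show 0 ≤ q by linarith)
    linarith
  set b : ℝ := min (barI Yb) 1 / (4 * B ^ (ν + 1)) with hb
  have hm0 : 0 < min (barI Yb) 1 := lt_min hĪ one_pos
  have hb0 : 0 < b := div_pos hm0 (by positivity)
  have hMb : I / 2 / 2 ^ (M + 1) ≤ b := by
    have h1 : I ≤ q * min (barI Yb) 1 := by
      rw [mul_min_of_nonneg _ _ (by linarith : 0 ≤ q), mul_one]
      refine le_min ?_ (by linarith)
      calc I = I / barI Yb * barI Yb := by field_simp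
        _ ≤ q * barI Yb := mul_le_mul_of_nonneg_right (le_max_right _ _) hĪ.le
    have h2 : B ^ (ν + 1) * I ≤ 2 ^ M * min (barI Yb) 1 := by
      calc B ^ (ν + 1) * I ≤ B ^ (ν + 1) * (q * min (barI Yb) 1) := by gcongr
        _ = B ^ (ν + 1) * q * min (barI Yb) 1 := by ring
        _ ≤ 2 ^ M * min (barI Yb) 1 := by gcongr
    rw [hb, div_div, div_le_div_iff₀ (by positivity) (by positivity), pow_succ]
    linarith
  have hlow : ∀ p ∈ Q, b < δ p := fun p hp =>
    pos_of_lower_bound hdet hD hτ0 hτ1 hn hν hN (hQ p hp).2.1 (hQ p hp).1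
      ((hδ p _ (hδ0 p)).1 le_rfl)
  set A : ℝ := 2 * 8 ^ n * (C * max ((N : ℝ) ^ (1 - 1 / ν)) (N * τ)) with hA
  have hA0 : 0 ≤ A := by
    have : 0 ≤ max ((N : ℝ) ^ (1 - 1 / ν)) (N * τ) := le_max_of_le_left (by positivity)
    positivity
  have hcount : ∀ u : ℝ, 0 < u → u ≤ 1 →
      ((Q.filter fun p => δ p ≤ u).card : ℝ) ≤ A * (1 + (u / barI Yb) ^ n) := by
    intro u hu0 hu1
    have hfin := finite_returnPairs (α := α) (σ := σ) (τ := τ) hdet N u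
    have h1 : (Q.filter fun p => δ p ≤ u).card ≤ (returnPairs Yb α σ τ N u).ncard := by
      rw [← Set.ncard_coe_finset]
      refine Set.ncard_le_ncard (fun p hp => ?_) hfin
      have hp := Finset.mem_filter.1 (Finset.mem_coe.1 hp)
      exact ⟨(hQ p hp.1).2.1, (hδ p u hu0.le).1 hp.2⟩
    refine (Nat.cast_le.2 h1).trans
      ((ncard_returnPairs_le hdet hD hτ0 hτ1 hn hν hN hu0 hu1).trans ?_)
    have h2 : max ((N : ℝ) ^ (1 - 1 / ν)) (N * τ * u) ≤ max ((N : ℝ) ^ (1 - 1 / ν)) (N * τ) :=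
      max_le_max le_rfl (mul_le_of_le_one_right (by positivity) hu1)
    calc 2 * 8 ^ n * (1 + (u / barI Yb) ^ n) * (C * max ((N : ℝ) ^ (1 - 1 / ν)) (N * τ * u))
        ≤ 2 * 8 ^ n * (1 + (u / barI Yb) ^ n) * (C * max ((N : ℝ) ^ (1 - 1 / ν)) (N * τ)) := by
          gcongr
      _ = _ := by rw [hA]; ring
  have hQcard : (Q.card : ℝ) ≤ 2 * A * q ^ n := by
    have h1 : Q.filter (fun p => δ p ≤ I / 2) = Q :=
      Finset.filter_true_of_mem fun p hp => (hδ p _ (by positivity)).2 (hQ p hp).2.2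
    have h2 := hcount (I / 2) (by positivity) (by linarith)
    rw [h1] at h2
    have h3 : (I / 2 / barI Yb) ^ n ≤ q ^ n := by
      refine (pow_le_pow_left₀ (by positivity) ?_ n).trans hIq
      gcongr; linarith
    nlinarith
  set κ : ℤ × (Fin n → ℤ) → ℕ := fun p =>
    ((Finset.Icc 1 M).filter fun k => δ p ≤ I / 2 / 2 ^ k).card with hκ
  have hterm : ∀ p ∈ Q, ∑ j ∈ Finset.range J, min 1 ((2 / δ p) ^ n / 2 ^ ((j + 1) * d))
      ≤ n * κ p + (n * (3 + e) + 1) := by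
    intro p hp
    have hδp : 0 < δ p := hb0.trans (hlow p hp)
    have h1 := two_div_le_of_card hI0 (hMb.trans (hlow p hp).le) he
    have h2 : (2 / δ p) ^ n ≤ 2 ^ (n * (κ p + 3 + e)) := by
      rw [mul_comm, pow_mul]
      exact pow_le_pow_left₀ (by positivity) h1 n
    refine (sum_min_one_le hd (by positivity) h2 J).trans_eq ?_
    push_cast; ring
  have hκsum : ∑ p ∈ Q, (κ p : ℝ) ≤ A * (M + q ^ n) := by
    -- Double counting of the pairs `(p, k)` with `δ p ≤ I / 2^{k+1}`.
    have h1 : ∑ p ∈ Q, κ p = ∑ k ∈ Finset.Icc 1 M, (Q.filter fun p => δ p ≤ I / 2 / 2 ^ k).card := by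
      simp only [hκ, Finset.card_filter]
      exact Finset.sum_comm
    have h2 : ∀ k ∈ Finset.Icc 1 M, ((Q.filter fun p => δ p ≤ I / 2 / 2 ^ k).card : ℝ)
        ≤ A * (1 + q ^ n * (1 / 2) ^ k) := by
      intro k hk
      have h2k : (1 : ℝ) ≤ 2 ^ k := one_le_pow₀ (by norm_num)
      have hu1 : I / 2 / 2 ^ k ≤ 1 := by
        rw [div_le_one (by positivity)]; linarith
      refine (hcount _ (by positivity) hu1).trans ?_
      have h3 : (I / 2 / 2 ^ k / barI Yb) ^ n ≤ q ^ n * (1 / 2) ^ k := by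
        have h4 : I / 2 / 2 ^ k / barI Yb ≤ q * (1 / 2) ^ k := by
          calc I / 2 / 2 ^ k / barI Yb = (I / barI Yb) * (1 / 2) ^ k / 2 := by
                rw [div_pow, one_pow]; field_simp
            _ ≤ (I / barI Yb) * (1 / 2) ^ k :=
                half_le_self (by positivity)
            _ ≤ q * (1 / 2) ^ k :=
                mul_le_mul_of_nonneg_right (le_max_right _ _) (by positivity)
        calc (I / 2 / 2 ^ k / barI Yb) ^ n ≤ (q * (1 / 2) ^ k) ^ n :=
              pow_le_pow_left₀ (by positivity) h4 n
          _ = q ^ n * ((1 / 2) ^ k) ^ n := mul_pow _ _ _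
          _ ≤ q ^ n * (1 / 2) ^ k := by
              refine mul_le_mul_of_nonneg_left ?_ (by positivity)
              exact pow_le_of_le_one (by positivity)
                (pow_le_one₀ (by norm_num) (by norm_num)) hn.ne'
      gcongr
    have h5 : ∑ k ∈ Finset.Icc 1 M, (1 / 2 : ℝ) ^ k ≤ 1 := by
      have h6 : ∀ M : ℕ, ∑ k ∈ Finset.Icc 1 M, (1 / 2 : ℝ) ^ k = 1 - (1 / 2) ^ M := by
        intro M
        induction M with
        | zero => simp
        | succ M ih => rw [Finset.sum_Icc_succ_top (by omega), ih, pow_succ]; ring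
      rw [h6]
      have : (0 : ℝ) ≤ (1 / 2) ^ M := by positivity
      linarith
    calc ∑ p ∈ Q, (κ p : ℝ)
        = ∑ k ∈ Finset.Icc 1 M, ((Q.filter fun p => δ p ≤ I / 2 / 2 ^ k).card : ℝ) := by
          exact_mod_cast h1
      _ ≤ ∑ k ∈ Finset.Icc 1 M, A * (1 + q ^ n * (1 / 2) ^ k) := Finset.sum_le_sum h2
      _ = A * (M + q ^ n * ∑ k ∈ Finset.Icc 1 M, (1 / 2 : ℝ) ^ k) := by
          rw [← Finset.mul_sum, Finset.sum_add_distrib, ← Finset.mul_sum]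
          simp
      _ ≤ A * (M + q ^ n) := by
          refine mul_le_mul_of_nonneg_left ?_ hA0
          nlinarith
  have hP0 : 0 ≤ Real.posLog I⁻¹ := Real.posLog_nonneg
  have hlB0 : 0 ≤ Real.log B := Real.log_nonneg hB1
  have hsum : ∑ p ∈ Q, ∑ j ∈ Finset.range J, min 1 ((2 / δ p) ^ n / 2 ^ ((j + 1) * d))
      ≤ n * (A * (M + q ^ n)) + 2 * A * q ^ n * (n * (3 + e) + 1) := by
    refine (Finset.sum_le_sum hterm).trans ?_
    rw [Finset.sum_add_distrib, ← Finset.mul_sum, Finset.sum_const, nsmul_eq_mul]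
    refine add_le_add (mul_le_mul_of_nonneg_left hκsum (by positivity)) ?_
    exact mul_le_mul_of_nonneg_right hQcard (by positivity)
  refine hsum.trans ?_
  have e2 : 1 + Real.posLog I⁻¹ + Real.log (1 + C) + Real.log N
      = 1 + Real.posLog I⁻¹ + Real.log B := by rw [hlogB]; ring
  rw [e2]
  refine (dyadic_sum_arith hn1 hν hA0 hqn hP0 hlB0 ?_ ?_).trans_eq ?_
  · linarith
  · linarith
  · rw [hA]; ring

end Sum

/-! ### Measurability on the nilmanifold -/

section MeasurableNil

variable {n : ℕ} {ℓ : Fin n → ℕ}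

theorem measurable_toNil_mk :
    Measurable fun y : ℝ × (JIdx ℓ → ℝ) => toNil ℓ ⟨y.1, y.2⟩ := by
  have h : Measurable fun y : ℝ × (JIdx ℓ → ℝ) => (⟨y.1, y.2⟩ : QAGroup ℓ) :=
    measurable_comap_iff.2 measurable_id
  exact measurable_quotient_mk''.comp h

theorem measurable_of_comp_toNil {β : Type*} [MeasurableSpace β] {f : Nil ℓ → β}
    (hf : Measurable fun y : ℝ × (JIdx ℓ → ℝ) => f (toNil ℓ ⟨y.1, y.2⟩)) : Measurable f := by
  refine measurable_from_quotient.2 ?_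
  exact hf.comp (comap_measurable fun g : QAGroup ℓ => (g.t, g.v))

theorem lintegral_nilMeasure {f : Nil ℓ → ENNReal} (hf : Measurable f) :
    ∫⁻ x, f x ∂(nilMeasure ℓ) = ∫⁻ t in Set.Ico (0 : ℝ) 1,
      ∫⁻ v in Set.univ.pi fun _ => Set.Ico (0 : ℝ) 1, f (toNil ℓ ⟨t, v⟩) := by
  rw [nilMeasure, lintegral_map hf measurable_toNil_mk, Measure.volume_eq_prod,
    ← Measure.prod_restrict]
  exact lintegral_prod (fun y : ℝ × (JIdx ℓ → ℝ) => f (toNil ℓ ⟨y.1, y.2⟩))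
    (hf.comp measurable_toNil_mk).aemeasurable

instance isProbabilityMeasure_nilMeasure : IsProbabilityMeasure (nilMeasure ℓ) := by
  refine ⟨?_⟩
  rw [nilMeasure, Measure.map_apply measurable_toNil_mk MeasurableSet.univ, Set.preimage_univ,
    Measure.restrict_apply MeasurableSet.univ, Set.univ_inter, Measure.volume_eq_prod,
    Measure.prod_prod, Real.volume_Ico, volume_pi_pi]
  simp

end MeasurableNil

/-! ### The displacement of the return map, its uniqueness and its measurability. -/

section Dist

variable {n : ℕ} {ℓ : Fin n → ℕ} {Y : JIdx ℓ → QALie ℓ}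

theorem IY_nonneg : 0 ≤ IY Y := Real.sSup_nonneg fun _ h => h.1.1.le

theorem IY_le_half : IY Y ≤ 1 / 2 := Real.sSup_le (fun _ h => h.1.2.le) (by norm_num)

/-- If `I > 0`, some admissible radius exceeds `I/2`. If the set of radii is empty, `I = 0` and the
box is a point. -/
theorem injOn_phiY (x : Nil ℓ) : Set.InjOn (phiY Y x) {s | ∀ q, |s q| ≤ IY Y / 2} := by
  rcases (IY_nonneg (Y := Y)).eq_or_lt with h0 | hpos
  · intro s hs s' hs' _
    rw [← h0, zero_div] at hs hs'
    funext q
    rw [abs_nonpos_iff.1 (hs q), abs_nonpos_iff.1 (hs' q)]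
  · have hne : {I' : ℝ | I' ∈ Set.Ioo (0 : ℝ) (1 / 2) ∧
        ∀ x : Nil ℓ, Set.InjOn (phiY Y x) {s | ∀ p, |s p| < I'}}.Nonempty := by
      by_contra h
      rw [Set.not_nonempty_iff_eq_empty] at h
      rw [IY, h, Real.sSup_empty] at hpos
      exact lt_irrefl _ hpos
    obtain ⟨I', hI', hlt⟩ := exists_lt_of_lt_csSup hne (half_lt_self hpos)
    exact (hI'.2 x).mono fun s hs q => (hs q).trans_lt hlt

theorem dist1_eq {x x' : Nil ℓ} {s : JIdx ℓ → ℝ} (hs : ∀ q, |s q| ≤ IY Y / 2)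
    (hx : x' = phiY Y x s) (p : JIdx ℓ) : dist1 Y x x' p = |s p| := by
  have hex : ∃ s : JIdx ℓ → ℝ, (∀ q, |s q| ≤ IY Y / 2) ∧ x' = phiY Y x s := ⟨s, hs, hx⟩
  unfold dist1
  rw [dif_pos hex]
  have h := hex.choose_spec
  rw [injOn_phiY x h.1 hs (h.2.symm.trans hx)]

theorem exists_of_dist1_lt {x x' : Nil ℓ} {p : JIdx ℓ} (h : dist1 Y x x' p < IY Y) :
    ∃ s : JIdx ℓ → ℝ, (∀ q, |s q| ≤ IY Y / 2) ∧ x' = phiY Y x s := by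
  by_contra hex
  rw [dist1, dif_neg hex] at h
  exact lt_irrefl _ h

theorem dist1_nonneg (x x' : Nil ℓ) (p : JIdx ℓ) : 0 ≤ dist1 Y x x' p := by
  unfold dist1
  split_ifs
  · exact abs_nonneg _
  · exact IY_nonneg

theorem sum_smul_eq_vecMul (s : JIdx ℓ → ℝ) : ∑ p, s p • (Y p).2 = Matrix.vecMul s (Ymat Y) := by
  funext q
  rw [Finset.sum_apply]
  rfl

end Dist

section ReturnSol

variable {n : ℕ} {ℓ : Fin n → ℕ} {α : JIdx ℓ → ℝ} {Y : JIdx ℓ → QALie ℓ}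

/-- The solution `s` of `h(t) (∑ s_p Y_p) = D - z`, for the return vector `D` of `Γ(t, v)`. -/
noncomputable def returnSol (α : JIdx ℓ → ℝ) (Y : JIdx ℓ → QALie ℓ) (r : ℤ) (z : JIdx ℓ → ℤ)
    (y : ℝ × (JIdx ℓ → ℝ)) : JIdx ℓ → ℝ :=
  Matrix.vecMul (hAct ℓ (-y.1) (returnDiff α r y.1 y.2 - fun p => (z p : ℝ))) (Ymat Y)⁻¹

theorem continuous_returnSol (r : ℤ) (z : JIdx ℓ → ℤ) : Continuous (returnSol α Y r z) := by
  have h1 : Continuous fun y : ℝ × (JIdx ℓ → ℝ) =>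
      returnDiff α r y.1 y.2 - fun p => ((z p : ℤ) : ℝ) :=
    (continuous_returnDiff α r).sub continuous_const
  have h2 : Continuous fun y : ℝ × (JIdx ℓ → ℝ) => -y.1 := continuous_fst.neg
  exact (continuous_hAct h2 h1).matrix_vecMul continuous_const

variable [∀ m, NeZero (ℓ m)]

variable (hY : IsNormalisedStronglyAdapted (Xvec α) Y)

include hY

theorem phiY_eq_act (x : Nil ℓ) (s : JIdx ℓ → ℝ) :
    phiY Y x s = act x (gexp (ofIdeal (∑ p, s p • (Y p).2))) := by
  unfold phiY
  congr 2
  let F : QALie ℓ →ₗ[ℝ] ℝ := LinearMap.fst ℝ ℝ (JIdx ℓ → ℝ)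
  let S : QALie ℓ →ₗ[ℝ] (JIdx ℓ → ℝ) := LinearMap.snd ℝ ℝ (JIdx ℓ → ℝ)
  refine Prod.ext ?_ ?_
  · change F (∑ p, s p • Y p) = 0
    rw [map_sum]
    refine Finset.sum_eq_zero fun p _ => ?_
    rw [map_smul]
    change s p * (Y p).1 = 0
    rw [hY.mem_ideal, mul_zero]
  · change S (∑ p, s p • Y p) = ∑ p, s p • (Y p).2
    rw [map_sum]
    exact Finset.sum_congr rfl fun p _ => map_smul S _ _

theorem returnMap_eq_phiY_iff (r : ℤ) (t : ℝ) (v s : JIdx ℓ → ℝ) :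
    returnMap α r (toNil ℓ ⟨t, v⟩) = phiY Y (toNil ℓ ⟨t, v⟩) s ↔
      ∃ z : JIdx ℓ → ℤ,
        returnDiff α r t v - hAct ℓ t (∑ p, s p • (Y p).2) = fun p => (z p : ℝ) := by
  rw [phiY_eq_act hY, returnMap_eq_act_iff]

theorem eq_returnSol_iff (r : ℤ) (z : JIdx ℓ → ℤ) (t : ℝ) (v s : JIdx ℓ → ℝ) :
    (returnDiff α r t v - hAct ℓ t (∑ p, s p • (Y p).2) = fun p => (z p : ℝ)) ↔
      s = returnSol α Y r z (t, v) := by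
  rw [sum_smul_eq_vecMul, returnSol]
  have hdet := isUnit_det_Ymat hY
  constructor
  · intro h
    rw [← h, sub_sub_cancel, hAct_neg_hAct, Matrix.vecMul_vecMul, Matrix.mul_nonsing_inv _ hdet,
      Matrix.vecMul_one]
  · intro h
    rw [h, Matrix.vecMul_vecMul, Matrix.nonsing_inv_mul _ hdet, Matrix.vecMul_one, hAct_hAct_neg,
      sub_sub_cancel]

-- This exhibits the displacement as a countable infimum of measurable functions. All solutions in
-- the box coincide by injectivity, and their components are at most `I/2`, so the default value `I`
-- of the other `z` does not disturb the infimum.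
open Classical in
theorem dist1_returnMap (r : ℤ) (y : ℝ × (JIdx ℓ → ℝ)) (p : JIdx ℓ) :
    dist1 Y (toNil ℓ ⟨y.1, y.2⟩) (returnMap α r (toNil ℓ ⟨y.1, y.2⟩)) p
      = ⨅ z : JIdx ℓ → ℤ, if ∀ q, |returnSol α Y r z y q| ≤ IY Y / 2
        then |returnSol α Y r z y p| else IY Y := by
  have hsol : ∀ z, returnMap α r (toNil ℓ ⟨y.1, y.2⟩)
      = phiY Y (toNil ℓ ⟨y.1, y.2⟩) (returnSol α Y r z y) := fun z =>
    (returnMap_eq_phiY_iff hY r y.1 y.2 _).2 ⟨z, (eq_returnSol_iff hY r z y.1 y.2 _).2 rfl⟩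
  by_cases hex : ∃ z, ∀ q, |returnSol α Y r z y q| ≤ IY Y / 2
  · obtain ⟨z₀, hz₀⟩ := hex
    rw [dist1_eq hz₀ (hsol z₀)]
    refine le_antisymm (le_ciInf fun z => ?_) ?_
    · split_ifs with h
      · rw [injOn_phiY _ hz₀ h ((hsol z₀).symm.trans (hsol z))]
      · exact (hz₀ p).trans (half_le_self IY_nonneg)
    · refine (ciInf_le ⟨0, ?_⟩ z₀).trans_eq (if_pos hz₀)
      rintro _ ⟨z, rfl⟩
      dsimp only
      split_ifs
      · exact abs_nonneg _
      · exact IY_nonneg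
  · have hz : ∀ z, ¬ ∀ q, |returnSol α Y r z y q| ≤ IY Y / 2 := fun z h => hex ⟨z, h⟩
    simp only [hz, if_false, ciInf_const]
    unfold dist1
    rw [dif_neg]
    rintro ⟨s, hs, hx⟩
    obtain ⟨z, h⟩ := (returnMap_eq_phiY_iff hY r y.1 y.2 s).1 hx
    rw [eq_returnSol_iff hY] at h
    exact hz z (h ▸ hs)

theorem measurable_dist1_returnMap (r : ℤ) (p : JIdx ℓ) :
    Measurable fun x => dist1 Y x (returnMap α r x) p := by
  classical
  refine measurable_of_comp_toNil ?_
  simp only [dist1_returnMap hY]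
  refine Measurable.iInf fun z => ?_
  have hc : ∀ q, Continuous fun y => |returnSol α Y r z y q| := fun q =>
    ((continuous_apply q).comp (continuous_returnSol r z)).abs
  refine Measurable.ite ?_ (hc p).measurable measurable_const
  have : {y : ℝ × (JIdx ℓ → ℝ) | ∀ q, |returnSol α Y r z y q| ≤ IY Y / 2}
      = ⋂ q, {y | |returnSol α Y r z y q| ≤ IY Y / 2} := by
    ext y; simp
  rw [this]
  exact MeasurableSet.iInter fun q => measurableSet_le (hc q).measurable measurable_const

variable (ρ : JIdx ℓ → ℝ) (r : ℤ) (L : ℝ)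

theorem measurable_deltaOne : Measurable (deltaOne α Y ρ r L) := by
  unfold deltaOne
  exact Measurable.iSup fun m =>
    measurable_const.min ((measurable_dist1_returnMap hY r _).const_mul _)

theorem measurable_deltaOther : Measurable (deltaOther α Y ρ r L) := by
  unfold deltaOther
  exact Measurable.iSup fun m =>
    measurable_const.min ((measurable_dist1_returnMap hY r _).const_mul _)

theorem measurableSet_APset (j : ℕ) : MeasurableSet (APset α Y ρ r j L) :=
  (measurableSet_le (measurable_deltaOne hY ρ r L) measurable_const).inter
    (measurable_deltaOther hY ρ r L measurableSet_Ioc)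

/-- The `j`-th term of `hFun`. -/
noncomputable def hTerm (α : JIdx ℓ → ℝ) (Y : JIdx ℓ → QALie ℓ) (ρ : JIdx ℓ → ℝ) (r : ℤ) (L : ℝ)
    (j : ℕ) : Nil ℓ → ℝ :=
  Set.indicator (APset α Y ρ r (j + 1) L)
    (fun y => min ((2 : ℝ) ^ ((j + 1) * (∑ m, ℓ m - n))) ((2 / deltaOne α Y ρ r L y) ^ n))

theorem measurable_hTerm (j : ℕ) : Measurable (hTerm α Y ρ r L j) :=
  (measurable_const.min (((measurable_deltaOne hY ρ r L).const_div 2).pow_const n)).indicator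
    (measurableSet_APset hY ρ r L _)

omit hY

theorem deltaOne_nonneg (x : Nil ℓ) (hL : 0 ≤ L) : 0 ≤ deltaOne α Y ρ r L x :=
  Real.iSup_nonneg fun _ => le_min IY_nonneg
    (mul_nonneg (Real.rpow_nonneg hL _) (dist1_nonneg _ _ _))

theorem hTerm_nonneg (hL : 0 ≤ L) (j : ℕ) (x : Nil ℓ) : 0 ≤ hTerm α Y ρ r L j x := by
  refine Set.indicator_nonneg (fun y _ => ?_) x
  have := deltaOne_nonneg (α := α) (Y := Y) ρ r L y hL
  positivity

/-- Valid without summability: a divergent real sum and `toReal` of an infinite one are both `0`.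
The extended sum thus dominates `h` and can be integrated term by term. -/
theorem hFun_eq_toReal (hL : 0 ≤ L) (x : Nil ℓ) :
    hFun α Y ρ r L x = (∑' j, ENNReal.ofReal (hTerm α Y ρ r L j x)).toReal := by
  rw [ENNReal.tsum_toReal_eq fun _ => ENNReal.ofReal_ne_top]
  exact tsum_congr fun j => (ENNReal.toReal_ofReal (hTerm_nonneg ρ r L hL j x)).symm

theorem hFun_nonneg (hL : 0 ≤ L) (x : Nil ℓ) : 0 ≤ hFun α Y ρ r L x := by
  rw [hFun_eq_toReal ρ r L hL]
  exact ENNReal.toReal_nonneg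

theorem ofReal_hFun_le (hL : 0 ≤ L) (x : Nil ℓ) :
    ENNReal.ofReal (hFun α Y ρ r L x) ≤ ∑' j, ENNReal.ofReal (hTerm α Y ρ r L j x) := by
  rw [hFun_eq_toReal ρ r L hL]
  exact ENNReal.ofReal_toReal_le

include hY

theorem measurable_hFun (hL : 0 ≤ L) : Measurable (hFun α Y ρ r L) := by
  rw [funext (hFun_eq_toReal ρ r L hL)]
  exact (Measurable.tsum fun j => (measurable_hTerm hY ρ r L j).ennreal_ofReal).ennreal_toReal

end ReturnSol

/-! ### Rescaling by `L` and the integral of a single term. -/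

section Scale

variable {n : ℕ} {ℓ : Fin n → ℕ} [∀ m, NeZero (ℓ m)]

theorem card_JDer : Fintype.card (JDer ℓ) = ∑ m, ℓ m - n := by
  rw [Fintype.card_subtype_compl, ← Fintype.card_congr (generatorEquiv ℓ), Fintype.card_sigma]
  simp

theorem sum_eq_rhoBar_add (ρ : JIdx ℓ → ℝ) : ∑ p, ρ p = rhoBar ρ + ∑ q : JDer ℓ, ρ q.1 := by
  rw [← Fintype.sum_subtype_add_sum_subtype (fun p : JIdx ℓ => p.2 = 0)]
  congr 1
  exact (Fintype.sum_equiv (generatorEquiv ℓ) (fun m => ρ ⟨m, 0⟩) _ fun _ => rfl).symm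

/-- The rescaled size `max_i L^{ρ_i} |s_i|` of the solution `s` of `∑ s_i Ȳ_i = r α - z`. -/
noncomputable def pairDelta (α : JIdx ℓ → ℝ) (Y : JIdx ℓ → QALie ℓ) (ρ : JIdx ℓ → ℝ) (L : ℝ)
    (p : ℤ × (Fin n → ℤ)) : ℝ :=
  ⨆ m : Fin n, L ^ ρ ⟨m, 0⟩ * |torusSol (Ybar Y) (fun m => α ⟨m, 0⟩) p m|

variable {α : JIdx ℓ → ℝ} {Y : JIdx ℓ → QALie ℓ} {ρ : JIdx ℓ → ℝ} {L : ℝ}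

theorem pairDelta_nonneg (hL : 1 ≤ L) (p : ℤ × (Fin n → ℤ)) : 0 ≤ pairDelta α Y ρ L p :=
  Real.iSup_nonneg fun _ => by positivity

/-- With `τ = L^{-|ρ̄|}` and `σ_i = ρ_i / |ρ̄|` one has `τ^{σ_i} = L^{-ρ_i}`, so sublevel sets of
`pairDelta` are the boxes of `returnPairs`. -/
theorem pairDelta_le_iff (hL : 1 ≤ L) (hρ : rhoBar ρ ≠ 0) (p : ℤ × (Fin n → ℤ)) (u : ℝ)
    (hu : 0 ≤ u) : pairDelta α Y ρ L p ≤ u ↔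
      ∀ i, |torusSol (Ybar Y) (fun m => α ⟨m, 0⟩) p i|
        ≤ (L ^ (-rhoBar ρ)) ^ (ρ ⟨i, 0⟩ / rhoBar ρ) * u := by
  have hL0 : 0 < L := by linarith
  have h1 : pairDelta α Y ρ L p ≤ u ↔
      ∀ m, L ^ ρ ⟨m, 0⟩ * |torusSol (Ybar Y) (fun m => α ⟨m, 0⟩) p m| ≤ u :=
    ⟨fun h m => (le_ciSup (Set.finite_range fun m : Fin n =>
      L ^ ρ ⟨m, 0⟩ * |torusSol (Ybar Y) (fun m => α ⟨m, 0⟩) p m|).bddAbove m).trans h,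
      fun h => Real.iSup_le h hu⟩
  rw [h1]
  refine forall_congr' fun i => ?_
  have h2 : (L ^ (-rhoBar ρ)) ^ (ρ ⟨i, 0⟩ / rhoBar ρ) = (L ^ ρ ⟨i, 0⟩)⁻¹ := by
    rw [← Real.rpow_mul hL0.le, ← Real.rpow_neg hL0.le]
    congr 1
    field_simp
  have h3 : 0 < L ^ ρ ⟨i, 0⟩ := Real.rpow_pos_of_pos hL0 _
  rw [h2, inv_mul_eq_div, le_div_iff₀ h3, mul_comm]

variable (hY : IsNormalisedStronglyAdapted (Xvec α) Y)

include hY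

theorem vecMul_Ybar_eq {r : ℤ} {t : ℝ} {v s : JIdx ℓ → ℝ} {z : JIdx ℓ → ℤ}
    (h : returnDiff α r t v - hAct ℓ t (∑ p, s p • (Y p).2) = fun p => (z p : ℝ)) (m : Fin n) :
    Matrix.vecMul (fun i => s ⟨i, 0⟩) (Matrix.of (Ybar Y)) m = r * α ⟨m, 0⟩ - z ⟨m, 0⟩ := by
  have h1 := congrFun h ⟨m, 0⟩
  have h0 : (((⟨m, 0⟩ : JIdx ℓ).2 : Fin (ℓ m)) : ℕ) = 0 := Fin.val_zero _
  rw [Pi.sub_apply, returnDiff_of_eq_zero _ _ _ _ _ h0, hAct_apply_of_eq_zero _ _ _ h0,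
    Finset.sum_apply, Fintype.sum_sigma] at h1
  have h2 : ∀ i : Fin n, ∑ k : Fin (ℓ i), (s ⟨i, k⟩ • (Y ⟨i, k⟩).2) ⟨m, 0⟩
      = s ⟨i, 0⟩ * Ybar Y i m := by
    intro i
    rw [Finset.sum_eq_single 0]
    · rfl
    · intro k _ hk
      rw [Pi.smul_apply, Y_derived_coord hY ⟨i, k⟩ ⟨m, 0⟩ hk rfl, smul_zero]
    · intro h
      exact absurd (Finset.mem_univ _) h
  rw [Finset.sum_congr rfl fun i _ => h2 i] at h1
  change ∑ i, s ⟨i, 0⟩ * Ybar Y i m = _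
  linarith

/-- The almost periodic points belong to the return sets of finitely many pairs `(r, z)`. -/
theorem exists_pair_of_mem_APset (hn : 0 < n) (hL : 1 ≤ L) (hρ : ∀ p, 0 ≤ ρ p) {r : ℤ} {j : ℕ}
    {t : ℝ} {v : JIdx ℓ → ℝ} (hx : toNil ℓ ⟨t, v⟩ ∈ APset α Y ρ r (j + 1) L) :
    ∃ p : ℤ × (Fin n → ℤ), p.1 = r ∧ pairDelta α Y ρ L p = deltaOne α Y ρ r L (toNil ℓ ⟨t, v⟩) ∧
      pairDelta α Y ρ L p ≤ IY Y / 2 ∧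
      v ∈ returnSet α Y r t (fun q => torusSol (Ybar Y) (fun m => α ⟨m, 0⟩) p q.1)
        (fun q => L ^ (-ρ q.1) * (IY Y / 2 ^ (j + 1))) := by
  have hL0 : 0 < L := by linarith
  obtain ⟨h1, h2, h3⟩ := hx
  -- For `I = 0` the half-open interval defining the almost periodic set is empty.
  have hI : 0 < IY Y := by
    by_contra h
    have h0 : IY Y = 0 := le_antisymm (not_lt.1 h) IY_nonneg
    rw [h0, zero_div] at h2
    rw [h0, zero_div] at h3
    linarith
  set x := toNil ℓ ⟨t, v⟩ with hxdef
  have hLρ : ∀ p, 1 ≤ L ^ ρ p := fun p => Real.one_le_rpow hL (hρ p)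
  have hmin : ∀ m : Fin n, L ^ ρ ⟨m, 0⟩ * dist1 Y x (returnMap α r x) ⟨m, 0⟩ ≤ IY Y / 2 := by
    intro m
    have h4 : min (IY Y) (L ^ ρ ⟨m, 0⟩ * dist1 Y x (returnMap α r x) ⟨m, 0⟩) ≤ IY Y / 2 :=
      (le_ciSup (Set.finite_range fun m : Fin n =>
        min (IY Y) (L ^ ρ ⟨m, 0⟩ * dist1 Y x (returnMap α r x) ⟨m, 0⟩)).bddAbove m).trans h1
    rcases min_le_iff.1 h4 with h | h
    · linarith
    · exact h
  -- A single generator displacement below `I` excludes the default value, so the return is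
  -- represented by some `s` in the box and all components are genuine. Here `n > 0` and `L^ρ ≥ 1`
  -- are used.
  have hlt : dist1 Y x (returnMap α r x) ⟨⟨0, hn⟩, 0⟩ < IY Y := by
    have h5 := hmin ⟨0, hn⟩
    have h6 := le_mul_of_one_le_left (dist1_nonneg (Y := Y) x (returnMap α r x) ⟨⟨0, hn⟩, 0⟩)
      (hLρ ⟨⟨0, hn⟩, 0⟩)
    linarith
  obtain ⟨s, hs, hxs⟩ := exists_of_dist1_lt hlt
  have hd : ∀ p, dist1 Y x (returnMap α r x) p = |s p| := dist1_eq hs hxs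
  obtain ⟨z, hz⟩ := (returnMap_eq_phiY_iff hY r t v s).1 hxs
  have hsol : torusSol (Ybar Y) (fun m => α ⟨m, 0⟩) (r, fun m => z ⟨m, 0⟩)
      = fun i => s ⟨i, 0⟩ :=
    torusSol_eq _ _ (isUnit_det_Ybar hY) (vecMul_Ybar_eq hY hz)
  have hδ : pairDelta α Y ρ L (r, fun m => z ⟨m, 0⟩) = deltaOne α Y ρ r L x := by
    unfold pairDelta deltaOne
    rw [hsol]
    refine iSup_congr fun m => ?_
    have h5 := hmin m
    rw [hd] at h5 ⊢
    rw [min_eq_right (by linarith)]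
  refine ⟨(r, fun m => z ⟨m, 0⟩), rfl, hδ, hδ.trans_le h1, s, ?_, ?_, z, hz⟩
  · rintro ⟨m, i⟩ hi
    have hi : i = 0 := hi
    subst hi
    rw [hsol]
  · intro q
    have h4 : min (IY Y) (L ^ ρ q.1 * dist1 Y x (returnMap α r x) q.1) ≤ IY Y / 2 ^ (j + 1) :=
      (le_ciSup (Set.finite_range fun p : JDer ℓ =>
        min (IY Y) (L ^ ρ p.1 * dist1 Y x (returnMap α r x) p.1)).bddAbove q).trans h3
    have h5 : IY Y / 2 ^ (j + 1) < IY Y :=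
      div_lt_self hI (one_lt_pow₀ (by norm_num) (Nat.succ_ne_zero j))
    rw [hd] at h4
    rcases min_le_iff.1 h4 with h | h
    · linarith
    · have h6 : 0 < L ^ ρ q.1 := Real.rpow_pos_of_pos hL0 _
      change |s q.1| ≤ L ^ (-ρ q.1) * (IY Y / 2 ^ (j + 1))
      rw [Real.rpow_neg hL0.le, inv_mul_eq_div, le_div_iff₀ h6, mul_comm]
      exact h

/-- The volume of the unit scale return sets, in terms of `|det Ȳ|⁻¹`. -/
noncomputable def returnVolume (Y : JIdx ℓ → QALie ℓ) (ρ : JIdx ℓ → ℝ) (L : ℝ) : ℝ :=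
  |(Matrix.of (Ybar Y)).det|⁻¹ * 2 ^ (∑ m, ℓ m - n) * IY Y ^ (∑ m, ℓ m - n)
    * L ^ (-∑ q : JDer ℓ, ρ q.1)

omit hY in
theorem returnVolume_nonneg (hL : 1 ≤ L) : 0 ≤ returnVolume Y ρ L := by
  have : 0 ≤ IY Y := IY_nonneg
  unfold returnVolume
  positivity

omit hY in
-- The cap `2^{(j+1)d}` cancels the decay of the volume of the `j`-th box, leaving a factor at most
-- `1` that is summable in `j`.
theorem weight_mul_volume (hL : 1 ≤ L) (j : ℕ) (W : ℝ) :
    min ((2 : ℝ) ^ ((j + 1) * (∑ m, ℓ m - n))) W * (|(Matrix.of (Ybar Y)).det|⁻¹ *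
      ∏ q : JDer ℓ, (2 * (L ^ (-ρ q.1) * (IY Y / 2 ^ (j + 1)))))
      = returnVolume Y ρ L * min 1 (W / 2 ^ ((j + 1) * (∑ m, ℓ m - n))) := by
  have hL0 : 0 < L := by linarith
  set d := ∑ m, ℓ m - n with hd
  have h1 : ∏ q : JDer ℓ, (2 * (L ^ (-ρ q.1) * (IY Y / 2 ^ (j + 1))))
      = 2 ^ d * L ^ (-∑ q : JDer ℓ, ρ q.1) * (IY Y ^ d / 2 ^ ((j + 1) * d)) := by
    rw [Finset.prod_mul_distrib, Finset.prod_mul_distrib, Finset.prod_const, Finset.prod_const,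
      Finset.card_univ, card_JDer, ← Real.rpow_sum_of_pos hL0, Finset.sum_neg_distrib, div_pow,
      ← pow_mul, mul_assoc]
  have h2 : min ((2 : ℝ) ^ ((j + 1) * d)) W
      = 2 ^ ((j + 1) * d) * min 1 (W / 2 ^ ((j + 1) * d)) := by
    rw [mul_min_of_nonneg _ _ (by positivity), mul_one, mul_div_cancel₀ _ (by positivity)]
  rw [h1, h2, returnVolume, ← hd]
  field_simp

/-- On each toral fibre the term is dominated by a sum over pairs: a constant weight on a return set
of controlled volume. The fibre bound is independent of `t`, so integration over `t ∈ [0, 1)` costs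
nothing. -/
theorem lintegral_hTerm_le (hn : 0 < n) (hL : 1 ≤ L) (hρ : ∀ p, 0 ≤ ρ p) {r : ℤ} (hr : r ≠ 0)
    (j : ℕ) (Q : Finset (ℤ × (Fin n → ℤ)))
    (hQ : ∀ p, p.1 = r → pairDelta α Y ρ L p ≤ IY Y / 2 → p ∈ Q) :
    ∫⁻ x, ENNReal.ofReal (hTerm α Y ρ r L j x) ∂(nilMeasure ℓ) ≤
      ∑ p ∈ Q, ENNReal.ofReal (returnVolume Y ρ L *
        min 1 ((2 / pairDelta α Y ρ L p) ^ n / 2 ^ ((j + 1) * (∑ m, ℓ m - n)))) := by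
  have hL0 : 0 < L := by linarith
  have hI0 : 0 ≤ IY Y := IY_nonneg
  rw [lintegral_nilMeasure (measurable_hTerm hY ρ r L j).ennreal_ofReal]
  set F : Set (JIdx ℓ → ℝ) := Set.univ.pi fun _ => Set.Ico (0 : ℝ) 1 with hF
  have hFm : MeasurableSet F := MeasurableSet.univ_pi fun _ => measurableSet_Ico
  set w : ℤ × (Fin n → ℤ) → ℝ := fun p =>
    min ((2 : ℝ) ^ ((j + 1) * (∑ m, ℓ m - n))) ((2 / pairDelta α Y ρ L p) ^ n) with hw
  have hw0 : ∀ p, 0 ≤ w p := fun p => by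
    have := pairDelta_nonneg (α := α) (Y := Y) (ρ := ρ) hL p
    positivity
  set ε : JDer ℓ → ℝ := fun q => L ^ (-ρ q.1) * (IY Y / 2 ^ (j + 1)) with hε
  -- Measurable hulls have the same measure as the return sets, whose measurability is then not
  -- needed.
  let S : ℝ → ℤ × (Fin n → ℤ) → Set (JIdx ℓ → ℝ) := fun t p => toMeasurable (volume.restrict F)
    (returnSet α Y r t (fun q => torusSol (Ybar Y) (fun m => α ⟨m, 0⟩) p q.1) ε)
  have hpt : ∀ t v, ENNReal.ofReal (hTerm α Y ρ r L j (toNil ℓ ⟨t, v⟩))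
      ≤ ∑ p ∈ Q, (S t p).indicator (fun _ => ENNReal.ofReal (w p)) v := by
    intro t v
    by_cases hx : toNil ℓ ⟨t, v⟩ ∈ APset α Y ρ r (j + 1) L
    · obtain ⟨p, hp1, hp2, hp3, hp4⟩ := exists_pair_of_mem_APset hY hn hL hρ hx
      have h1 : hTerm α Y ρ r L j (toNil ℓ ⟨t, v⟩) = w p := by
        rw [hTerm, Set.indicator_of_mem hx, hw]
        simp only [hp2]
      have h2 : (S t p).indicator (fun _ => ENNReal.ofReal (w p)) v = ENNReal.ofReal (w p) :=
        Set.indicator_of_mem (subset_toMeasurable _ _ hp4) _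
      rw [h1, ← h2]
      exact Finset.single_le_sum
        (f := fun p => (S t p).indicator (fun _ => ENNReal.ofReal (w p)) v)
        (fun _ _ => zero_le) (hQ p hp1 hp3)
    · rw [hTerm, Set.indicator_of_notMem hx, ENNReal.ofReal_zero]
      exact zero_le
  have hfib : ∀ t, ∫⁻ v in F, ENNReal.ofReal (hTerm α Y ρ r L j (toNil ℓ ⟨t, v⟩))
      ≤ ∑ p ∈ Q, ENNReal.ofReal (returnVolume Y ρ L *
        min 1 ((2 / pairDelta α Y ρ L p) ^ n / 2 ^ ((j + 1) * (∑ m, ℓ m - n)))) := by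
    intro t
    refine (lintegral_mono (hpt t)).trans ?_
    rw [lintegral_finsetSum _ fun p _ => measurable_const.indicator (measurableSet_toMeasurable _ _)]
    refine Finset.sum_le_sum fun p _ => ?_
    rw [lintegral_indicator_const (measurableSet_toMeasurable _ _), measure_toMeasurable,
      Measure.restrict_apply' hFm]
    refine (mul_le_mul_right (volume_returnSet_le hY hr t _ fun q => by positivity) _).trans_eq ?_
    rw [← ENNReal.ofReal_mul (hw0 p), weight_mul_volume hL]
  refine (lintegral_mono hfib).trans_eq ?_
  simp

end Scale

/-! ### Summation over all returns and the main estimate. -/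

section Final

variable {n : ℕ} {ℓ : Fin n → ℕ} [∀ m, NeZero (ℓ m)]
variable {α : JIdx ℓ → ℝ} {Y : JIdx ℓ → QALie ℓ} {ρ : JIdx ℓ → ℝ} {T L : ℝ}

/-- The condition `ν ≤ 1/R` means `R ≤ 1/ν`, so the non-equidistributed term `N^{1-1/ν}` is no worse
than the expected `N L^{-R}` as far as the power of `L` is concerned. -/
theorem max_rpow_le {N ν R : ℝ} (hν : 1 ≤ ν) (hR0 : 0 < R) (hR : ν ≤ 1 / R) (hT : 0 < T)
    (hL : 1 ≤ L) (hN0 : 0 ≤ N) (hN : N ≤ T * L) :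
    max (N ^ (1 - 1 / ν)) (N * L ^ (-R)) ≤ (1 + T) * L ^ (1 - R) := by
  have hL0 : 0 < L := by linarith
  have hν0 : 0 < ν := by linarith
  have hRν : R ≤ 1 / ν := by
    rw [le_div_iff₀ hR0] at hR
    rw [le_div_iff₀ hν0]
    linarith
  have he0 : 0 ≤ 1 - 1 / ν := by
    rw [sub_nonneg, div_le_one hν0]; exact hν
  have he1 : 1 - 1 / ν ≤ 1 := by
    have : 0 ≤ 1 / ν := by positivity
    linarith
  refine max_le ?_ ?_
  · calc N ^ (1 - 1 / ν) ≤ (T * L) ^ (1 - 1 / ν) := Real.rpow_le_rpow hN0 hN he0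
      _ = T ^ (1 - 1 / ν) * L ^ (1 - 1 / ν) := Real.mul_rpow hT.le hL0.le
      _ ≤ (1 + T) * L ^ (1 - R) := by
          refine mul_le_mul ?_ (Real.rpow_le_rpow_of_exponent_le hL (by linarith)) (by positivity)
            (by positivity)
          calc T ^ (1 - 1 / ν) ≤ (1 + T) ^ (1 - 1 / ν) :=
                Real.rpow_le_rpow hT.le (by linarith) he0
            _ ≤ (1 + T) ^ (1 : ℝ) := Real.rpow_le_rpow_of_exponent_le (by linarith) he1
            _ = 1 + T := Real.rpow_one _
  · calc N * L ^ (-R) ≤ T * L * L ^ (-R) := by gcongr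
      _ = T * L ^ (1 - R) := by
          rw [sub_eq_add_neg, Real.rpow_add hL0, Real.rpow_one]; ring
      _ ≤ (1 + T) * L ^ (1 - R) := by gcongr; linarith

variable (hY : IsNormalisedStronglyAdapted (Xvec α) Y)

include hY

theorem sum_pairs_le (hn : 0 < n) (hd : 1 ≤ ∑ m, ℓ m - n) {ν : ℝ} (hν : 1 ≤ ν)
    (hρ0 : 0 < rhoBar ρ) (hνρ : ν ≤ 1 / rhoBar ρ) {C : ℝ}
    (hD : IsDiophantineWith (Ybar Y) (fun m => ρ ⟨m, 0⟩ / rhoBar ρ) ν (fun m => α ⟨m, 0⟩) C)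
    (hT : 0 < T) (hL : 1 ≤ L) {N : ℕ} (hN : (N : ℝ) ≤ T * L) (Q : Finset (ℤ × (Fin n → ℤ)))
    (hQ : ∀ p ∈ Q, p.1 ≠ 0 ∧ |p.1| ≤ N ∧ pairDelta α Y ρ L p ≤ IY Y / 2) (J : ℕ) :
    ∑ j ∈ Finset.range J, ∑ p ∈ Q, returnVolume Y ρ L *
        min 1 ((2 / pairDelta α Y ρ L p) ^ n / 2 ^ ((j + 1) * (∑ m, ℓ m - n)))
      ≤ 32 * 8 ^ n * n * (ν + 1) * 2 ^ (∑ m, ℓ m - n) * (distortion Y * HConst Y C * (1 + T)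
        * (1 + Real.posLog T + Real.log L) * L ^ (1 - ∑ p, ρ p)) := by
  have hL0 : 0 < L := by linarith
  have hC := hD.const_pos
  have hI0 : 0 ≤ IY Y := IY_nonneg
  have hlL : 0 ≤ Real.log L := Real.log_nonneg hL
  have hlT : 0 ≤ Real.posLog T := Real.posLog_nonneg
  have hlI : 0 ≤ Real.posLog (IY Y)⁻¹ := Real.posLog_nonneg
  have hlC : 0 ≤ Real.log (1 + C) := Real.log_nonneg (by linarith)
  have hdist : 0 ≤ distortion Y := zero_le_one.trans (le_max_left _ _)
  have hH0 : 0 ≤ HConst Y C := by unfold HConst; positivity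
  have hRHS : 0 ≤ 32 * 8 ^ n * n * (ν + 1) * 2 ^ (∑ m, ℓ m - n) * (distortion Y * HConst Y C
      * (1 + T) * (1 + Real.posLog T + Real.log L) * L ^ (1 - ∑ p, ρ p)) := by positivity
  rw [Finset.sum_comm]
  simp only [← Finset.mul_sum]
  rcases Nat.eq_zero_or_pos N with rfl | hN1
  · have hQe : Q = ∅ := by
      refine Finset.eq_empty_of_forall_notMem fun p hp => ?_
      have h1 := hQ p hp
      exact h1.1 (abs_nonpos_iff.1 (by simpa using h1.2.1))
    rw [hQe, Finset.sum_empty, mul_zero]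
    exact hRHS
  rcases hI0.eq_or_lt with hI | hI
  · have h0 : returnVolume Y ρ L = 0 := by
      rw [returnVolume, ← hI, zero_pow (by omega)]; ring
    rw [h0, zero_mul]
    exact hRHS
  set τ : ℝ := L ^ (-rhoBar ρ) with hτ
  have hτ0 : 0 < τ := Real.rpow_pos_of_pos hL0 _
  have hτ1 : τ ≤ 1 := Real.rpow_le_one_of_one_le_of_nonpos hL (by linarith)
  have hδ := pairDelta_le_iff (α := α) (Y := Y) (ρ := ρ) hL hρ0.ne'
  have hsum := sum_weights_le (isUnit_det_Ybar hY) hD hτ0 hτ1 hn hν hN1 hI IY_le_half hd Q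
    (fun p hp => ⟨(hQ p hp).1, (hQ p hp).2.1, (hδ p _ (by positivity)).1 (hQ p hp).2.2⟩)
    (pairDelta α Y ρ L) hδ (pairDelta_nonneg hL) J
  refine (mul_le_mul_of_nonneg_left hsum (returnVolume_nonneg hL)).trans ?_
  set d := ∑ m, ℓ m - n with hdd
  set q : ℝ := max 1 (IY Y / barI (Ybar Y)) with hq
  set D : ℝ := |(Matrix.of (Ybar Y)).det|⁻¹ with hDdef
  have hD0 : 0 ≤ D := by positivity
  have hq1 : 1 ≤ q := le_max_left _ _
  have hNpos : (0 : ℝ) < N := by exact_mod_cast hN1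
  have hmax : max ((N : ℝ) ^ (1 - 1 / ν)) (N * τ) ≤ (1 + T) * L ^ (1 - rhoBar ρ) :=
    max_rpow_le hν hρ0 hνρ hT hL hNpos.le hN
  have hlogN : Real.log N ≤ Real.posLog T + Real.log L := by
    calc Real.log N ≤ Real.log (T * L) := Real.log_le_log hNpos hN
      _ = Real.log T + Real.log L := Real.log_mul hT.ne' hL0.ne'
      _ ≤ Real.posLog T + Real.log L := add_le_add_left (le_max_right _ _) _
  -- A sum of nonnegative logarithms is separated into a product, as the constant of the theorem
  -- requires.
  have hlogs : 1 + Real.posLog (IY Y)⁻¹ + Real.log (1 + C) + Real.log N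
      ≤ (1 + Real.posLog (IY Y)⁻¹ + Real.log (1 + C)) * (1 + Real.posLog T + Real.log L) := by
    nlinarith [mul_nonneg hlI hlT, mul_nonneg hlI hlL, mul_nonneg hlC hlT, mul_nonneg hlC hlL]
  have hlogs0 : 0 ≤ 1 + Real.posLog (IY Y)⁻¹ + Real.log (1 + C) + Real.log N := by
    have : 0 ≤ Real.log N := Real.log_nonneg (by exact_mod_cast hN1)
    linarith
  have hDq : D * q ^ n ≤ distortion Y := le_max_right _ _
  have hHC : IY Y ^ d * C * (1 + Real.posLog (IY Y)⁻¹ + Real.log (1 + C)) ≤ HConst Y C := by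
    have h1 : IY Y ^ d * C * (1 + Real.posLog (IY Y)⁻¹ + Real.log (1 + C))
        ≤ IY Y ^ d * (1 + C) * (1 + Real.posLog (IY Y)⁻¹ + Real.log (1 + C)) := by
      gcongr; linarith
    exact h1.trans (le_add_of_nonneg_left zero_le_one)
  have hLpow : L ^ (-∑ q : JDer ℓ, ρ q.1) * L ^ (1 - rhoBar ρ) = L ^ (1 - ∑ p, ρ p) := by
    rw [← Real.rpow_add hL0, sum_eq_rhoBar_add]
    congr 1
    ring
  have hm0 : 0 ≤ max ((N : ℝ) ^ (1 - 1 / ν)) (N * τ) := le_max_of_le_left (by positivity)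
  calc returnVolume Y ρ L * (32 * 8 ^ n * n * (ν + 1) * (q ^ n *
        (C * max ((N : ℝ) ^ (1 - 1 / ν)) (N * τ)) *
        (1 + Real.posLog (IY Y)⁻¹ + Real.log (1 + C) + Real.log N)))
      ≤ returnVolume Y ρ L * (32 * 8 ^ n * n * (ν + 1) * (q ^ n *
        (C * ((1 + T) * L ^ (1 - rhoBar ρ))) *
        ((1 + Real.posLog (IY Y)⁻¹ + Real.log (1 + C)) * (1 + Real.posLog T + Real.log L)))) := by
        refine mul_le_mul_of_nonneg_left ?_ (returnVolume_nonneg hL)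
        gcongr
    _ = 32 * 8 ^ n * n * (ν + 1) * 2 ^ d * ((D * q ^ n) *
        (IY Y ^ d * C * (1 + Real.posLog (IY Y)⁻¹ + Real.log (1 + C))) * (1 + T) *
        (1 + Real.posLog T + Real.log L) *
        (L ^ (-∑ q : JDer ℓ, ρ q.1) * L ^ (1 - rhoBar ρ))) := by
        rw [returnVolume]; ring
    _ ≤ _ := by
        rw [hLpow]
        gcongr

theorem lintegral_HFun_le (hn : 0 < n) (hd : 1 ≤ ∑ m, ℓ m - n) {ν : ℝ} (hν : 1 ≤ ν)
    (hρ : ∀ p, 0 ≤ ρ p) (hρ0 : 0 < rhoBar ρ) (hνρ : ν ≤ 1 / rhoBar ρ) {C : ℝ}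
    (hD : IsDiophantineWith (Ybar Y) (fun m => ρ ⟨m, 0⟩ / rhoBar ρ) ν (fun m => α ⟨m, 0⟩) C)
    (hT : 0 < T) (hL : 1 ≤ L) :
    ∫⁻ x, ENNReal.ofReal (HFun α Y ρ T L x) ∂(nilMeasure ℓ) ≤
      ENNReal.ofReal (1 + 32 * 8 ^ n * n * (ν + 1) * 2 ^ (∑ m, ℓ m - n) *
        (distortion Y * HConst Y C * (1 + T) * (1 + Real.posLog T + Real.log L)
          * L ^ (1 - ∑ p, ρ p))) := by
  classical
  have hL0 : 0 < L := by linarith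
  have hTL : 0 ≤ ⌊T * L⌋ := Int.floor_nonneg.2 (by positivity)
  set N : ℕ := ⌊T * L⌋.toNat with hN
  have hNZ : (N : ℤ) = ⌊T * L⌋ := Int.toNat_of_nonneg hTL
  have hNR : (N : ℝ) ≤ T * L := by
    have h1 : ((N : ℤ) : ℝ) = (⌊T * L⌋ : ℝ) := by rw [hNZ]
    rw [Int.cast_natCast] at h1
    rw [h1]
    exact Int.floor_le _
  set RHS : ℝ := 32 * 8 ^ n * n * (ν + 1) * 2 ^ (∑ m, ℓ m - n) *
    (distortion Y * HConst Y C * (1 + T) * (1 + Real.posLog T + Real.log L)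
      * L ^ (1 - ∑ p, ρ p)) with hRHS
  have hfin : {p : ℤ × (Fin n → ℤ) | p.1 ≠ 0 ∧ |p.1| ≤ N ∧
      pairDelta α Y ρ L p ≤ IY Y / 2}.Finite := by
    refine (finite_returnPairs (α := fun m => α ⟨m, 0⟩) (σ := fun m => ρ ⟨m, 0⟩ / rhoBar ρ)
      (τ := L ^ (-rhoBar ρ)) (isUnit_det_Ybar hY) N (IY Y / 2)).subset ?_
    rintro p ⟨_, h2, h3⟩
    exact ⟨h2, (pairDelta_le_iff hL hρ0.ne' p _ (div_nonneg IY_nonneg zero_le_two)).1 h3⟩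
  set Q := hfin.toFinset with hQdef
  have hQ : ∀ p ∈ Q, p.1 ≠ 0 ∧ |p.1| ≤ N ∧ pairDelta α Y ρ L p ≤ IY Y / 2 :=
    fun p hp => hfin.mem_toFinset.1 hp
  set U : ℕ → ℤ × (Fin n → ℤ) → ℝ := fun j p => returnVolume Y ρ L *
    min 1 ((2 / pairDelta α Y ρ L p) ^ n / 2 ^ ((j + 1) * (∑ m, ℓ m - n))) with hU
  have hU0 : ∀ j p, 0 ≤ U j p := fun j p => by
    have h1 := pairDelta_nonneg (α := α) (Y := Y) (ρ := ρ) hL p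
    have h2 := returnVolume_nonneg (Y := Y) (ρ := ρ) hL
    positivity
  set R : Finset ℤ := (Finset.Icc (-⌊T * L⌋) ⌊T * L⌋).erase 0 with hR
  have hterm : ∀ r ∈ R, ∫⁻ x, ENNReal.ofReal (hFun α Y ρ r L x) ∂(nilMeasure ℓ)
      ≤ ∑' j, ∑ p ∈ Q.filter (fun p => p.1 = r), ENNReal.ofReal (U j p) := by
    intro r hr
    obtain ⟨hr0, hrN⟩ := Finset.mem_erase.1 hr
    rw [Finset.mem_Icc, ← hNZ] at hrN
    refine (lintegral_mono (ofReal_hFun_le ρ r L hL0.le)).trans ?_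
    rw [lintegral_tsum fun j => (measurable_hTerm hY ρ r L j).ennreal_ofReal.aemeasurable]
    refine ENNReal.tsum_le_tsum fun j => lintegral_hTerm_le hY hn hL hρ hr0 j _ fun p hp1 hp2 => ?_
    refine Finset.mem_filter.2 ⟨hfin.mem_toFinset.2 ⟨hp1 ▸ hr0, ?_, hp2⟩, hp1⟩
    rw [hp1]
    exact abs_le.2 hrN
  -- The pairs are fibred by their first entry, so the sums over `r` merge into one sum over `Q`, to
  -- which the Diophantine count applies.
  have hsumR : ∑ r ∈ R, ∑' j, ∑ p ∈ Q.filter (fun p => p.1 = r), ENNReal.ofReal (U j p)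
      = ∑' j, ∑ p ∈ Q, ENNReal.ofReal (U j p) := by
    rw [← Summable.tsum_finsetSum fun _ _ => ENNReal.summable]
    refine tsum_congr fun j => ?_
    refine Finset.sum_fiberwise_of_maps_to (fun p hp => ?_) _
    have h := hQ p hp
    rw [hR, Finset.mem_erase, Finset.mem_Icc, ← hNZ]
    exact ⟨h.1, abs_le.1 h.2.1⟩
  have htot : ∑' j, ∑ p ∈ Q, ENNReal.ofReal (U j p) ≤ ENNReal.ofReal RHS := by
    refine ENNReal.tsum_le_of_sum_range_le fun J => ?_
    simp only [← ENNReal.ofReal_sum_of_nonneg fun p (_ : p ∈ Q) => hU0 _ p]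
    rw [← ENNReal.ofReal_sum_of_nonneg fun j _ => Finset.sum_nonneg fun p _ => hU0 j p]
    exact ENNReal.ofReal_le_ofReal (sum_pairs_le hY hn hd hν hρ0 hνρ hD hT hL hNR Q hQ J)
  have hRHS0 : 0 ≤ RHS := by
    have h := sum_pairs_le hY hn hd hν hρ0 hνρ hD hT hL hNR Q hQ 0
    rwa [Finset.range_zero, Finset.sum_empty] at h
  have hH : ∀ x, ENNReal.ofReal (HFun α Y ρ T L x)
      = 1 + ∑ r ∈ R, ENNReal.ofReal (hFun α Y ρ r L x) := by
    intro x
    have h0 : ∀ r ∈ R, 0 ≤ hFun α Y ρ r L x := fun r _ => hFun_nonneg ρ r L hL0.le x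
    rw [HFun, ENNReal.ofReal_add zero_le_one (Finset.sum_nonneg h0), ENNReal.ofReal_one,
      ENNReal.ofReal_sum_of_nonneg h0]
  simp only [hH]
  rw [lintegral_add_left measurable_const, lintegral_one, measure_univ,
    lintegral_finsetSum _ fun r _ => (measurable_hFun hY ρ r L hL0.le).ennreal_ofReal,
    ENNReal.ofReal_add zero_le_one hRHS0, ENNReal.ofReal_one]
  exact add_le_add_right ((Finset.sum_le_sum hterm).trans (hsumR.trans_le htot)) _

end Final

end QuasiAbelian

open QuasiAbelian in
theorem theorem5 (n a : ℕ) (hna : n < a) (ν : ℝ) (hν : 1 ≤ ν) :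
    ∃ K' : ℝ, 0 < K' ∧
      ∀ (ℓ : Fin n → ℕ) [∀ m, NeZero (ℓ m)], ∑ m, ℓ m = a →
      ∀ (α : JIdx ℓ → ℝ) (Y : JIdx ℓ → QALie ℓ), IsNormalisedStronglyAdapted (Xvec α) Y →
      ∀ ρ : JIdx ℓ → ℝ, (∀ p, 0 ≤ ρ p ∧ ρ p < 1) → ν ≤ 1 / rhoBar ρ →
      ∀ C : ℝ, IsDiophantineWith (Ybar Y) (fun m => ρ ⟨m, 0⟩ / rhoBar ρ) ν
          (fun m => α ⟨m, 0⟩) C →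
      ∀ T L : ℝ, 0 < T → 1 ≤ L →
        Integrable (HFun α Y ρ T L) (nilMeasure ℓ) ∧
        |∫ x, HFun α Y ρ T L x ∂(nilMeasure ℓ)| ≤
          K' * max 1 (distortion Y * HConst Y C * (1 + T)
            * (1 + Real.posLog T + Real.log L) * L ^ (1 - ∑ p, ρ p)) := by
  have hK0 : 0 ≤ 32 * 8 ^ n * n * (ν + 1) * 2 ^ (a - n) := by positivity
  -- The summand `1` pays for the constant `1` in `H`, through `1 + K₀ Z ≤ (1 + K₀) max(1, Z)`.
  refine ⟨1 + 32 * 8 ^ n * n * (ν + 1) * 2 ^ (a - n), by linarith, ?_⟩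
  intro ℓ _ hℓ α Y hY ρ hρ hνρ C hD T L hT hL
  have hn : 0 < n := by
    rcases Nat.eq_zero_or_pos n with rfl | h
    · simp at hℓ
      omega
    · exact h
  have hL0 : 0 ≤ L := by linarith
  -- If `|ρ̄| = 0`, the weights `ρ_i / |ρ̄|` would be `0` by the convention for division, against
  -- their positivity.
  have hρ0 : 0 < rhoBar ρ := by
    refine lt_of_le_of_ne (Finset.sum_nonneg fun m _ => (hρ _).1) fun h => ?_
    have := hD.weight_pos ⟨0, hn⟩
    rw [← h, div_zero] at this
    exact lt_irrefl _ this
  subst hℓ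
  have hmain := lintegral_HFun_le hY hn (by omega) hν (fun p => (hρ p).1) hρ0 hνρ hD hT hL
  set K₀ := 32 * 8 ^ n * n * (ν + 1) * 2 ^ (∑ m, ℓ m - n) with hK₀
  set Z := distortion Y * HConst Y C * (1 + T) * (1 + Real.posLog T + Real.log L)
    * L ^ (1 - ∑ p, ρ p) with hZ
  have hH0 : ∀ x, 0 ≤ HFun α Y ρ T L x := fun x =>
    add_nonneg zero_le_one (Finset.sum_nonneg fun r _ => hFun_nonneg ρ r L hL0 x)
  have hHm : Measurable (HFun α Y ρ T L) :=
    measurable_const.add (Finset.measurable_fun_sum _ fun r _ => measurable_hFun hY ρ r L hL0)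
  have hint : Integrable (HFun α Y ρ T L) (nilMeasure ℓ) := by
    refine ⟨hHm.aestronglyMeasurable, ?_⟩
    rw [hasFiniteIntegral_iff_ofReal (Filter.Eventually.of_forall hH0)]
    exact hmain.trans_lt ENNReal.ofReal_lt_top
  refine ⟨hint, ?_⟩
  have hbound : 1 + K₀ * Z ≤ (1 + K₀) * max 1 Z := by
    have h1 : K₀ * Z ≤ K₀ * max 1 Z := mul_le_mul_of_nonneg_left (le_max_right _ _) hK0
    have h2 : 1 ≤ max 1 Z := le_max_left _ _
    linarith
  rw [abs_of_nonneg (integral_nonneg hH0), integral_eq_lintegral_of_nonneg_ae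
    (Filter.Eventually.of_forall hH0) hHm.aestronglyMeasurable]
  refine ENNReal.toReal_le_of_le_ofReal (by positivity) (hmain.trans ?_)
  exact ENNReal.ofReal_le_ofReal hbound
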